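/- Let $M$ be a smooth Riemannian manifold of dimension $n$ (without boundary), let $E\to M$ be a smooth real vector bundle of finite rank with a smooth fibre metric, and let $\nabla$ be a smooth connection on $E$ that is compatible with the metric. Let $0\le k\le n$ and let $\phi$ be a smooth section of $\Lambda^kT^*M\otimes E$. Write $\nabla\phi$ for its covariant derivative with respect to the tensor product of the Levi-Civita connection on $\Lambda^kT^*M$ and the connection on $E$, $d^\nabla$ for the covariant exterior derivative of $\nabla$ on $E$-valued forms, and $(d^\nabla)^*$ for the formal adjoint of $d^\nabla$ (equal to $0$ on forms of degree $0$). All norms are the pointwise ones induced by the two metrics, normalised so that the forms $e^{j_1}\wedge\dots\wedge e^{j_k}$, $j_1<\dots<j_k$, are orthonormal whenever $(e^j)$ is an orthonormal coframe. Fix constants $c\ge 0$ and $c_*\ge 0$, and let $x\in M$ be a point with $\phi(x)\neq 0$. Then at $x$ $$|\nabla\phi|^2+c\,|d^\nabla\phi|^2+c_*\,|(d^\nabla)^*\phi|^2\ \ge\ \bigl(1+\min\{\tilde c,\tilde c_*\}\bigr)\,\bigl|d|\phi|\bigr|^2,$$ where $$\tilde c=\begin{cases}\dfrac1k & \text{if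 } (d^\nabla\phi)_x=0,\\[2mm] \dfrac{c}{1+kc} & \text{if } (d^\nabla\phi)_x\ne0,\end{cases}\qquad \tilde c_*=\begin{cases}\dfrac1{n-k} & \text{if } ((d^\nabla)^*\phi)_x=0,\\[2mm] \dfrac{c_*}{1+(n-k)c_*} & \text{if } ((d^\nabla)^*\phi)_x\neq0.\end{cases}$$ (The expression $1/0$ can occur only for $k=0$ or $k=n$, and then only where $\nabla\phi$ vanishes at $x$, so that both sides are $0$ whatever value it is given.) -/

import Mathlib

open Bundle Manifold MeasureTheory
open scoped ContDiff Topology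

noncomputable section

namespace TwistedForm

section Tangent

variable {n : ℕ} {M : Type*} [TopologicalSpace M] [ChartedSpace (EuclideanSpace ℝ (Fin n)) M]
  [IsManifold (𝓡 n) ∞ M]

/-- A vector field on `M` that is smooth near `x` and takes the value `v` at `x`. -/
abbrev ext {x : M} (v : TangentSpace (𝓡 n) x) : Π y : M, TangentSpace (𝓡 n) y :=
  FiberBundle.extend (EuclideanSpace ℝ (Fin n)) v

variable [RiemannianBundle (fun x : M ↦ TangentSpace (𝓡 n) x)]

/-- An orthonormal basis of the tangent space at `x`. -/
def frame (x : M) : OrthonormalBasis (Fin n) ℝ (TangentSpace (𝓡 n) x) :=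
  haveI : FiniteDimensional ℝ (TangentSpace (𝓡 n) x) :=
    inferInstanceAs (FiniteDimensional ℝ (EuclideanSpace ℝ (Fin n)))
  (stdOrthonormalBasis ℝ (TangentSpace (𝓡 n) x)).reindex
    (finCongr (finrank_euclideanSpace_fin (𝕜 := ℝ) (n := n)))

/-- The right-hand side of the Koszul formula: `2 ⟨∇_X Y, Z⟩` at the point `x` for the
Levi-Civita connection `∇`. -/
def koszul (X Y Z : Π x : M, TangentSpace (𝓡 n) x) (x : M) : ℝ :=
  mvfderiv (𝓡 n) (fun y ↦ inner ℝ (Y y) (Z y)) x (X x)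
    + mvfderiv (𝓡 n) (fun y ↦ inner ℝ (X y) (Z y)) x (Y x)
    - mvfderiv (𝓡 n) (fun y ↦ inner ℝ (X y) (Y y)) x (Z x)
    + inner ℝ (VectorField.mlieBracket (𝓡 n) X Y x) (Z x)
    - inner ℝ (VectorField.mlieBracket (𝓡 n) X Z x) (Y x)
    - inner ℝ (VectorField.mlieBracket (𝓡 n) Y Z x) (X x)

/-- The Levi-Civita connection: `leviCivita Y x v` is `∇_v Y ∈ T_x M`. Its inner product with each
vector `e_i` of an orthonormal basis is given by the Koszul formula. -/
def leviCivita (Y : Π x : M, TangentSpace (𝓡 n) x) (x : M) (v : TangentSpace (𝓡 n) x) :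
    TangentSpace (𝓡 n) x :=
  ∑ i, ((1 / 2 : ℝ) * koszul (ext v) Y (ext (frame x i)) x) • frame x i

/-- The coordinate vector field `∂_i` of the chart at `p`, at the point with coordinates `u`. -/
def coordVec (p : M) (i : Fin n) (u : EuclideanSpace ℝ (Fin n)) :
    TangentSpace (𝓡 n) ((extChartAt (𝓡 n) p).symm u) :=
  mfderiv (𝓡 n) (𝓡 n) (extChartAt (𝓡 n) p).symm u
    (EuclideanSpace.single i (1 : ℝ) : EuclideanSpace ℝ (Fin n))

/-- The Riemannian volume density `√(det g_ij)` in the chart at `p`. -/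
def volDensity (p : M) (u : EuclideanSpace ℝ (Fin n)) : ℝ :=
  √(Matrix.det (Matrix.of fun i j : Fin n ↦ inner ℝ (coordVec p i u) (coordVec p j u)))

/-- The integral over the domain of the chart at `p` of a function on `M`, with respect to the
Riemannian volume `√(det g_ij) du₁ ⋯ duₙ`. -/
def chartIntegral (p : M) (f : M → ℝ) : ℝ :=
  ∫ u in (extChartAt (𝓡 n) p).target, f ((extChartAt (𝓡 n) p).symm u) * volDensity p u

/-- The squared norm `|df|²` of the differential of a real function at `x`. -/
def diffNormSq (f : M → ℝ) (x : M) : ℝ :=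
  ∑ i, (mvfderiv (𝓡 n) f x (frame x i)) ^ 2

end Tangent

section Forms

variable {n : ℕ} {M : Type*} [TopologicalSpace M] [ChartedSpace (EuclideanSpace ℝ (Fin n)) M]
  [IsManifold (𝓡 n) ∞ M]
  {F : Type*} [NormedAddCommGroup F] [NormedSpace ℝ F]
  {V : M → Type*} [TopologicalSpace (TotalSpace F V)]
  [∀ x, NormedAddCommGroup (V x)] [∀ x, InnerProductSpace ℝ (V x)]
  [FiberBundle F V] [VectorBundle ℝ F V]

/-- Smoothness of a section of `Λ^k T*M ⊗ V`, the bundle of alternating `k`-linear maps on the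
tangent spaces with values in `V`. -/
def IsSmooth (F : Type*) [NormedAddCommGroup F] [NormedSpace ℝ F]
    {V : M → Type*} [TopologicalSpace (TotalSpace F V)]
    [∀ x, NormedAddCommGroup (V x)] [∀ x, InnerProductSpace ℝ (V x)]
    [FiberBundle F V] [VectorBundle ℝ F V] {k : ℕ}
    (φ : Π x : M, TangentSpace (𝓡 n) x [⋀^Fin k]→L[ℝ] V x) : Prop :=
  ContMDiff (𝓡 n) ((𝓡 n).prod 𝓘(ℝ, EuclideanSpace ℝ (Fin n) [⋀^Fin k]→L[ℝ] F)) ∞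
    (fun x ↦ TotalSpace.mk' (EuclideanSpace ℝ (Fin n) [⋀^Fin k]→L[ℝ] F)
      (E := fun x : M ↦ TangentSpace (𝓡 n) x [⋀^Fin k]→L[ℝ] V x) x (φ x))

/-- The covariant exterior derivative `d^∇ φ` at `x`, evaluated on `k + 1` tangent vectors
`w₀, …, w_k` that are extended to vector fields `W₀, …, W_k`:
`∑_i (-1)^i ∇_{W_i} (φ (W₀, …, Ŵ_i, …, W_k))
  + ∑_{i < j} (-1)^(i+j) φ ([W_i, W_j], W₀, …, Ŵ_i, …, Ŵ_j, …, W_k)`.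
In the second sum the bracket is moved to the slot `j - 1` of `W_j` in the list without `W_i`,
which turns the sign `(-1)^(i+j)` into `-(-1)^i`. -/
def covExtDeriv {k : ℕ} (cov : CovariantDerivative (𝓡 n) F V)
    (φ : Π x : M, TangentSpace (𝓡 n) x [⋀^Fin k]→L[ℝ] V x) (x : M)
    (w : Fin (k + 1) → TangentSpace (𝓡 n) x) : V x :=
  ∑ i : Fin (k + 1), (-1 : ℝ) ^ (i : ℕ) •
    (cov (fun y ↦ φ y (fun a ↦ ext (w (i.succAbove a)) y)) x (w i)
      - ∑ a : Fin k, if i ≤ a.castSucc then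
          φ x (Function.update (fun b ↦ w (i.succAbove b)) a
            (VectorField.mlieBracket (𝓡 n) (ext (w i)) (ext (w (i.succAbove a))) x))
        else 0)

variable [RiemannianBundle (fun x : M ↦ TangentSpace (𝓡 n) x)]

/-- The covariant derivative `∇_v φ` (Levi-Civita connection on `Λ^k T*M` tensored with the
connection of `V`), evaluated on `k` tangent vectors `w₁, …, w_k` extended to vector fields `W_a`:
`∇_v (φ (W₁, …, W_k)) - ∑_a φ (W₁, …, ∇_v W_a, …, W_k)`. -/
def nabla {k : ℕ} (cov : CovariantDerivative (𝓡 n) F V)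
    (φ : Π x : M, TangentSpace (𝓡 n) x [⋀^Fin k]→L[ℝ] V x) (x : M)
    (v : TangentSpace (𝓡 n) x) (w : Fin k → TangentSpace (𝓡 n) x) : V x :=
  cov (fun y ↦ φ y (fun a ↦ ext (w a) y)) x v
    - ∑ a : Fin k, φ x (Function.update w a (leviCivita (ext (w a)) x v))

/-- The inner product of `Λ^k T*_x M ⊗ V_x`, for which the `e^{j_1} ∧ ⋯ ∧ e^{j_k} ⊗ s`,
`j_1 < ⋯ < j_k`, are orthonormal when `e` and the `s` are: the sum over all multi-indices,
divided by `k!`. -/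
def formInner {k : ℕ} (x : M) (α β : (Fin k → TangentSpace (𝓡 n) x) → V x) : ℝ :=
  (1 / (k.factorial : ℝ)) *
    ∑ J : Fin k → Fin n, inner ℝ (α fun a ↦ frame x (J a)) (β fun a ↦ frame x (J a))

/-- The squared norm `|∇φ|²` at `x`, in `T*_x M ⊗ Λ^k T*_x M ⊗ V_x`. -/
def nablaNormSq {k : ℕ} (cov : CovariantDerivative (𝓡 n) F V)
    (φ : Π x : M, TangentSpace (𝓡 n) x [⋀^Fin k]→L[ℝ] V x) (x : M) : ℝ :=
  ∑ i, formInner x (nabla cov φ x (frame x i)) (nabla cov φ x (frame x i))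

/-- `ψ` is the image of the `(k + 1)`-form `φ` under the formal adjoint of `d^∇`: it is smooth and
`∫ ⟨d^∇ η, φ⟩ = ∫ ⟨η, ψ⟩` for all smooth `k`-forms `η` with compact support in the domain of a
chart. -/
def IsAdjointImage {k : ℕ} (cov : CovariantDerivative (𝓡 n) F V)
    (φ : Π x : M, TangentSpace (𝓡 n) x [⋀^Fin (k + 1)]→L[ℝ] V x)
    (ψ : Π x : M, TangentSpace (𝓡 n) x [⋀^Fin k]→L[ℝ] V x) : Prop :=
  IsSmooth F ψ ∧
    ∀ (p : M) (η : Π x : M, TangentSpace (𝓡 n) x [⋀^Fin k]→L[ℝ] V x), IsSmooth F η →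
      (∃ K : Set M, IsCompact K ∧ K ⊆ (chartAt (EuclideanSpace ℝ (Fin n)) p).source ∧
        ∀ y ∉ K, η y = 0) →
      chartIntegral (n := n) p (fun y ↦ formInner y (covExtDeriv cov η y) (φ y))
        = chartIntegral (n := n) p (fun y ↦ formInner y (η y) (ψ y))

open Classical in
/-- The formal adjoint `(d^∇)* φ` of the covariant exterior derivative. On forms of degree `0` it
is `0` (there are no forms of degree `-1`). -/
def covCodiff (cov : CovariantDerivative (𝓡 n) F V) : {k : ℕ} →
    (φ : Π x : M, TangentSpace (𝓡 n) x [⋀^Fin k]→L[ℝ] V x) →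
    Π x : M, TangentSpace (𝓡 n) x [⋀^Fin (k - 1)]→L[ℝ] V x
  | 0, _ => fun _ ↦ 0
  | _ + 1, φ => if h : ∃ ψ, IsAdjointImage cov φ ψ then h.choose else fun _ ↦ 0

end Forms

open Classical in
/-- `1 / m` if `P` holds and `c / (1 + m c)` otherwise. -/
def katoConst (P : Prop) (m c : ℝ) : ℝ := if P then 1 / m else c / (1 + m * c)

end TwistedForm

end

/-!
The inequality is pointwise linear algebra applied to the tensor `α = ∇φ` at `x`, once the two
first order operators have been expressed by `∇`.

The algebra. Let `f = φ / |φ|` and `ξ = d|φ|`. As the connection is metric, `⟨∇_v φ, f⟩ = ξ(v)`, so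
`⟨α, ξ ⊗ f⟩ = |ξ|²`, and Cauchy-Schwarz gives the usual Kato inequality `|α|² ≥ |ξ|²`. Equality
would force `α = ξ ⊗ f`, whose wedge product is `ξ ∧ f` and whose trace is `ι_ξ f`, and by the
Clifford identity `|ξ ∧ f|² + |ι_ξ f|² = |ξ|²` (`arrayInner_wedge_add_trace`) these cannot both be
small. To use this, `ξ ⊗ f` is corrected in `kato_array` by multiples of the images of `ξ ∧ f` and
`ι_ξ f` under the adjoints of the wedge product and of the trace, which are orthogonal to each other
and have squared norms `(k + 1) |ξ ∧ f|²` and `(n - k + 1) |ι_ξ f|²`. The best multiples, found in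
`weighted_cauchy_bound`, lead to the constants `c / (1 + k c)` and `c_* / (1 + (n - k) c_*)`. If
`d^∇ φ` or `(d^∇)* φ` vanishes at `x`, its coefficient is arbitrary, and letting it tend to infinity
improves the constant to `1 / k` or `1 / (n - k)` (`min_katoConst_mul_le`).

The operators. The Levi-Civita connection is metric and torsion free by the Koszul formula
(`mvfderiv_inner_leviCivita`, `leviCivita_sub_swap`). As it is torsion free, `d^∇ φ` is the wedge
product of `∇φ` (`covExtDeriv_eq_sum_nabla`). The formal adjoint is defined by an integral identity,
and has to be identified with `-∑_i (∇_{e_i} φ)(e_i, …)` (`covCodiff_eq_codiffForm`). The difference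
of the two integrands `⟨d^∇ η, φ⟩` and `⟨η, (d^∇)* φ⟩` is the divergence of the vector field
`∑_i ⟨η, φ(e_i, …)⟩ e_i` (`divergence_adjointField`), whose integral over a chart is zero
(`chartIntegral_divergence`): in coordinates `√(det g) div X = ∑_i ∂_i (√(det g) X^i)`, by Jacobi's
formula for the derivative of a determinant. Conversely, the integral identity determines the
adjoint, by testing with a bump function times the difference of two candidates
(`IsAdjointImage.unique`).
-/

set_option linter.unusedSectionVars false

noncomputable section

namespace TwistedForm

/-! ### The algebraic inequality, in components -/

section Arrays

variable {n k : ℕ} {H : Type*} [NormedAddCommGroup H] [InnerProductSpace ℝ H]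

/-- The inner product of two `k`-forms with values in `H`, given by their components
`a J = α (e_{J 0}, …, e_{J (k-1)})` in an orthonormal basis. All multi-indices `J` are used, not
only the increasing ones, hence the division by `k!`. -/
def arrayInner (a b : (Fin k → Fin n) → H) : ℝ :=
  (1 / (k.factorial : ℝ)) * ∑ J, inner ℝ (a J) (b J)

/-- The components `a J` are skew-symmetric in the multi-index `J`. -/
def IsAltArray (a : (Fin k → Fin n) → H) : Prop :=
  ∀ (σ : Equiv.Perm (Fin k)) (J : Fin k → Fin n), a (J ∘ σ) = Equiv.Perm.sign σ • a J

/-- The components of `∑_i e^i ∧ α i`. For `α i = ∇_{e_i} φ` these are the components of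
`d^∇ φ`. -/
def wedgeArray (α : Fin n → (Fin k → Fin n) → H) (J : Fin (k + 1) → Fin n) : H :=
  ∑ a : Fin (k + 1), (-1 : ℝ) ^ (a : ℕ) • α (J a) (a.removeNth J)

/-- The components of the contraction of `β` with `e_i`, the adjoint of `e^i ∧ ·`. -/
def curryArray (β : (Fin (k + 1) → Fin n) → H) (i : Fin n) (J : Fin k → Fin n) : H :=
  β (Fin.cons i J)

/-- The components of the sum over `i` of the contractions of `α i` with `e_i`. For
`α i = ∇_{e_i} φ` these are the components of `-(d^∇)* φ`. -/
def traceArray (α : Fin n → (Fin (k + 1) → Fin n) → H) (K : Fin k → Fin n) : H :=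
  ∑ i, α i (Fin.cons i K)

/-- The components of `e^i ∧ β`. As a family in `i`, this is the adjoint of `traceArray`. -/
def traceAdjArray (β : (Fin k → Fin n) → H) (i : Fin n) (J : Fin (k + 1) → Fin n) : H :=
  ∑ a : Fin (k + 1), (-1 : ℝ) ^ (a : ℕ) • if J a = i then β (a.removeNth J) else 0

lemma IsAltArray.insertNth {β : (Fin (k + 1) → Fin n) → H} (h : IsAltArray β) (a : Fin (k + 1))
    (i : Fin n) (K : Fin k → Fin n) :
    β (a.insertNth i K) = (-1 : ℝ) ^ (a : ℕ) • β (Fin.cons i K) := by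
  have : a.insertNth (α := fun _ ↦ Fin n) i K = Fin.cons i K ∘ a.cycleRange := by
    ext b
    refine Fin.succAboveCases a ?_ (fun c ↦ ?_) b <;> simp
  rw [this, h, Fin.sign_cycleRange]
  rcases neg_one_pow_eq_or ℤˣ a with h1 | h1 <;> rcases Nat.even_or_odd (a : ℕ) with h2 | h2 <;>
    simp_all [h2.neg_one_pow]

lemma sum_insertNth {A : Type*} [AddCommMonoid A] (a : Fin (k + 1))
    (f : (Fin (k + 1) → Fin n) → A) :
    ∑ J, f J = ∑ i, ∑ K, f (a.insertNth i K) := by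
  rw [← (Fin.insertNthEquiv (fun _ ↦ Fin n) a).sum_comp, Fintype.sum_prod_type]
  rfl

/-- `wedgeArray` and `curryArray` are adjoint to each other. -/
lemma arrayInner_wedge (α : Fin n → (Fin k → Fin n) → H) {β : (Fin (k + 1) → Fin n) → H}
    (h : IsAltArray β) :
    arrayInner (wedgeArray α) β = ∑ i, arrayInner (α i) (curryArray β i) := by
  have key : ∑ J, inner ℝ (wedgeArray α J) (β J)
      = (k + 1) * ∑ i, ∑ K, inner ℝ (α i K) (curryArray β i K) := by
    simp_rw [wedgeArray, sum_inner]
    rw [Finset.sum_comm]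
    have : ∀ a : Fin (k + 1), ∑ J, inner ℝ ((-1 : ℝ) ^ (a : ℕ) • α (J a) (a.removeNth J)) (β J)
        = ∑ i, ∑ K, inner ℝ (α i K) (curryArray β i K) := by
      intro a
      rw [sum_insertNth a]
      refine Finset.sum_congr rfl fun i _ ↦ Finset.sum_congr rfl fun K _ ↦ ?_
      rw [h.insertNth, inner_smul_left, inner_smul_right]
      simp [curryArray, ← mul_assoc, ← mul_pow]
    simp [this]
  unfold arrayInner
  rw [key, ← Finset.mul_sum, Nat.factorial_succ]
  push_cast
  field_simp

/-- `traceArray` and `traceAdjArray` are adjoint to each other. -/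
lemma arrayInner_trace {α : Fin n → (Fin (k + 1) → Fin n) → H} (h : ∀ i, IsAltArray (α i))
    (β : (Fin k → Fin n) → H) :
    arrayInner (traceArray α) β = ∑ i, arrayInner (α i) (traceAdjArray β i) := by
  have key : ∑ i, ∑ J, inner ℝ (α i J) (traceAdjArray β i J)
      = (k + 1) * ∑ K, inner ℝ (traceArray α K) (β K) := by
    have : ∀ i, ∑ J, inner ℝ (α i J) (traceAdjArray β i J)
        = (k + 1) * ∑ K, inner ℝ (α i (Fin.cons i K)) (β K) := by
      intro i
      simp_rw [traceAdjArray, inner_sum]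
      rw [Finset.sum_comm]
      have : ∀ a : Fin (k + 1), ∑ J, inner ℝ (α i J)
          ((-1 : ℝ) ^ (a : ℕ) • if J a = i then β (a.removeNth J) else 0)
          = ∑ K, inner ℝ (α i (Fin.cons i K)) (β K) := by
        intro a
        rw [sum_insertNth a, Finset.sum_eq_single i]
        · refine Finset.sum_congr rfl fun K _ ↦ ?_
          rw [(h i).insertNth, inner_smul_left, inner_smul_right]
          simp [← mul_assoc, ← mul_pow]
        · intro j _ hj
          simp [hj]
        · simp
      rw [Finset.sum_congr rfl fun a _ ↦ this a]
      simp
    simp_rw [this, ← Finset.mul_sum, traceArray, sum_inner]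
    rw [Finset.sum_comm]
  unfold arrayInner
  rw [← Finset.mul_sum, key, Nat.factorial_succ]
  push_cast
  field_simp

lemma wedge_curry {β : (Fin (k + 1) → Fin n) → H} (h : IsAltArray β) :
    wedgeArray (curryArray β) = (k + 1 : ℝ) • β := by
  ext J
  have : ∀ a : Fin (k + 1), (-1 : ℝ) ^ (a : ℕ) • curryArray β (J a) (a.removeNth J) = β J := by
    intro a
    rw [curryArray, ← h.insertNth, Fin.insertNth_self_removeNth]
  simp [wedgeArray, this, ← Nat.cast_smul_eq_nsmul ℝ]

lemma IsAltArray.cons_cons {β : (Fin (k + 2) → Fin n) → H} (h : IsAltArray β)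
    (i : Fin n) (K : Fin k → Fin n) : β (Fin.cons i (Fin.cons i K)) = 0 := by
  have h1 := h (Equiv.swap 0 1) (Fin.cons i (Fin.cons i K))
  have h2 : (Fin.cons i (Fin.cons i K : Fin (k + 1) → Fin n) : Fin (k + 2) → Fin n) ∘
      (Equiv.swap (0 : Fin (k + 2)) 1) = Fin.cons i (Fin.cons i K) := by
    ext b
    refine Fin.cases ?_ (fun c ↦ Fin.cases ?_ (fun d ↦ ?_) c) b
    · rw [Function.comp_apply, Equiv.swap_apply_left]; rfl
    · rw [Function.comp_apply, show Fin.succ (0 : Fin (k + 1)) = 1 from rfl,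
        Equiv.swap_apply_right]; rfl
    · rw [Function.comp_apply, Equiv.swap_apply_of_ne_of_ne]
      · exact Fin.succ_ne_zero _
      · rw [← Fin.succ_zero_eq_one]
        exact fun hh ↦ Fin.succ_ne_zero _ (Fin.succ_injective _ hh)
  rw [h2, Equiv.Perm.sign_swap (by simp)] at h1
  simp only [Units.neg_smul, one_smul] at h1
  have h3 : (2 : ℝ) • β (Fin.cons i (Fin.cons i K)) = 0 := by
    rw [two_smul]; nth_rewrite 1 [h1]; simp
  simpa using h3

lemma trace_curry {β : (Fin (k + 2) → Fin n) → H} (h : IsAltArray β) :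
    traceArray (curryArray β) = 0 := by
  ext K
  simp [traceArray, curryArray, h.cons_cons]

lemma trace_traceAdj {β : (Fin k → Fin n) → H} (h : IsAltArray β) :
    traceArray (traceAdjArray β) = ((n : ℝ) - k) • β := by
  ext K
  have h0 : ∀ i, traceAdjArray β i (Fin.cons i K) = β K + ∑ b : Fin k, (-1 : ℝ) ^ ((b : ℕ) + 1) •
      if K b = i then β (b.succ.removeNth (α := fun _ ↦ Fin n) (Fin.cons i K)) else 0 := by
    intro i
    simp [traceAdjArray, Fin.sum_univ_succ]
  simp_rw [traceArray, h0, Finset.sum_add_distrib]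
  rw [Finset.sum_comm]
  have h1 : ∀ b : Fin k, ∑ i, (-1 : ℝ) ^ ((b : ℕ) + 1) •
      (if K b = i then β (b.succ.removeNth (α := fun _ ↦ Fin n) (Fin.cons i K)) else 0)
      = - β K := by
    intro b
    rw [Finset.sum_eq_single (K b)]
    · cases k with
      | zero => exact b.elim0
      | succ k =>
        have : b.succ.removeNth (α := fun _ ↦ Fin n) (Fin.cons (K b) K)
            = Fin.cons (K b) (b.removeNth K) := by
          ext c
          refine Fin.cases ?_ (fun d ↦ ?_) c <;> simp [Fin.removeNth]
        rw [if_pos rfl, this, pow_succ, mul_comm, ← smul_smul, ← h.insertNth,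
          Fin.insertNth_self_removeNth]
        simp
    · intro i _ hi
      simp [hi.symm]
    · simp
  rw [Finset.sum_congr rfl fun b _ ↦ h1 b]
  rw [sub_smul]
  simp [← Nat.cast_smul_eq_nsmul ℝ, sub_eq_add_neg]

/-- A skew-symmetric array is the array of components of an alternating map. This transfers the skew
symmetry of wedge products and contractions from alternating maps to arrays. -/
lemma IsAltArray.exists_alternatingMap {a : (Fin k → Fin n) → H} (h : IsAltArray a) :
    ∃ A : (Fin n → ℝ) [⋀^Fin k]→ₗ[ℝ] H, ∀ J, A (fun b ↦ Pi.single (J b) 1) = a J := by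
  classical
  let m : MultilinearMap ℝ (fun _ : Fin k ↦ Fin n → ℝ) H :=
    ∑ J : Fin k → Fin n,
      (MultilinearMap.mkPiRing ℝ (Fin k) (a J)).compLinearMap fun b ↦ LinearMap.proj (J b)
  have hm : ∀ v, m v = ∑ J : Fin k → Fin n, (∏ b, v b (J b)) • a J := by
    intro v; simp [m]
  refine ⟨{ m with map_eq_zero_of_eq' := ?_ }, ?_⟩
  · intro v i j hv hij
    change m v = 0
    have h1 : m v = - m v := by
      conv_lhs => rw [hm]
      rw [hm, ← Finset.sum_neg_distrib,
        ← (Equiv.arrowCongr (Equiv.swap i j) (Equiv.refl (Fin n))).sum_comp]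
      refine Finset.sum_congr rfl fun J _ ↦ ?_
      have : (Equiv.arrowCongr (Equiv.swap i j) (Equiv.refl (Fin n))) J = J ∘ Equiv.swap i j := by
        ext; simp [Equiv.arrowCongr]
      rw [this, h, Equiv.Perm.sign_swap hij, ← Equiv.prod_comp (Equiv.swap i j)]
      have h2 : ∀ b, v (Equiv.swap i j b) = v b := by
        intro b
        rcases eq_or_ne b i with rfl | hb
        · simp [hv]
        rcases eq_or_ne b j with rfl | hb'
        · simp [hv]
        · rw [Equiv.swap_apply_of_ne_of_ne hb hb']
      simp [h2]
    have h3 : (2 : ℝ) • m v = 0 := by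
      rw [two_smul]; nth_rewrite 1 [h1]; simp
    simpa using h3
  · intro J
    change m _ = _
    rw [hm, Finset.sum_eq_single J]
    · simp
    · intro J' _ hJ
      obtain ⟨b, hb⟩ := Function.ne_iff.1 hJ
      rw [Finset.prod_eq_zero (Finset.mem_univ b), zero_smul]
      rw [Pi.single_eq_of_ne hb]
    · simp

lemma IsAltArray.wedge {α : Fin n → (Fin k → Fin n) → H} (h : ∀ i, IsAltArray (α i)) :
    IsAltArray (wedgeArray α) := by
  choose A hA using fun i ↦ (h i).exists_alternatingMap
  let f : (Fin n → ℝ) →ₗ[ℝ] (Fin n → ℝ) [⋀^Fin k]→ₗ[ℝ] H :=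
    ∑ i, (LinearMap.proj i : (Fin n → ℝ) →ₗ[ℝ] ℝ).smulRight (A i)
  have key : ∀ J, wedgeArray α J
      = AlternatingMap.alternatizeUncurryFin f (fun b ↦ Pi.single (J b) (1 : ℝ)) := by
    intro J
    rw [AlternatingMap.alternatizeUncurryFin_apply, wedgeArray]
    refine Finset.sum_congr rfl fun a _ ↦ ?_
    rw [← hA]
    have : f (Pi.single (J a) (1 : ℝ)) = A (J a) := by
      simp only [f, LinearMap.sum_apply, LinearMap.smulRight_apply, LinearMap.proj_apply]
      rw [Finset.sum_eq_single (J a)] <;> simp +contextual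
    rw [this]
    have hs : ∀ v : H, (-1 : ℝ) ^ (a : ℕ) • v = (-1 : ℤ) ^ (a : ℕ) • v := by
      rcases Nat.even_or_odd (a : ℕ) with h2 | h2 <;> simp [h2.neg_one_pow]
    rw [hs]
    rfl
  intro σ J
  rw [key, key, ← AlternatingMap.map_perm]
  rfl

lemma IsAltArray.smul {a : (Fin k → Fin n) → H} (h : IsAltArray a) (r : ℝ) :
    IsAltArray (r • a) := by
  intro σ J
  simp only [Pi.smul_apply, h σ J]
  rw [smul_comm]

lemma IsAltArray.curry {a : (Fin (k + 1) → Fin n) → H} (h : IsAltArray a) (i : Fin n) :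
    IsAltArray (curryArray a i) := by
  obtain ⟨A, hA⟩ := h.exists_alternatingMap
  have key : ∀ J, curryArray a i J
      = A.curryLeft (Pi.single i 1) (fun b ↦ Pi.single (J b) (1 : ℝ)) := by
    intro J
    rw [curryArray, ← hA, AlternatingMap.curryLeft_apply_apply]
    congr 1
    ext b : 1
    refine Fin.cases ?_ (fun c ↦ ?_) b <;> rfl
  intro σ J
  rw [key, key, ← AlternatingMap.map_perm]
  rfl

lemma IsAltArray.traceAdj {a : (Fin k → Fin n) → H} (h : IsAltArray a) (i : Fin n) :
    IsAltArray (traceAdjArray a i) := by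
  have : traceAdjArray a i = wedgeArray fun j ↦ (if j = i then (1 : ℝ) else 0) • a := by
    ext J
    simp [traceAdjArray, wedgeArray, ite_smul]
  rw [this]
  exact .wedge fun j ↦ h.smul _

lemma arrayInner_comm (a b : (Fin k → Fin n) → H) : arrayInner a b = arrayInner b a := by
  simp [arrayInner, real_inner_comm]

lemma arrayInner_sub_left (a b c : (Fin k → Fin n) → H) :
    arrayInner (a - b) c = arrayInner a c - arrayInner b c := by
  simp [arrayInner, inner_sub_left, mul_sub]

lemma arrayInner_sub_right (a b c : (Fin k → Fin n) → H) :
    arrayInner a (b - c) = arrayInner a b - arrayInner a c := by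
  simp [arrayInner, inner_sub_right, mul_sub]

lemma arrayInner_smul_left (r : ℝ) (a b : (Fin k → Fin n) → H) :
    arrayInner (r • a) b = r * arrayInner a b := by
  simp [arrayInner, inner_smul_left, ← Finset.mul_sum]; ring

lemma arrayInner_smul_right (r : ℝ) (a b : (Fin k → Fin n) → H) :
    arrayInner a (r • b) = r * arrayInner a b := by
  simp [arrayInner, inner_smul_right, ← Finset.mul_sum]; ring

lemma arrayInner_self_nonneg (a : (Fin k → Fin n) → H) : 0 ≤ arrayInner a a := by
  unfold arrayInner
  exact mul_nonneg (by positivity) (Finset.sum_nonneg fun J _ ↦ real_inner_self_nonneg)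

/-- The Clifford identity `|ξ ∧ f|² + |ι_ξ f|² = |ξ|² |f|²`. -/
lemma arrayInner_wedge_add_trace {f : (Fin (k + 1) → Fin n) → H} (hf : IsAltArray f)
    (ξ : Fin n → ℝ) :
    arrayInner (wedgeArray fun i ↦ ξ i • f) (wedgeArray fun i ↦ ξ i • f)
      + arrayInner (traceArray fun i ↦ ξ i • f) (traceArray fun i ↦ ξ i • f)
      = (∑ i, ξ i ^ 2) * arrayInner f f := by
  set W := wedgeArray fun i ↦ ξ i • f with hW
  set T := traceArray fun i ↦ ξ i • f with hT
  have hTa : ∀ i, IsAltArray (ξ i • f) := fun i ↦ hf.smul _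
  rw [arrayInner_wedge _ (IsAltArray.wedge hTa), arrayInner_trace hTa, ← Finset.sum_add_distrib]
  have hsum : ∀ J : Fin (k + 1) → Fin n,
      ∑ i, ξ i • (curryArray W i J + traceAdjArray T i J) = (∑ i, ξ i ^ 2) • f J := by
    intro J
    have h1 : ∀ i, curryArray W i J = ξ i • f J
        + ∑ a : Fin (k + 1), (-1 : ℝ) ^ ((a : ℕ) + 1) • ξ (J a) •
          f (Fin.cons i (a.removeNth J)) := by
      intro i
      rw [curryArray, hW, wedgeArray, Fin.sum_univ_succ]
      simp only [Fin.val_zero, pow_zero, one_smul, Fin.cons_zero, Fin.removeNth_zero, Fin.tail_cons,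
        Fin.val_succ, Fin.cons_succ, Pi.smul_apply]
      congr 1
      refine Finset.sum_congr rfl fun a _ ↦ ?_
      congr 3
      ext c
      refine Fin.cases ?_ (fun d ↦ ?_) c <;> simp [Fin.removeNth]
    have h2 : ∑ i, ξ i • traceAdjArray T i J
        = ∑ a : Fin (k + 1), (-1 : ℝ) ^ (a : ℕ) • ξ (J a) • T (a.removeNth J) := by
      simp_rw [traceAdjArray, Finset.smul_sum]
      rw [Finset.sum_comm]
      refine Finset.sum_congr rfl fun a _ ↦ ?_
      rw [Finset.sum_eq_single (J a)]
      · rw [if_pos rfl, smul_comm]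
      · intro i _ hi
        simp [hi.symm]
      · simp
    have h3 : ∑ i, ξ i • ∑ a : Fin (k + 1),
        (-1 : ℝ) ^ ((a : ℕ) + 1) • ξ (J a) • f (Fin.cons i (a.removeNth J))
        = - ∑ a : Fin (k + 1), (-1 : ℝ) ^ (a : ℕ) • ξ (J a) • T (a.removeNth J) := by
      simp_rw [hT, traceArray, Finset.smul_sum]
      rw [Finset.sum_comm, ← Finset.sum_neg_distrib]
      refine Finset.sum_congr rfl fun a _ ↦ ?_
      rw [← Finset.sum_neg_distrib]
      refine Finset.sum_congr rfl fun i _ ↦ ?_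
      simp only [Pi.smul_apply, smul_smul, pow_succ, ← neg_smul]
      congr 1
      ring
    simp_rw [smul_add, Finset.sum_add_distrib, h2, h1, smul_add, Finset.sum_add_distrib, h3]
    simp [smul_smul, Finset.sum_smul, sq]
  have : ∀ i, arrayInner (ξ i • f) (curryArray W i) + arrayInner (ξ i • f) (traceAdjArray T i)
      = (1 / ((k + 1).factorial : ℝ)) *
        ∑ J, inner ℝ (f J) (ξ i • (curryArray W i J + traceAdjArray T i J)) := by
    intro i
    simp only [arrayInner, Pi.smul_apply, inner_smul_left, inner_smul_right, inner_add_right,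
      smul_add, ← mul_add, ← Finset.sum_add_distrib]
    rfl
  rw [Finset.sum_congr rfl fun i _ ↦ this i, ← Finset.mul_sum, Finset.sum_comm]
  simp_rw [← inner_sum, hsum, inner_smul_right, ← Finset.mul_sum]
  rw [arrayInner]
  ring

/-- The numerical part of the refined Kato inequality. With `α` for `∇φ` and a unit form `f`, the
letters stand for `P = |α|²`, `A` and `B` the squared norms of the wedge product and the trace of
`α`, `x` and `y` their inner products with `ξ ∧ f` and `ι_ξ f`, and `a = |ξ ∧ f|²`, `b = |ι_ξ f|²`,
`t = |ξ|²`, where `k` is the degree and `m = n - k`. The hypotheses say that `α - l β`, for `β` the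
combination of `ξ ⊗ f` and its images under the two adjoints, and the corresponding differences of
wedge products and of traces have nonnegative squared norms. -/
lemma weighted_cauchy_bound {P A B x y t a b c cs k m : ℝ} (hc : 0 ≤ c) (hcs : 0 ≤ cs)
    (hk : 0 ≤ k) (hm : 0 ≤ m) (ha : 0 ≤ a) (hb : 0 ≤ b) (hab : a + b = t)
    (h1 : ∀ l m1 m2 : ℝ, 0 ≤ P - 2 * l * (t - m1 * x - m2 * y)
      + l ^ 2 * (t - 2 * m1 * a - 2 * m2 * b + m1 ^ 2 * ((k + 1) * a) + m2 ^ 2 * ((m + 1) * b)))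
    (h2 : ∀ s : ℝ, 0 ≤ A - 2 * s * x + s ^ 2 * a) (h3 : ∀ s : ℝ, 0 ≤ B - 2 * s * y + s ^ 2 * b) :
    (1 + min (c / (1 + k * c)) (cs / (1 + m * cs))) * t ≤ P + c * A + cs * B := by
  have main : ∀ l : ℝ, 2 * l * t - l ^ 2 * (t - c / (1 + c * (k + 1)) * a
      - cs / (1 + cs * (m + 1)) * b) ≤ P + c * A + cs * B := by
    intro l
    have e1 : 0 < 1 + c * (k + 1) := by positivity
    have e2 : 0 < 1 + cs * (m + 1) := by positivity
    -- These multipliers cancel all terms with `x` and `y` in the sum `g1 + g2 + g3`.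
    have g1 := h1 l (c / (1 + c * (k + 1))) (cs / (1 + cs * (m + 1)))
    have g2 := mul_nonneg hc (h2 (l / (1 + c * (k + 1))))
    have g3 := mul_nonneg hcs (h3 (l / (1 + cs * (m + 1))))
    have i1 : c / (1 + c * (k + 1)) = c * (1 / (1 + c * (k + 1))) := by ring
    have i2 : cs / (1 + cs * (m + 1)) = cs * (1 / (1 + cs * (m + 1))) := by ring
    have i3 : l / (1 + c * (k + 1)) = l * (1 / (1 + c * (k + 1))) := by ring
    have i4 : l / (1 + cs * (m + 1)) = l * (1 / (1 + cs * (m + 1))) := by ring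
    rw [i1, i2] at g1 ⊢
    rw [i3] at g2
    rw [i4] at g3
    have j1 : (1 / (1 + c * (k + 1))) * (1 + c * (k + 1)) = 1 := by field_simp
    have j2 : (1 / (1 + cs * (m + 1))) * (1 + cs * (m + 1)) = 1 := by field_simp
    set r := 1 / (1 + c * (k + 1))
    set s := 1 / (1 + cs * (m + 1))
    have k1 : c * r ^ 2 * (1 + c * (k + 1)) = c * r := by linear_combination c * r * j1
    have k2 : cs * s ^ 2 * (1 + cs * (m + 1)) = cs * s := by linear_combination cs * s * j2
    have := add_nonneg (add_nonneg g1 g2) g3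
    refine le_of_sub_nonneg (this.trans_eq ?_)
    linear_combination l ^ 2 * a * k1 + l ^ 2 * b * k2
  have d1 : 0 < 1 + k * c := by positivity
  have d2 : 0 < 1 + m * cs := by positivity
  set q := min (c / (1 + k * c)) (cs / (1 + m * cs)) with hq
  have q0 : 0 ≤ q := le_min (by positivity) (by positivity)
  -- `q / (1 + q)` is the minimum of the two coefficients in `main`.
  have q1 : q / (1 + q) ≤ c / (1 + c * (k + 1)) := by
    have : q ≤ c / (1 + k * c) := min_le_left _ _
    rw [le_div_iff₀ d1] at this
    rw [div_le_div_iff₀ (by positivity) (by positivity)]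
    nlinarith
  have q2 : q / (1 + q) ≤ cs / (1 + cs * (m + 1)) := by
    have : q ≤ cs / (1 + m * cs) := min_le_right _ _
    rw [le_div_iff₀ d2] at this
    rw [div_le_div_iff₀ (by positivity) (by positivity)]
    nlinarith
  -- `l = 1 + q` maximizes `2 l - l ^ 2 / (1 + q)`.
  refine le_trans ?_ (main (1 + q))
  have hB : t - c / (1 + c * (k + 1)) * a - cs / (1 + cs * (m + 1)) * b ≤ t - q / (1 + q) * t := by
    rw [← hab]
    nlinarith [mul_le_mul_of_nonneg_right q1 ha, mul_le_mul_of_nonneg_right q2 hb]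
  have : (1 + q) ^ 2 * (t - q / (1 + q) * t) = (1 + q) * t := by field_simp; ring
  nlinarith [mul_le_mul_of_nonneg_left hB (sq_nonneg (1 + q))]

/-- The refined Kato inequality in components, for forms of degree `k + 1`: `α` is `∇φ` at a point,
`f` is `φ / |φ|`, and `ξ` is then `d|φ|`. -/
theorem kato_array {α : Fin n → (Fin (k + 1) → Fin n) → H} (hα : ∀ i, IsAltArray (α i))
    {f : (Fin (k + 1) → Fin n) → H} (hf : IsAltArray f) {ξ : Fin n → ℝ}
    (hf1 : arrayInner f f = 1) (hξ : ∀ i, arrayInner (α i) f = ξ i) (hkn : k + 1 ≤ n)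
    {c cs : ℝ} (hc : 0 ≤ c) (hcs : 0 ≤ cs) :
    (1 + min (c / (1 + (k + 1 : ℕ) * c)) (cs / (1 + ((n : ℝ) - (k + 1 : ℕ)) * cs))) * ∑ i, ξ i ^ 2
      ≤ ∑ i, arrayInner (α i) (α i) + c * arrayInner (wedgeArray α) (wedgeArray α)
        + cs * arrayInner (traceArray α) (traceArray α) := by
  set W := wedgeArray fun i ↦ ξ i • f with hW
  set T := traceArray fun i ↦ ξ i • f with hT
  have hβ : ∀ i, IsAltArray (ξ i • f) := fun i ↦ hf.smul _
  have hWa : IsAltArray W := IsAltArray.wedge hβ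
  have hTa : IsAltArray T := by
    have : T = ∑ i, ξ i • curryArray f i := by
      ext J; simp [hT, traceArray, curryArray]
    rw [this]
    intro σ J
    simp only [Finset.sum_apply, Pi.smul_apply, Finset.smul_sum]
    refine Finset.sum_congr rfl fun i _ ↦ ?_
    rw [hf.curry i σ J, smul_comm]
  have hm : (0 : ℝ) ≤ (n : ℝ) - (k + 1 : ℕ) := by
    rw [sub_nonneg]; exact_mod_cast hkn
  refine weighted_cauchy_bound (x := arrayInner (wedgeArray α) W) (y := arrayInner (traceArray α) T)
    (a := arrayInner W W) (b := arrayInner T T) hc hcs (by positivity) hm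
    (arrayInner_self_nonneg _) (arrayInner_self_nonneg _) ?_ ?_ ?_ ?_
  · rw [arrayInner_wedge_add_trace hf, hf1, mul_one]
  · intro l m1 m2
    have hpos : 0 ≤ ∑ i, arrayInner
        (α i - l • (ξ i • f - m1 • curryArray W i - m2 • traceAdjArray T i))
        (α i - l • (ξ i • f - m1 • curryArray W i - m2 • traceAdjArray T i)) :=
      Finset.sum_nonneg fun i _ ↦ arrayInner_self_nonneg _
    refine hpos.trans_eq ?_
    -- The components `curryArray W` and `traceAdjArray T` of the test vector are orthogonal by
    -- `e7`, and their norms `e5`, `e6` come from the eigenvalues `k + 2` and `n - k` of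
    -- `wedgeArray ∘ curryArray` and `traceArray ∘ traceAdjArray`.
    have e1 : ∑ i, arrayInner (α i) (curryArray W i) = arrayInner (wedgeArray α) W :=
      (arrayInner_wedge α hWa).symm
    have e2 : ∑ i, arrayInner (α i) (traceAdjArray T i) = arrayInner (traceArray α) T :=
      (arrayInner_trace hα T).symm
    have e3 : ∑ i, arrayInner (ξ i • f) (curryArray W i) = arrayInner W W :=
      (arrayInner_wedge _ hWa).symm
    have e4 : ∑ i, arrayInner (ξ i • f) (traceAdjArray T i) = arrayInner T T :=
      (arrayInner_trace hβ T).symm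
    have e5 : ∑ i, arrayInner (curryArray W i) (curryArray W i)
        = ((k + 1 : ℕ) + 1) * arrayInner W W := by
      rw [← arrayInner_wedge _ hWa, wedge_curry hWa, arrayInner_smul_left]
    have e6 : ∑ i, arrayInner (traceAdjArray T i) (traceAdjArray T i)
        = ((n : ℝ) - (k + 1 : ℕ) + 1) * arrayInner T T := by
      rw [← arrayInner_trace (fun i ↦ hTa.traceAdj i), trace_traceAdj hTa, arrayInner_smul_left]
      push_cast
      ring
    have e7 : ∑ i, arrayInner (curryArray W i) (traceAdjArray T i) = 0 := by
      rw [← arrayInner_trace (fun i ↦ hWa.curry i), trace_curry hWa]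
      simp [arrayInner]
    have e8 : ∑ i, arrayInner (α i) (ξ i • f) = ∑ i, ξ i ^ 2 := by
      simp [arrayInner_smul_right, hξ, sq]
    have e9 : ∑ i, arrayInner (ξ i • f) (ξ i • f) = ∑ i, ξ i ^ 2 := by
      simp [arrayInner_smul_right, arrayInner_smul_left, hf1, sq]
    rw [← e1, ← e2, ← e3, ← e4] at *
    have : ∀ i, arrayInner
        (α i - l • (ξ i • f - m1 • curryArray W i - m2 • traceAdjArray T i))
        (α i - l • (ξ i • f - m1 • curryArray W i - m2 • traceAdjArray T i))
        = arrayInner (α i) (α i)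
          - 2 * l * (arrayInner (α i) (ξ i • f) - m1 * arrayInner (α i) (curryArray W i)
            - m2 * arrayInner (α i) (traceAdjArray T i))
          + l ^ 2 * (arrayInner (ξ i • f) (ξ i • f)
            - 2 * m1 * arrayInner (ξ i • f) (curryArray W i)
            - 2 * m2 * arrayInner (ξ i • f) (traceAdjArray T i)
            + m1 ^ 2 * arrayInner (curryArray W i) (curryArray W i)
            + m2 ^ 2 * arrayInner (traceAdjArray T i) (traceAdjArray T i)
            + 2 * m1 * m2 * arrayInner (curryArray W i) (traceAdjArray T i)) := by
      intro i
      generalize ξ i • f = β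
      generalize curryArray W i = u
      generalize traceAdjArray T i = v
      simp only [arrayInner_sub_left, arrayInner_sub_right, arrayInner_smul_left,
        arrayInner_smul_right]
      rw [arrayInner_comm β (α i), arrayInner_comm u (α i), arrayInner_comm v (α i),
        arrayInner_comm u β, arrayInner_comm v β, arrayInner_comm v u]
      ring
    simp_rw [this]
    simp only [Finset.sum_add_distrib, Finset.sum_sub_distrib, ← Finset.mul_sum]
    rw [e5, e6, e7, e8, e9]
    ring
  · intro s
    refine (arrayInner_self_nonneg (wedgeArray α - s • W)).trans_eq ?_
    simp only [arrayInner_sub_left, arrayInner_sub_right, arrayInner_smul_left,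
        arrayInner_smul_right, arrayInner_comm W (wedgeArray α)]
    ring
  · intro s
    refine (arrayInner_self_nonneg (traceArray α - s • T)).trans_eq ?_
    simp only [arrayInner_sub_left, arrayInner_sub_right, arrayInner_smul_left,
        arrayInner_smul_right, arrayInner_comm T (traceArray α)]
    ring

end Arrays

/-! ### Differentiable sections -/

section Sections

variable (n : ℕ) {M : Type*} [TopologicalSpace M] [ChartedSpace (EuclideanSpace ℝ (Fin n)) M]
  (F : Type*) [NormedAddCommGroup F] [NormedSpace ℝ F]
  {V : M → Type*} [TopologicalSpace (TotalSpace F V)] [∀ x, TopologicalSpace (V x)]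
  [FiberBundle F V]

/-- Differentiability of a section at a point. -/
abbrev SecDiffAt (σ : Π x : M, V x) (x : M) : Prop :=
  MDifferentiableAt (𝓡 n) ((𝓡 n).prod 𝓘(ℝ, F)) (fun y ↦ TotalSpace.mk' F y (σ y)) x

variable {n} [IsManifold (𝓡 n) ∞ M]

/-- Differentiability of a vector field at a point. -/
abbrev VFDiffAt (X : Π x : M, TangentSpace (𝓡 n) x) (x : M) : Prop :=
  SecDiffAt n (EuclideanSpace ℝ (Fin n)) X x

end Sections

/-! ### The Levi-Civita connection -/

section LeviCivita

variable {n : ℕ} {M : Type*} [TopologicalSpace M] [ChartedSpace (EuclideanSpace ℝ (Fin n)) M]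
  [IsManifold (𝓡 n) ∞ M] [RiemannianBundle (fun x : M ↦ TangentSpace (𝓡 n) x)]

lemma koszul_sub_swap (X Y Z : Π x : M, TangentSpace (𝓡 n) x) (x : M) :
    koszul X Y Z x - koszul Y X Z x
      = 2 * inner ℝ (VectorField.mlieBracket (𝓡 n) X Y x) (Z x) := by
  have h1 : VectorField.mlieBracket (𝓡 n) Y X x = - VectorField.mlieBracket (𝓡 n) X Y x :=
    VectorField.mlieBracket_swap_apply
  have h2 : (fun y ↦ inner ℝ (X y) (Y y)) = fun y ↦ inner ℝ (Y y) (X y) := by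
    ext y; rw [real_inner_comm]
  rw [koszul, koszul, h1, h2, inner_neg_left]
  ring

lemma koszul_add_swap (X Y Z : Π x : M, TangentSpace (𝓡 n) x) (x : M) :
    koszul X Y Z x + koszul X Z Y x
      = 2 * mvfderiv (𝓡 n) (fun y ↦ inner ℝ (Y y) (Z y)) x (X x) := by
  have h1 : VectorField.mlieBracket (𝓡 n) Z Y x = - VectorField.mlieBracket (𝓡 n) Y Z x :=
    VectorField.mlieBracket_swap_apply
  have h2 : (fun y ↦ inner ℝ (Z y) (Y y)) = fun y ↦ inner ℝ (Y y) (Z y) := by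
    ext y; rw [real_inner_comm]
  rw [koszul, koszul, h1, h2, inner_neg_left]
  ring

variable [IsContMDiffRiemannianBundle (𝓡 n) ∞ (EuclideanSpace ℝ (Fin n))
  (fun x : M ↦ TangentSpace (𝓡 n) x)]

instance : IsContMDiffRiemannianBundle (𝓡 n) 1 (EuclideanSpace ℝ (Fin n))
    (fun x : M ↦ TangentSpace (𝓡 n) x) :=
  .of_le (n := ∞) (by norm_cast)

variable {X Y Z X' Y' : Π x : M, TangentSpace (𝓡 n) x} {x : M}

lemma koszul_tensorial_left (hY : VFDiffAt Y x) (hZ : VFDiffAt Z x) :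
    TensorialAt (𝓡 n) (EuclideanSpace ℝ (Fin n)) (fun X ↦ koszul X Y Z x) x where
  smul {f X} hf hX := by
    have h1 := mvfderiv_fun_mul hf (hX.inner_bundle hZ)
    have h2 := mvfderiv_fun_mul hf (hX.inner_bundle hY)
    simp only [koszul, Pi.smul_apply', inner_smul_left, inner_smul_right, map_smul,
      VectorField.mlieBracket_smul_left hf hX, inner_add_left, RCLike.conj_to_real, h1, h2]
    simp
    ring
  add {X X'} hX hX' := by
    have h1 := mvfderiv_fun_add (hX.inner_bundle hZ) (hX'.inner_bundle hZ)
    have h2 := mvfderiv_fun_add (hX.inner_bundle hY) (hX'.inner_bundle hY)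
    simp only [koszul, Pi.add_apply, inner_add_left, inner_add_right, map_add,
      VectorField.mlieBracket_add_left hX hX', h1, h2]
    simp
    ring

lemma koszul_smul_middle {f : M → ℝ} (hX : VFDiffAt X x)
    (hf : MDifferentiableAt (𝓡 n) 𝓘(ℝ, ℝ) f x)
    (hY : VFDiffAt Y x) (hZ : VFDiffAt Z x) :
    koszul X (f • Y) Z x
      = f x * koszul X Y Z x + 2 * (mvfderiv (𝓡 n) f x (X x) * inner ℝ (Y x) (Z x)) := by
  have h1 := mvfderiv_fun_mul hf (hY.inner_bundle hZ)
  have h2 := mvfderiv_fun_mul hf (hX.inner_bundle hY)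
  simp only [koszul, Pi.smul_apply', inner_smul_left, inner_smul_right, map_smul,
    VectorField.mlieBracket_smul_left hf hY, VectorField.mlieBracket_smul_right hf hY,
    inner_add_left, RCLike.conj_to_real, h1, h2]
  simp [real_inner_comm]
  ring

lemma koszul_add_middle (hX : VFDiffAt X x) (hY : VFDiffAt Y x)
    (hY' : VFDiffAt Y' x) (hZ : VFDiffAt Z x) :
    koszul X (Y + Y') Z x = koszul X Y Z x + koszul X Y' Z x := by
  have h1 := mvfderiv_fun_add (hY.inner_bundle hZ) (hY'.inner_bundle hZ)
  have h2 := mvfderiv_fun_add (hX.inner_bundle hY) (hX.inner_bundle hY')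
  simp only [koszul, Pi.add_apply, inner_add_left, inner_add_right, map_add,
    VectorField.mlieBracket_add_left hY hY', VectorField.mlieBracket_add_right hY hY', h1, h2]
  simp
  ring

lemma koszul_tensorial_right (hX : VFDiffAt X x) (hY : VFDiffAt Y x) :
    TensorialAt (𝓡 n) (EuclideanSpace ℝ (Fin n)) (fun Z ↦ koszul X Y Z x) x where
  smul {f Z} hf hZ := by
    have h1 := koszul_add_swap X Y (f • Z) x
    have h2 := koszul_add_swap X Y Z x
    have h3 := koszul_smul_middle hX hf hZ hY
    have h4 := mvfderiv_fun_mul hf (hY.inner_bundle hZ)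
    simp only [Pi.smul_apply', inner_smul_right, h4] at h1
    rw [real_inner_comm (Y x) (Z x)] at h3
    simp at h1 h2 h3 ⊢
    linear_combination h1 - h3 - f x * h2
  add {Z Z'} hZ hZ' := by
    have h1 := koszul_add_swap X Y (Z + Z') x
    have h2 := koszul_add_swap X Y Z x
    have h2' := koszul_add_swap X Y Z' x
    have h3 := koszul_add_middle hX hZ hZ' hY
    have h4 := mvfderiv_fun_add (hY.inner_bundle hZ) (hY.inner_bundle hZ')
    simp only [Pi.add_apply, inner_add_right, h4] at h1
    simp at h1 h2 h2' h3 ⊢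
    linear_combination h1 - h3 - h2 - h2'

lemma mdifferentiableAt_ext (v : TangentSpace (𝓡 n) x) :
    VFDiffAt (ext v) x := FiberBundle.mdifferentiableAt_extend _ _ v

@[simp] lemma ext_self (v : TangentSpace (𝓡 n) x) : ext v x = v := by simp [ext]

/-- The Koszul formula, for arbitrary vector fields in place of the extensions in the definition of
`leviCivita`. -/
lemma inner_leviCivita (hX : VFDiffAt X x) (hY : VFDiffAt Y x) (hZ : VFDiffAt Z x) :
    inner ℝ (leviCivita Y x (X x)) (Z x) = 1 / 2 * koszul X Y Z x := by
  have h1 : ∀ i, koszul (ext (X x)) Y (ext (frame x i)) x = koszul X Y (ext (frame x i)) x :=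
    fun i ↦ (koszul_tensorial_left hY (mdifferentiableAt_ext _)).pointwise
      (mdifferentiableAt_ext _) hX (by simp)
  have h2 := koszul_tensorial_right hX hY
  have h3 : koszul X Y Z x = ∑ i, inner ℝ (frame x i) (Z x) * koszul X Y (ext (frame x i)) x := by
    rw [← h2.mkHom_apply hZ]
    conv_lhs => rw [← (frame x).sum_repr (Z x)]
    rw [map_sum]
    refine Finset.sum_congr rfl fun i _ ↦ ?_
    rw [map_smul, h2.mkHom_apply_eq_extend, OrthonormalBasis.repr_apply_apply]
    rfl
  rw [h3, leviCivita, sum_inner, Finset.mul_sum]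
  refine Finset.sum_congr rfl fun i _ ↦ ?_
  rw [inner_smul_left, h1]
  simp
  ring

lemma inner_leviCivita_ext (hY : VFDiffAt Y x) (v w : TangentSpace (𝓡 n) x) :
    inner ℝ (leviCivita Y x v) w = 1 / 2 * koszul (ext v) Y (ext w) x := by
  have := inner_leviCivita (mdifferentiableAt_ext v) hY (mdifferentiableAt_ext w)
  rwa [ext_self, ext_self] at this

lemma leviCivita_add (hY : VFDiffAt Y x) (hY' : VFDiffAt Y' x) (v : TangentSpace (𝓡 n) x) :
    leviCivita (Y + Y') x v = leviCivita Y x v + leviCivita Y' x v := by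
  refine ext_inner_right ℝ fun w ↦ ?_
  rw [inner_add_left, inner_leviCivita_ext (mdifferentiableAt_add_section hY hY'),
    inner_leviCivita_ext hY, inner_leviCivita_ext hY',
    koszul_add_middle (mdifferentiableAt_ext v) hY hY' (mdifferentiableAt_ext w)]
  ring

lemma leviCivita_smul {f : M → ℝ} (hf : MDifferentiableAt (𝓡 n) 𝓘(ℝ, ℝ) f x)
    (hY : VFDiffAt Y x) (v : TangentSpace (𝓡 n) x) :
    leviCivita (f • Y) x v = f x • leviCivita Y x v + mvfderiv (𝓡 n) f x v • Y x := by
  refine ext_inner_right ℝ fun w ↦ ?_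
  rw [inner_add_left, inner_smul_left, inner_smul_left,
    inner_leviCivita_ext (hf.smul_section hY), inner_leviCivita_ext hY,
    koszul_smul_middle (mdifferentiableAt_ext v) hf hY (mdifferentiableAt_ext w)]
  simp
  ring

/-- The Levi-Civita connection is compatible with the metric. -/
lemma mvfderiv_inner_leviCivita (hY : VFDiffAt Y x) (hZ : VFDiffAt Z x)
    (v : TangentSpace (𝓡 n) x) :
    mvfderiv (𝓡 n) (fun y ↦ inner ℝ (Y y) (Z y)) x v
      = inner ℝ (leviCivita Y x v) (Z x) + inner ℝ (Y x) (leviCivita Z x v) := by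
  have hv := mdifferentiableAt_ext v
  have h := koszul_add_swap (ext v) Y Z x
  have h1 := inner_leviCivita hv hY hZ
  have h2 := inner_leviCivita hv hZ hY
  rw [ext_self] at h h1 h2
  rw [real_inner_comm _ (Y x), h1, h2]
  linarith

/-- The Levi-Civita connection is torsion free. -/
lemma leviCivita_sub_swap (hX : VFDiffAt X x) (hY : VFDiffAt Y x) :
    leviCivita Y x (X x) - leviCivita X x (Y x) = VectorField.mlieBracket (𝓡 n) X Y x := by
  refine ext_inner_right ℝ fun w ↦ ?_
  have hw := mdifferentiableAt_ext w
  have h1 := inner_leviCivita hX hY hw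
  have h2 := inner_leviCivita hY hX hw
  have h := koszul_sub_swap X Y (ext w) x
  rw [ext_self] at h1 h2 h
  rw [inner_sub_left, h1, h2]
  linarith

lemma leviCivita_add_vec (hY : VFDiffAt Y x) (v w : TangentSpace (𝓡 n) x) :
    leviCivita Y x (v + w) = leviCivita Y x v + leviCivita Y x w := by
  refine ext_inner_right ℝ fun z ↦ ?_
  have h := koszul_tensorial_left hY (mdifferentiableAt_ext z)
  have h0 : ∀ u, inner ℝ (leviCivita Y x u) z = 1 / 2 * h.mkHom _ _ u :=
    fun u ↦ inner_leviCivita_ext hY u z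
  rw [inner_add_left, h0, h0, h0, map_add, mul_add]

lemma leviCivita_smul_vec (hY : VFDiffAt Y x) (r : ℝ) (v : TangentSpace (𝓡 n) x) :
    leviCivita Y x (r • v) = r • leviCivita Y x v := by
  refine ext_inner_right ℝ fun z ↦ ?_
  have h := koszul_tensorial_left hY (mdifferentiableAt_ext z)
  have h0 : ∀ u, inner ℝ (leviCivita Y x u) z = 1 / 2 * h.mkHom _ _ u :=
    fun u ↦ inner_leviCivita_ext hY u z
  rw [inner_smul_left, h0, h0, map_smul]
  simp
  ring

lemma leviCivita_congr (h : Y =ᶠ[𝓝 x] Y') (v : TangentSpace (𝓡 n) x) :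
    leviCivita Y x v = leviCivita Y' x v := by
  have hk : ∀ X Z : Π x : M, TangentSpace (𝓡 n) x, koszul X Y Z x = koszul X Y' Z x := by
    intro X Z
    have h1 : (fun y ↦ inner ℝ (Y y) (Z y)) =ᶠ[𝓝 x] fun y ↦ inner ℝ (Y' y) (Z y) :=
      h.mono fun y hy ↦ by simp only [hy]
    have h2 : (fun y ↦ inner ℝ (X y) (Y y)) =ᶠ[𝓝 x] fun y ↦ inner ℝ (X y) (Y' y) :=
      h.mono fun y hy ↦ by simp only [hy]
    simp only [koszul, mvfderiv, h1.mfderiv_eq, h2.mfderiv_eq, h.eq_of_nhds,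
      h.mlieBracket_vectorField_eq (Filter.EventuallyEq.refl _ Z),
      Filter.EventuallyEq.mlieBracket_vectorField_eq (Filter.EventuallyEq.refl _ X) h]
    rfl
  simp only [leviCivita, hk]

end LeviCivita

/-! ### Smooth forms and their values on vector fields -/

section Evaluation

variable {n : ℕ} {M : Type*} [TopologicalSpace M] [ChartedSpace (EuclideanSpace ℝ (Fin n)) M]
  [IsManifold (𝓡 n) ∞ M]
  {F : Type*} [NormedAddCommGroup F] [NormedSpace ℝ F]
  {V : M → Type*} [TopologicalSpace (TotalSpace F V)]

/-- Smoothness of a section at a point. -/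
abbrev SecSmoothAt (n : ℕ) {M : Type*} [TopologicalSpace M]
    [ChartedSpace (EuclideanSpace ℝ (Fin n)) M]
    (F : Type*) [NormedAddCommGroup F] [NormedSpace ℝ F]
    {V : M → Type*} [TopologicalSpace (TotalSpace F V)] [∀ x, TopologicalSpace (V x)]
    [FiberBundle F V] (σ : Π x : M, V x) (x : M) : Prop :=
  ContMDiffAt (𝓡 n) ((𝓡 n).prod 𝓘(ℝ, F)) ∞ (fun y ↦ TotalSpace.mk' F y (σ y)) x

/-- Smoothness of a vector field at a point. -/
abbrev VFSmoothAt (X : Π x : M, TangentSpace (𝓡 n) x) (x : M) : Prop :=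
  SecSmoothAt n (EuclideanSpace ℝ (Fin n)) X x

/-- Differentiability at a point of a form with values in `V`. -/
abbrev FormDiffAt (F : Type*) [NormedAddCommGroup F] [NormedSpace ℝ F]
    {V : M → Type*} [TopologicalSpace (TotalSpace F V)]
    [∀ x, NormedAddCommGroup (V x)] [∀ x, InnerProductSpace ℝ (V x)]
    [FiberBundle F V] [VectorBundle ℝ F V] {k : ℕ}
    (φ : Π x : M, TangentSpace (𝓡 n) x [⋀^Fin k]→L[ℝ] V x) (x : M) : Prop :=
  SecDiffAt n (EuclideanSpace ℝ (Fin n) [⋀^Fin k]→L[ℝ] F)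
    (V := fun x : M ↦ TangentSpace (𝓡 n) x [⋀^Fin k]→L[ℝ] V x) φ x

/-- Smoothness at a point of a form with values in `V`. -/
abbrev FormSmoothAt (F : Type*) [NormedAddCommGroup F] [NormedSpace ℝ F]
    {V : M → Type*} [TopologicalSpace (TotalSpace F V)]
    [∀ x, NormedAddCommGroup (V x)] [∀ x, InnerProductSpace ℝ (V x)]
    [FiberBundle F V] [VectorBundle ℝ F V] {k : ℕ}
    (φ : Π x : M, TangentSpace (𝓡 n) x [⋀^Fin k]→L[ℝ] V x) (x : M) : Prop :=
  SecSmoothAt n (EuclideanSpace ℝ (Fin n) [⋀^Fin k]→L[ℝ] F)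
    (V := fun x : M ↦ TangentSpace (𝓡 n) x [⋀^Fin k]→L[ℝ] V x) φ x

variable [∀ x, NormedAddCommGroup (V x)] [∀ x, InnerProductSpace ℝ (V x)]
  [FiberBundle F V] [VectorBundle ℝ F V] {k : ℕ}

lemma SecSmoothAt.secDiffAt {σ : Π x : M, V x} {x : M} (h : SecSmoothAt n F σ x) :
    SecDiffAt n F σ x := ContMDiffAt.mdifferentiableAt h (by simp)

lemma contDiff_alternatingMap_eval {E : Type*} [NormedAddCommGroup E] [NormedSpace ℝ E] :
    ContDiff ℝ ∞ (fun p : (E [⋀^Fin k]→L[ℝ] F) × (Fin k → E) ↦ p.1 p.2) :=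
  contDiffOn_univ.1 ((ContinuousAlternatingMap.toContinuousMultilinearMapCLM (𝕜 := ℝ) ℝ :
    (E [⋀^Fin k]→L[ℝ] F) →L[ℝ] _).cpolynomialOn_uncurry_of_multilinear
      (s := Set.univ)).contDiffOn

/-- Evaluation of a form commutes with the passage to the trivializations around `x₀`. -/
lemma trivialization_alternatingMap_eval (x₀ : M) {y : M}
    (hy : y ∈ (trivializationAt (EuclideanSpace ℝ (Fin n)) (TangentSpace (𝓡 n)) x₀).baseSet)
    (hy' : y ∈ (trivializationAt F V x₀).baseSet)
    (α : TangentSpace (𝓡 n) y [⋀^Fin k]→L[ℝ] V y) (w : Fin k → TangentSpace (𝓡 n) y) :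
    (trivializationAt F V x₀ ⟨y, α w⟩).2
      = ContinuousAlternatingMap.inCoordinates (EuclideanSpace ℝ (Fin n)) F x₀ y x₀ y α
        (fun a ↦ (trivializationAt (EuclideanSpace ℝ (Fin n)) (TangentSpace (𝓡 n)) x₀
          ⟨y, w a⟩).2) := by
  rw [ContinuousAlternatingMap.inCoordinates_eq _ _ hy hy']
  have : ∀ a, (trivializationAt (EuclideanSpace ℝ (Fin n)) (TangentSpace (𝓡 n)) x₀).symm y
      ((trivializationAt (EuclideanSpace ℝ (Fin n)) (TangentSpace (𝓡 n)) x₀ ⟨y, w a⟩).2) = w a :=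
    fun a ↦ Trivialization.symm_apply_apply_mk _ hy _
  simp [Function.comp_def, this]

lemma eventually_trivialization_eval (x₀ : M)
    (φ : Π x : M, TangentSpace (𝓡 n) x [⋀^Fin k]→L[ℝ] V x)
    (W : Fin k → Π x : M, TangentSpace (𝓡 n) x) :
    (fun y ↦ (trivializationAt F V x₀ ⟨y, φ y (fun a ↦ W a y)⟩).2) =ᶠ[𝓝 x₀]
      fun y ↦ (ContinuousAlternatingMap.inCoordinates (EuclideanSpace ℝ (Fin n)) F x₀ y x₀ y (φ y))
        (fun a ↦ (trivializationAt (EuclideanSpace ℝ (Fin n)) (TangentSpace (𝓡 n)) x₀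
          ⟨y, W a y⟩).2) := by
  filter_upwards [(trivializationAt (EuclideanSpace ℝ (Fin n))
      (TangentSpace (𝓡 n)) x₀).open_baseSet.mem_nhds (FiberBundle.mem_baseSet_trivializationAt' x₀),
    (trivializationAt F V x₀).open_baseSet.mem_nhds
      (FiberBundle.mem_baseSet_trivializationAt' x₀)] with y hy hy'
  exact trivialization_alternatingMap_eval x₀ hy hy' _ _

lemma mdifferentiableAt_pi {E : Type*} [NormedAddCommGroup E] [NormedSpace ℝ E]
    {f : M → Fin k → E} {x : M} (h : ∀ a, MDifferentiableAt (𝓡 n) 𝓘(ℝ, E) (fun y ↦ f y a) x) :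
    MDifferentiableAt (𝓡 n) 𝓘(ℝ, Fin k → E) f x := by
  simp only [mdifferentiableAt_iff] at h ⊢
  exact ⟨continuousAt_pi.2 fun a ↦ (h a).1, differentiableWithinAt_pi.2 fun a ↦ (h a).2⟩

lemma FormSmoothAt.eval {φ : Π x : M, TangentSpace (𝓡 n) x [⋀^Fin k]→L[ℝ] V x}
    {W : Fin k → Π x : M, TangentSpace (𝓡 n) x} {x : M}
    (hφ : FormSmoothAt F φ x) (hW : ∀ a, VFSmoothAt (W a) x) :
    SecSmoothAt n F (fun y ↦ φ y (fun a ↦ W a y)) x := by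
  rw [SecSmoothAt, contMDiffAt_section]
  refine ContMDiffAt.congr_of_eventuallyEq ?_ (eventually_trivialization_eval x φ W)
  rw [FormSmoothAt, SecSmoothAt, contMDiffAt_section] at hφ
  refine (contDiff_alternatingMap_eval (k := k) (F := F)
    (E := EuclideanSpace ℝ (Fin n))).contDiffAt.contMDiffAt.comp x (hφ.prodMk_space ?_)
  refine contMDiffAt_pi_space.2 fun a ↦ ?_
  exact (contMDiffAt_section x).1 (hW a)

lemma FormDiffAt.eval {φ : Π x : M, TangentSpace (𝓡 n) x [⋀^Fin k]→L[ℝ] V x}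
    {W : Fin k → Π x : M, TangentSpace (𝓡 n) x} {x : M}
    (hφ : FormDiffAt F φ x) (hW : ∀ a, VFDiffAt (W a) x) :
    SecDiffAt n F (fun y ↦ φ y (fun a ↦ W a y)) x := by
  rw [SecDiffAt, mdifferentiableAt_section]
  refine MDifferentiableAt.congr_of_eventuallyEq ?_ (eventually_trivialization_eval x φ W)
  rw [FormDiffAt, SecDiffAt, mdifferentiableAt_section] at hφ
  refine ((contDiff_alternatingMap_eval (k := k) (F := F)
    (E := EuclideanSpace ℝ (Fin n))).contDiffAt.contMDiffAt.mdifferentiableAt (by simp)).comp x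
      (hφ.prodMk_space ?_)
  refine mdifferentiableAt_pi fun a ↦ ?_
  exact (mdifferentiableAt_section _ _).1 (hW a)

/-- The values on the basis tuples determine an alternating map; `E [⋀^Fin k]→L[ℝ] F` is a
finite-dimensional space, so a left inverse of this restriction map is continuous. -/
lemma exists_alternatingMap_leftInverse [FiniteDimensional ℝ F] :
    ∃ L : ((Fin k → Fin n) → F) →L[ℝ] (EuclideanSpace ℝ (Fin n) [⋀^Fin k]→L[ℝ] F),
      ∀ α : EuclideanSpace ℝ (Fin n) [⋀^Fin k]→L[ℝ] F,
        L (fun J ↦ α fun a ↦ EuclideanSpace.basisFun (Fin n) ℝ (J a)) = α := by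
  let R : (EuclideanSpace ℝ (Fin n) [⋀^Fin k]→L[ℝ] F) →ₗ[ℝ] ((Fin k → Fin n) → F) :=
    { toFun := fun α J ↦ α fun a ↦ EuclideanSpace.basisFun (Fin n) ℝ (J a)
      map_add' := fun α β ↦ rfl
      map_smul' := fun r α ↦ rfl }
  have hR : LinearMap.ker R = ⊥ := by
    rw [LinearMap.ker_eq_bot]
    intro α β h
    apply ContinuousAlternatingMap.toAlternatingMap_injective
    refine Module.Basis.ext_alternating (EuclideanSpace.basisFun (Fin n) ℝ).toBasis fun J _ ↦ ?_
    simpa [R] using congrFun h J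
  obtain ⟨L, hL⟩ := R.exists_leftInverse_of_injective hR
  exact ⟨LinearMap.toContinuousLinearMap L, fun α ↦ LinearMap.congr_fun hL α⟩

/-- A form is smooth as soon as its values on smooth vector fields are. -/
lemma formSmoothAt_of_eval [FiniteDimensional ℝ F]
    {φ : Π x : M, TangentSpace (𝓡 n) x [⋀^Fin k]→L[ℝ] V x} {x : M}
    (h : ∀ W : Fin k → Π x : M, TangentSpace (𝓡 n) x,
      (∀ a, ∀ᶠ y in 𝓝 x, VFSmoothAt (W a) y) → SecSmoothAt n F (fun y ↦ φ y (fun a ↦ W a y)) x) :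
    FormSmoothAt F φ x := by
  obtain ⟨L, hL⟩ := exists_alternatingMap_leftInverse (n := n) (F := F) (k := k)
  rw [FormSmoothAt, SecSmoothAt, contMDiffAt_section]
  set e := trivializationAt (EuclideanSpace ℝ (Fin n)) (TangentSpace (𝓡 n) (M := M)) x
  let A : M → (Fin k → Fin n) → F := fun y J ↦
    (trivializationAt F V x ⟨y, φ y fun a ↦
      e.localFrame (EuclideanSpace.basisFun (Fin n) ℝ).toBasis (J a) y⟩).2
  have hx : x ∈ e.baseSet := FiberBundle.mem_baseSet_trivializationAt' x
  have hA : ContMDiffAt (𝓡 n) 𝓘(ℝ, (Fin k → Fin n) → F) ∞ A x := by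
    refine contMDiffAt_pi_space.2 fun J ↦ ?_
    refine (contMDiffAt_section x).1 (h _ fun a ↦ ?_)
    filter_upwards [e.open_baseSet.mem_nhds hx] with y hy
    exact contMDiffAt_localFrame_of_mem _ _ _ _ hy
  refine (L.contMDiff.contMDiffAt.comp x hA).congr_of_eventuallyEq ?_
  filter_upwards [e.open_baseSet.mem_nhds hx, (trivializationAt F V x).open_baseSet.mem_nhds
      (FiberBundle.mem_baseSet_trivializationAt' x)] with y hy hy'
  rw [Function.comp_apply]
  simp only [A]
  simp_rw [trivialization_alternatingMap_eval x hy hy']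
  have : ∀ j : Fin n, (e ⟨y, e.localFrame (EuclideanSpace.basisFun (Fin n) ℝ).toBasis j y⟩).2
      = EuclideanSpace.basisFun (Fin n) ℝ j := by
    intro j
    rw [e.localFrame_apply_of_mem_baseSet _ hy]
    simp [Trivialization.basisAt, hy]
  change _ = L fun J ↦ ContinuousAlternatingMap.inCoordinates _ _ _ _ _ _ (φ y) fun a ↦ (e _).2
  simp_rw [this]
  rw [hL]
  rfl

end Evaluation

/-! ### Smoothness of covariant derivatives, and orthonormal frames -/

section CovSmooth

variable {n : ℕ} {M : Type*} [TopologicalSpace M] [ChartedSpace (EuclideanSpace ℝ (Fin n)) M]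
  [IsManifold (𝓡 n) ∞ M]
  {F : Type*} [NormedAddCommGroup F] [NormedSpace ℝ F]
  {V : M → Type*} [TopologicalSpace (TotalSpace F V)]
  [∀ x, NormedAddCommGroup (V x)] [∀ x, InnerProductSpace ℝ (V x)]
  [FiberBundle F V] [VectorBundle ℝ F V] [ContMDiffVectorBundle ∞ F V (𝓡 n)]

/-- Multiplying by a bump function makes a locally smooth section globally smooth, so the
covariant derivative of a locally smooth section is smooth. -/
lemma secSmoothAt_cov [T2Space M] (cov : CovariantDerivative (𝓡 n) F V)
    [CovariantDerivative.ContMDiffCovariantDerivative cov ∞]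
    {σ : Π x : M, V x} {X : Π x : M, TangentSpace (𝓡 n) x} {x : M}
    (hσ : ∀ᶠ y in 𝓝 x, SecSmoothAt n F σ y) (hX : VFSmoothAt X x) :
    SecSmoothAt n F (fun y ↦ cov σ y (X y)) x := by
  obtain ⟨u, hu, huo, hxu⟩ := eventually_nhds_iff.1 hσ
  obtain ⟨f, -, hf⟩ := (SmoothBumpFunction.nhds_basis_tsupport (I := 𝓡 n) (c := x)).mem_iff.1
    (huo.mem_nhds hxu)
  have h1 : ContMDiff (𝓡 n) ((𝓡 n).prod 𝓘(ℝ, F)) ∞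
      (fun y ↦ TotalSpace.mk' F y (((f : M → ℝ) • σ) y)) :=
    ContMDiffOn.smul_section_of_tsupport (f.contMDiff.contMDiffOn) huo hf
      (fun y hy ↦ (hu y hy).contMDiffWithinAt)
  have h2 := (CovariantDerivative.ContMDiffCovariantDerivative.contMDiff
    (cov := cov) (k := ∞)).contMDiff (σ := (f : M → ℝ) • σ) h1.contMDiffOn
  have h3 : SecSmoothAt n F (fun y ↦ cov ((f : M → ℝ) • σ) y (X y)) x :=
    ContMDiffAt.clm_bundle_apply (h2.contMDiffAt Filter.univ_mem) hX
  refine h3.congr_of_eventuallyEq ?_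
  filter_upwards [f.eventuallyEq_one.eventually_nhds, huo.mem_nhds hxu] with y hy hyu
  have h4 : cov σ y = cov ((f : M → ℝ) • σ) y :=
    cov.isCovariantDerivativeOn.congr_of_eventuallyEq (s := Set.univ)
      (SecSmoothAt.secDiffAt (hu y hyu)) (SecSmoothAt.secDiffAt (h1 y)) Filter.univ_mem
      (hy.mono fun z hz ↦ by simp [hz])
  rw [h4]

lemma contMDiffAt_mvfderiv_apply {f : M → ℝ} {X : Π x : M, TangentSpace (𝓡 n) x} {x : M}
    (hf : ContMDiffAt (𝓡 n) 𝓘(ℝ, ℝ) ∞ f x) (hX : VFSmoothAt X x) :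
    ContMDiffAt (𝓡 n) 𝓘(ℝ, ℝ) ∞ (fun y ↦ mvfderiv (𝓡 n) f y (X y)) x := by
  have h1 := hf.mfderiv_const (m := ∞) (by simp)
  have h2 := ContMDiffAt.clm_apply_of_inCoordinates (E₂ := TangentSpace 𝓘(ℝ, ℝ) (M := ℝ))
    (b₁ := id) (b₂ := f) (ϕ := fun y ↦ mfderiv (𝓡 n) 𝓘(ℝ, ℝ) f y) h1 hX hf
  have h3 := (contMDiffAt_totalSpace.1 h2).2
  convert h3 using 2 with y
  simp
  rfl

variable [RiemannianBundle (fun x : M ↦ TangentSpace (𝓡 n) x)]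
 [IsContMDiffRiemannianBundle (𝓡 n) ∞ (EuclideanSpace ℝ (Fin n))
  (fun x : M ↦ TangentSpace (𝓡 n) x)]

lemma eventually_vfSmoothAt_ext {x : M} (v : TangentSpace (𝓡 n) x) :
    ∀ᶠ y in 𝓝 x, VFSmoothAt (ext v) y := by
  set e := trivializationAt (EuclideanSpace ℝ (Fin n)) (TangentSpace (𝓡 n) (M := M)) x
  filter_upwards [e.open_baseSet.mem_nhds (FiberBundle.mem_baseSet_trivializationAt' x)] with y hy
  refine (e.contMDiffAt_section_iff hy).2 ?_
  refine (contMDiffAt_const (c := (e ⟨x, v⟩).2)).congr_of_eventuallyEq ?_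
  filter_upwards [e.open_baseSet.mem_nhds hy] with z hz
  simp only [ext, FiberBundle.extend]
  exact (congrArg Prod.snd (e.apply_mk_symm hz (e ⟨x, v⟩).2) :)

lemma contMDiffAt_koszul {X Y Z : Π x : M, TangentSpace (𝓡 n) x} {x : M}
    (hX : VFSmoothAt X x) (hY : VFSmoothAt Y x) (hZ : VFSmoothAt Z x) :
    ContMDiffAt (𝓡 n) 𝓘(ℝ, ℝ) ∞ (koszul X Y Z) x := by
  have : IsManifold (𝓡 n) (minSmoothness ℝ 2) M := by
    rw [minSmoothness_of_isRCLikeNormedField]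
    exact IsManifold.of_le (n := ∞) (by norm_cast)
  have : IsManifold (𝓡 n) (((⊤ : ℕ∞) : WithTop ℕ∞) + 1) M := inferInstanceAs (IsManifold (𝓡 n) ∞ M)
  have hb : ∀ {A B : Π x : M, TangentSpace (𝓡 n) x}, VFSmoothAt A x → VFSmoothAt B x →
      VFSmoothAt (VectorField.mlieBracket (𝓡 n) A B) x := fun hA hB ↦
    ContMDiffAt.mlieBracket_vectorField (m := ⊤) (n := ⊤) hA hB (by simp)
  have hd : ∀ {A B C : Π x : M, TangentSpace (𝓡 n) x}, VFSmoothAt A x → VFSmoothAt B x →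
      VFSmoothAt C x → ContMDiffAt (𝓡 n) 𝓘(ℝ, ℝ) ∞
        (fun y ↦ mvfderiv (𝓡 n) (fun z ↦ inner ℝ (A z) (B z)) y (C y)) x := fun hA hB hC ↦
    contMDiffAt_mvfderiv_apply (ContMDiffAt.inner_bundle hA hB) hC
  exact (((((hd hY hZ hX).add (hd hX hZ hY)).sub (hd hX hY hZ)).add
    ((hb hX hY).inner_bundle hZ)).sub ((hb hX hZ).inner_bundle hY)).sub
    ((hb hY hZ).inner_bundle hX)

/-- Smooth local frames, orthonormal at each point, with prescribed value `frame x` at `x`. They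
are needed as `frame` itself depends on the point by choice only, without any continuity. They are
obtained from extensions of `frame x` by the Gram-Schmidt process. -/
lemma exists_orthonormal_frame (x : M) :
    ∃ E : Fin n → Π x : M, TangentSpace (𝓡 n) x, (∀ i, E i x = frame x i) ∧
      ∀ᶠ y in 𝓝 x, (∀ i, VFSmoothAt (E i) y) ∧ Orthonormal ℝ (fun i ↦ E i y) := by
  let S : Fin n → Π x : M, TangentSpace (𝓡 n) x := fun i ↦ ext (frame x i)
  let G : Fin n → Π x : M, TangentSpace (𝓡 n) x := fun i y ↦
    InnerProductSpace.gramSchmidt ℝ (fun j ↦ S j y) i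
  have hGx : ∀ i, G i x = frame x i := by
    intro i
    have : (fun j ↦ S j x) = frame x := by ext1 j; simp [S]
    simp only [G, this]
    rw [InnerProductSpace.gramSchmidt_of_orthogonal ℝ fun i j hij ↦ (frame x).orthonormal.2 hij]
  have hG : ∀ i, ∀ᶠ y in 𝓝 x, VFSmoothAt (G i) y ∧ G i y ≠ 0 := by
    intro i
    induction i using WellFoundedLT.induction with | _ i ih
    have h1 : ∀ᶠ y in 𝓝 x, ∀ j < i, VFSmoothAt (G j) y ∧ G j y ≠ 0 := by
      simp only [Filter.eventually_all]
      exact fun j hj ↦ ih j hj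
    have h2 : ∀ᶠ y in 𝓝 x, VFSmoothAt (G i) y := by
      filter_upwards [h1, eventually_vfSmoothAt_ext (frame x i)] with y hy hS
      have h3 : G i = fun z ↦ S i z - ∑ j ∈ Finset.Iio i,
          (inner ℝ (G j z) (S i z) / inner ℝ (G j z) (G j z)) • G j z := by
        ext1 z
        have := InnerProductSpace.gramSchmidt_def'' ℝ (fun j ↦ S j z) i
        rw [eq_sub_iff_add_eq]
        simp only [real_inner_self_eq_norm_sq]
        exact this.symm
      rw [h3]
      refine ContMDiffAt.sub_section hS (ContMDiffAt.sum_section fun j hj ↦ ?_)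
      obtain ⟨hj1, hj2⟩ := hy j (Finset.mem_Iio.1 hj)
      exact ((hj1.inner_bundle hS).div₀ (hj1.inner_bundle hj1)
        (by simpa using hj2)).smul_section hj1
    have h3 : ∀ᶠ y in 𝓝 x, inner ℝ (G i y) (G i y) ≠ 0 := by
      have h4 : ContinuousAt (fun y ↦ inner ℝ (G i y) (G i y)) x :=
        (h2.self_of_nhds.inner_bundle h2.self_of_nhds).continuousAt
      refine h4.eventually_ne ?_
      rw [hGx]
      simp
    filter_upwards [h2, h3] with y h4 h5
    exact ⟨h4, fun h ↦ h5 (by simp [h])⟩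
  refine ⟨fun i y ↦ (‖G i y‖⁻¹) • G i y, fun i ↦ by simp [hGx], ?_⟩
  have hG' : ∀ᶠ y in 𝓝 x, ∀ i, VFSmoothAt (G i) y ∧ G i y ≠ 0 := Filter.eventually_all.2 hG
  filter_upwards [hG'] with y hy
  refine ⟨fun i ↦ ?_, ?_⟩
  · obtain ⟨h1, h2⟩ := hy i
    have h3 : ContMDiffAt (𝓡 n) 𝓘(ℝ, ℝ) ∞ (fun z ↦ ‖G i z‖) y := by
      have h4 : (fun z ↦ ‖G i z‖) = fun z ↦ √(inner ℝ (G i z) (G i z)) := by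
        ext z; rw [real_inner_self_eq_norm_sq, Real.sqrt_sq (norm_nonneg _)]
      rw [h4]
      exact (Real.contDiffAt_sqrt (by simpa using h2)).contMDiffAt.comp y (h1.inner_bundle h1)
    exact (h3.inv₀ (by simpa using h2)).smul_section h1
  · constructor
    · intro i
      have := (hy i).2
      simp [norm_smul, this]
    · intro i j hij
      have : inner ℝ (G i y) (G j y) = 0 := InnerProductSpace.gramSchmidt_orthogonal ℝ _ hij
      simp [inner_smul_left, inner_smul_right, this]

/-- The orthonormal basis of the tangent space given by `n` orthonormal vectors. -/
def orthonormalBasisOf {y : M} (v : Fin n → TangentSpace (𝓡 n) y) (hv : Orthonormal ℝ v) :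
    OrthonormalBasis (Fin n) ℝ (TangentSpace (𝓡 n) y) :=
  OrthonormalBasis.mk hv (by
    have : FiniteDimensional ℝ (TangentSpace (𝓡 n) y) :=
      inferInstanceAs (FiniteDimensional ℝ (EuclideanSpace ℝ (Fin n)))
    refine (hv.linearIndependent.span_eq_top_of_card_eq_finrank' ?_).ge
    exact (Module.finrank_eq_card_basis (frame y).toBasis).symm)

@[simp] lemma coe_orthonormalBasisOf {y : M} (v : Fin n → TangentSpace (𝓡 n) y)
    (hv : Orthonormal ℝ v) : ⇑(orthonormalBasisOf v hv) = v := OrthonormalBasis.coe_mk _ _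

/-- A vector field is smooth as soon as its inner products with smooth vector fields are. -/
lemma vfSmoothAt_of_inner {Y : Π x : M, TangentSpace (𝓡 n) x} {x : M}
    (h : ∀ Z : Π x : M, TangentSpace (𝓡 n) x, (∀ᶠ y in 𝓝 x, VFSmoothAt Z y) →
      ContMDiffAt (𝓡 n) 𝓘(ℝ, ℝ) ∞ (fun y ↦ inner ℝ (Z y) (Y y)) x) :
    VFSmoothAt Y x := by
  obtain ⟨E, -, hE⟩ := exists_orthonormal_frame (n := n) x
  have h1 : VFSmoothAt (fun y ↦ ∑ i, inner ℝ (E i y) (Y y) • E i y) x :=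
    ContMDiffAt.sum_section fun i _ ↦ (h (E i) (hE.mono fun y hy ↦ hy.1 i)).smul_section
      (hE.self_of_nhds.1 i)
  refine h1.congr_of_eventuallyEq ?_
  filter_upwards [hE] with y hy
  congr 1
  simpa using ((orthonormalBasisOf _ hy.2).sum_repr' (Y y)).symm

lemma vfSmoothAt_leviCivita {X Y : Π x : M, TangentSpace (𝓡 n) x} {x : M}
    (hX : ∀ᶠ y in 𝓝 x, VFSmoothAt X y) (hY : ∀ᶠ y in 𝓝 x, VFSmoothAt Y y) :
    VFSmoothAt (fun y ↦ leviCivita Y y (X y)) x := by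
  refine vfSmoothAt_of_inner fun Z hZ ↦ ?_
  refine (contMDiffAt_const.mul (contMDiffAt_koszul hX.self_of_nhds hY.self_of_nhds
    hZ.self_of_nhds) (f := fun _ ↦ (1 / 2 : ℝ))).congr_of_eventuallyEq ?_
  filter_upwards [hX, hY, hZ] with y h1 h2 h3
  rw [real_inner_comm, inner_leviCivita h1.secDiffAt h2.secDiffAt h3.secDiffAt]
  rfl

end CovSmooth

/-! ### The covariant derivative and the covariant exterior derivative of a form -/

section Nabla

variable {n : ℕ} {M : Type*} [TopologicalSpace M] [ChartedSpace (EuclideanSpace ℝ (Fin n)) M]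
  [IsManifold (𝓡 n) ∞ M]
  {F : Type*} [NormedAddCommGroup F] [NormedSpace ℝ F]
  {V : M → Type*} [TopologicalSpace (TotalSpace F V)]
  [∀ x, NormedAddCommGroup (V x)] [∀ x, InnerProductSpace ℝ (V x)]
  [FiberBundle F V] [VectorBundle ℝ F V] [ContMDiffVectorBundle ∞ F V (𝓡 n)]
  [RiemannianBundle (fun x : M ↦ TangentSpace (𝓡 n) x)]
  [IsContMDiffRiemannianBundle (𝓡 n) ∞ (EuclideanSpace ℝ (Fin n))
    (fun x : M ↦ TangentSpace (𝓡 n) x)] {k : ℕ}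
  (cov : CovariantDerivative (𝓡 n) F V)
  {φ : Π x : M, TangentSpace (𝓡 n) x [⋀^Fin k]→L[ℝ] V x} {x : M}

/-- The right-hand side of `(∇_v φ)(W₁, …, W_k) = ∇_v (φ(W₁, …, W_k)) - ∑_a φ(…, ∇_v W_a, …)`, for
arbitrary vector fields `W_a`. -/
def nablaFields (φ : Π x : M, TangentSpace (𝓡 n) x [⋀^Fin k]→L[ℝ] V x)
    (W : Fin k → Π x : M, TangentSpace (𝓡 n) x) (x : M) (v : TangentSpace (𝓡 n) x) : V x :=
  cov (fun y ↦ φ y (fun a ↦ W a y)) x v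
    - ∑ a, φ x (Function.update (fun b ↦ W b x) a (leviCivita (W a) x v))

lemma nabla_eq_nablaFields_ext (v : TangentSpace (𝓡 n) x) (w : Fin k → TangentSpace (𝓡 n) x) :
    nabla cov φ x v w = nablaFields cov φ (fun a ↦ ext (w a)) x v := by
  simp [nabla, nablaFields]

lemma update_field (W : Fin k → Π x : M, TangentSpace (𝓡 n) x) (a : Fin k)
    (Y : Π x : M, TangentSpace (𝓡 n) x) (y : M) :
    (fun c ↦ Function.update W a Y c y) = Function.update (fun c ↦ W c y) a (Y y) := by
  ext1 c
  rcases eq_or_ne c a with rfl | h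
  · simp
  · simp [h]

lemma nablaFields_update (W : Fin k → Π x : M, TangentSpace (𝓡 n) x) (a : Fin k)
    (Y : Π x : M, TangentSpace (𝓡 n) x) (v : TangentSpace (𝓡 n) x) :
    nablaFields cov φ (Function.update W a Y) x v
      = cov (fun y ↦ φ y (Function.update (fun c ↦ W c y) a (Y y))) x v
        - (φ x (Function.update (fun c ↦ W c x) a (leviCivita Y x v))
          + ∑ b ∈ Finset.univ.erase a, φ x (Function.update (Function.update (fun c ↦ W c x) b
            (leviCivita (W b) x v)) a (Y x))) := by
  rw [nablaFields, ← Finset.add_sum_erase _ _ (Finset.mem_univ a)]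
  simp only [update_field, Function.update_self, Function.update_idem]
  congr 2
  refine Finset.sum_congr rfl fun b hb ↦ ?_
  have hb : b ≠ a := (Finset.mem_erase.1 hb).1
  rw [Function.update_of_ne hb, Function.update_comm hb.symm]

/-- `∇_v φ (W₁, …, W_k)` is `C^∞`-linear in each field `W_a`: the derivatives of a factor `f` from
`∇_v (φ(…, f Y, …))` and from `φ(…, ∇_v (f Y), …)` cancel. -/
lemma nablaFields_tensorialAt (hφ : FormDiffAt F φ x)
    {W : Fin k → Π x : M, TangentSpace (𝓡 n) x} (hW : ∀ a, VFDiffAt (W a) x) (a : Fin k)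
    (v : TangentSpace (𝓡 n) x) :
    TensorialAt (𝓡 n) (EuclideanSpace ℝ (Fin n))
      (fun Y ↦ nablaFields cov φ (Function.update W a Y) x v) x := by
  have hu : ∀ {Y : Π x : M, TangentSpace (𝓡 n) x}, VFDiffAt Y x →
      SecDiffAt n F (fun y ↦ φ y (Function.update (fun c ↦ W c y) a (Y y))) x := by
    intro Y hY
    simp only [← update_field]
    refine hφ.eval fun c ↦ ?_
    rcases eq_or_ne c a with rfl | h
    · simpa using hY
    · simpa [h] using hW c
  constructor
  · intro f Y hf hY
    have h1 : (fun y ↦ φ y (Function.update (fun c ↦ W c y) a ((f • Y) y)))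
        = f • fun y ↦ φ y (Function.update (fun c ↦ W c y) a (Y y)) := by
      ext1 y
      simp [ContinuousAlternatingMap.map_update_smul]
    have h2 := cov.isCovariantDerivativeOn.leibniz (s := Set.univ) (hu hY) hf
    simp only [nablaFields_update, h1, h2, leviCivita_smul hf hY]
    simp only [Pi.smul_apply', ContinuousAlternatingMap.map_update_smul,
      ContinuousAlternatingMap.map_update_add, smul_sub, smul_add, Finset.smul_sum,
      add_apply, smul_apply,
      ContinuousLinearMap.smulRight_apply]
    abel
  · intro Y Y' hY hY'
    have h1 : (fun y ↦ φ y (Function.update (fun c ↦ W c y) a ((Y + Y') y)))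
        = (fun y ↦ φ y (Function.update (fun c ↦ W c y) a (Y y)))
          + fun y ↦ φ y (Function.update (fun c ↦ W c y) a (Y' y)) := by
      ext1 y
      simp [ContinuousAlternatingMap.map_update_add]
    have h2 := cov.isCovariantDerivativeOn.add (s := Set.univ) (hu hY) (hu hY')
    simp only [nablaFields_update, h1, h2, leviCivita_add hY hY']
    simp only [Pi.add_apply, ContinuousAlternatingMap.map_update_add, Finset.sum_add_distrib,
      add_apply]
    abel

/-- `∇_v φ (W₁, …, W_k)` depends only on the values at `x` of the fields `W_a`. -/
lemma nablaFields_congr (hφ : FormDiffAt F φ x)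
    {W W' : Fin k → Π x : M, TangentSpace (𝓡 n) x} (hW : ∀ a, VFDiffAt (W a) x)
    (hW' : ∀ a, VFDiffAt (W' a) x) (h : ∀ a, W a x = W' a x) (v : TangentSpace (𝓡 n) x) :
    nablaFields cov φ W x v = nablaFields cov φ W' x v := by
  classical
  have key : ∀ s : Finset (Fin k),
      nablaFields cov φ (s.piecewise W' W) x v = nablaFields cov φ W x v := by
    intro s
    induction s using Finset.induction_on with
    | empty => simp
    | insert a s ha ih =>
      have hs : ∀ b, VFDiffAt (s.piecewise W' W b) x := by
        intro b
        by_cases hb : b ∈ s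
        · simpa [hb] using hW' b
        · simpa [hb] using hW b
      have h1 := (nablaFields_tensorialAt cov hφ hs a v).pointwise (hW' a) (hW a) (h a).symm
      rw [Finset.piecewise_insert]
      refine h1.trans ?_
      rw [← ih]
      congr 1
      have : W a = s.piecewise W' W a := by simp [ha]
      rw [this, Function.update_eq_self]
  have := key Finset.univ
  rw [Finset.piecewise_univ] at this
  exact this.symm

lemma nabla_eq_nablaFields (hφ : FormDiffAt F φ x)
    {W : Fin k → Π x : M, TangentSpace (𝓡 n) x} (hW : ∀ a, VFDiffAt (W a) x)
    (v : TangentSpace (𝓡 n) x) :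
    nabla cov φ x v (fun a ↦ W a x) = nablaFields cov φ W x v := by
  rw [nabla_eq_nablaFields_ext]
  exact nablaFields_congr cov hφ (fun a ↦ mdifferentiableAt_ext _) hW (fun a ↦ ext_self _) v

/-- The form `∇_v φ` at `x`. -/
def nablaAlternating (hφ : FormDiffAt F φ x) (v : TangentSpace (𝓡 n) x) :
    TangentSpace (𝓡 n) x [⋀^Fin k]→ₗ[ℝ] V x where
  toFun := nabla cov φ x v
  map_update_add' {inst} w a u u' := by
    obtain rfl : inst = instDecidableEqFin k := Subsingleton.elim _ _
    have hw : ∀ b, VFDiffAt (ext (w b)) x := fun b ↦ mdifferentiableAt_ext _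
    have h := nablaFields_tensorialAt cov hφ hw a v
    have h0 : ∀ {Y}, VFDiffAt Y x → nabla cov φ x v (Function.update w a (Y x))
        = nablaFields cov φ (Function.update (fun b ↦ ext (w b)) a Y) x v := by
      intro Y hY
      rw [← nabla_eq_nablaFields cov hφ]
      · simp [update_field]
      · intro c
        rcases eq_or_ne c a with rfl | h
        · simpa using hY
        · simpa [h] using hw c
    have h1 := h0 (mdifferentiableAt_ext u)
    have h2 := h0 (mdifferentiableAt_ext u')
    have h3 := h0 (mdifferentiableAt_add_section (mdifferentiableAt_ext u)
      (mdifferentiableAt_ext u'))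
    simp only [Pi.add_apply, ext_self] at h1 h2 h3
    rw [h1, h2, h3]
    exact h.add (mdifferentiableAt_ext u) (mdifferentiableAt_ext u')
  map_update_smul' {inst} w a r u := by
    obtain rfl : inst = instDecidableEqFin k := Subsingleton.elim _ _
    have hw : ∀ b, VFDiffAt (ext (w b)) x := fun b ↦ mdifferentiableAt_ext _
    have h := nablaFields_tensorialAt cov hφ hw a v
    have h0 : ∀ {Y}, VFDiffAt Y x → nabla cov φ x v (Function.update w a (Y x))
        = nablaFields cov φ (Function.update (fun b ↦ ext (w b)) a Y) x v := by
      intro Y hY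
      rw [← nabla_eq_nablaFields cov hφ]
      · simp [update_field]
      · intro c
        rcases eq_or_ne c a with rfl | h
        · simpa using hY
        · simpa [h] using hw c
    have hr : MDifferentiableAt (𝓡 n) 𝓘(ℝ, ℝ) (fun _ : M ↦ r) x := mdifferentiableAt_const
    have h1 := h0 (mdifferentiableAt_ext u)
    have h3 := h0 (hr.smul_section (mdifferentiableAt_ext u))
    simp only [Pi.smul_apply', ext_self] at h1 h3
    rw [h1, h3]
    exact h.smul hr (mdifferentiableAt_ext u)
  map_eq_zero_of_eq' w i j hij hne := by
    have h1 : (fun y ↦ φ y (fun a ↦ ext (w a) y)) = 0 := by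
      ext1 y
      exact (φ y).map_eq_zero_of_eq _ (by simp [hij]) hne
    have h2 : ∀ a, a ≠ i → a ≠ j →
        φ x (Function.update w a (leviCivita (ext (w a)) x v)) = 0 := fun a hi hj ↦
      (φ x).map_eq_zero_of_eq _ (by simp [hi.symm, hj.symm, hij]) hne
    have h3 : ∀ u, φ x (Function.update w i u) + φ x (Function.update w j u) = 0 := by
      intro u
      have : Function.update w j u = Function.update w i u ∘ Equiv.swap i j := by
        ext1 a
        rcases eq_or_ne a i with rfl | hi
        · simp [hne, hne.symm, hij]
        · rcases eq_or_ne a j with rfl | hj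
          · simp
          · simp [hi, hj, Equiv.swap_apply_of_ne_of_ne]
      rw [this]
      have h := (φ x).toAlternatingMap.map_swap (Function.update w i u) hne
      exact (congrArg (φ x (Function.update w i u) + ·) h).trans (add_neg_cancel _)
    change cov _ x v - _ = _
    rw [h1, cov.zero]
    rw [Finset.sum_eq_add i j hne (fun a _ ha ↦ h2 a ha.1 ha.2) (by simp) (by simp), hij, h3]
    simp

@[simp] lemma nablaAlternating_apply (hφ : FormDiffAt F φ x) (v : TangentSpace (𝓡 n) x)
    (w : Fin k → TangentSpace (𝓡 n) x) :
    nablaAlternating cov hφ v w = nabla cov φ x v w := rfl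

lemma nabla_add_left (v v' : TangentSpace (𝓡 n) x) (w : Fin k → TangentSpace (𝓡 n) x) :
    nabla cov φ x (v + v') w = nabla cov φ x v w + nabla cov φ x v' w := by
  simp only [nabla, map_add, leviCivita_add_vec (mdifferentiableAt_ext _),
    ContinuousAlternatingMap.map_update_add, Finset.sum_add_distrib]
  abel

lemma nabla_smul_left (r : ℝ) (v : TangentSpace (𝓡 n) x) (w : Fin k → TangentSpace (𝓡 n) x) :
    nabla cov φ x (r • v) w = r • nabla cov φ x v w := by
  simp only [nabla, map_smul, leviCivita_smul_vec (mdifferentiableAt_ext _),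
    ContinuousAlternatingMap.map_update_smul, ← Finset.smul_sum, smul_sub]

/-- As the Levi-Civita connection is torsion free, `d^∇ φ` is the alternation of `∇φ`. -/
lemma covExtDeriv_eq_sum_nabla (w : Fin (k + 1) → TangentSpace (𝓡 n) x) :
    covExtDeriv cov φ x w
      = ∑ i : Fin (k + 1), (-1 : ℝ) ^ (i : ℕ) • nabla cov φ x (w i) (i.removeNth w) := by
  -- `B i j` is `∇_{w_i} W_j`, and `T i j u` is the term in which `w_i` is removed from the list
  -- and `u` replaces `w_j`.
  let B : Fin (k + 1) → Fin (k + 1) → TangentSpace (𝓡 n) x :=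
    fun i j ↦ leviCivita (ext (w j)) x (w i)
  let T : Fin (k + 1) → Fin (k + 1) → TangentSpace (𝓡 n) x → V x :=
    fun i j u ↦ (-1 : ℝ) ^ (i : ℕ) • φ x (i.removeNth (Function.update w j u))
  have hT : ∀ (i : Fin (k + 1)) (a : Fin k) (u : TangentSpace (𝓡 n) x),
      (-1 : ℝ) ^ (i : ℕ) • φ x (Function.update (i.removeNth w) a u) = T i (i.succAbove a) u := by
    intro i a u
    simp only [T]
    congr 2
    ext1 b
    simp only [Fin.removeNth, Function.update_apply, Fin.succAbove_right_inj]
  have hTsub : ∀ i j u u', i ≠ j → T i j (u - u') = T i j u - T i j u' := by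
    intro i j u u' hij
    obtain ⟨a, rfl⟩ := Fin.exists_succAbove_eq hij.symm
    rw [← hT, ← hT, ← hT, ContinuousAlternatingMap.map_update_sub, smul_sub]
  have hswap : ∀ i j u, i ≠ j → T i j u = - T j i u := by
    intro i j u hij
    have h := (φ x).neg_one_pow_smul_map_removeNth_add_eq_zero_of_eq
      (v := Function.update (Function.update w i u) j u) (i := i) (j := j)
      (by simp [hij]) hij
    have h1 : i.removeNth (Function.update (Function.update w i u) j u)
        = i.removeNth (Function.update w j u) := by
      rw [Function.update_comm hij]
      ext1 b
      simp [Fin.removeNth]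
    have h2 : j.removeNth (Function.update (Function.update w i u) j u)
        = j.removeNth (Function.update w i u) := by
      ext1 b
      simp [Fin.removeNth]
    rw [h1, h2] at h
    rw [eq_neg_iff_add_eq_zero, ← h]
    simp only [T]
    have hz : ∀ (m : ℕ) (z : V x), (-1 : ℝ) ^ m • z = (-1 : ℤ) ^ m • z := by
      intro m z
      rcases Nat.even_or_odd m with hm | hm
      · simp [hm.neg_one_pow]
      · simp [hm.neg_one_pow]
    rw [hz, hz]
  have hbr : ∀ i j, VectorField.mlieBracket (𝓡 n) (ext (w i)) (ext (w j)) x = B i j - B j i := by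
    intro i j
    have := leviCivita_sub_swap (mdifferentiableAt_ext (w i)) (mdifferentiableAt_ext (w j))
    simpa [B] using this.symm
  -- The brackets contribute one term for each `i < j`, the corrections in `nabla` one for each
  -- `i ≠ j`. The terms match as `T` changes its sign when `i` and `j` are exchanged.
  have hL : ∀ i : Fin (k + 1), (-1 : ℝ) ^ (i : ℕ) • (∑ a : Fin k, if i ≤ a.castSucc then
          φ x (Function.update (fun b ↦ w (i.succAbove b)) a
            (VectorField.mlieBracket (𝓡 n) (ext (w i)) (ext (w (i.succAbove a))) x)) else 0)
      = ∑ j, if i < j then T i j (B i j) - T i j (B j i) else 0 := by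
    intro i
    rw [Fin.sum_univ_succAbove _ i]
    simp only [lt_self_iff_false, if_false, zero_add, Finset.smul_sum]
    refine Finset.sum_congr rfl fun a _ ↦ ?_
    simp only [Fin.lt_succAbove_iff_le_castSucc]
    split_ifs
    · rw [← hTsub _ _ _ _ (Fin.succAbove_ne i a).symm, ← hT, hbr]
      rfl
    · simp
  have hR : ∀ i : Fin (k + 1), (-1 : ℝ) ^ (i : ℕ) • (∑ a : Fin k, φ x (Function.update
      (i.removeNth w) a (leviCivita (ext (i.removeNth w a)) x (w i))))
      = ∑ j, if i = j then 0 else T i j (B i j) := by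
    intro i
    rw [Fin.sum_univ_succAbove _ i]
    simp only [if_true, zero_add, Finset.smul_sum, (Fin.succAbove_ne i _).symm, if_false]
    refine Finset.sum_congr rfl fun a _ ↦ ?_
    rw [hT]
    rfl
  have hsum : ∑ i, ∑ j, (if i < j then T i j (B i j) - T i j (B j i) else 0)
      = ∑ i, ∑ j, if i = j then 0 else T i j (B i j) := by
    have h1 : ∀ i j, (if i < j then T i j (B i j) - T i j (B j i) else 0)
        = (if i < j then T i j (B i j) else 0) + if i < j then T j i (B j i) else 0 := by
      intro i j
      split_ifs with h
      · rw [hswap i j (B j i) h.ne, sub_neg_eq_add]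
      · simp
    have h2 : ∀ i j, (if i = j then 0 else T i j (B i j))
        = (if i < j then T i j (B i j) else 0) + if j < i then T i j (B i j) else 0 := by
      intro i j
      rcases lt_trichotomy i j with h | h | h
      · simp [h, h.ne, h.not_gt]
      · simp [h]
      · simp [h, h.ne', h.not_gt]
    simp only [h1, h2, Finset.sum_add_distrib]
    congr 1
    rw [Finset.sum_comm]
  simp only [covExtDeriv, nabla, smul_sub, Finset.sum_sub_distrib, hL, hR, hsum]
  rfl

end Nabla

/-! ### Independence of the orthonormal basis -/

section BasisIndependence

variable {n k : ℕ} {T H : Type*} [NormedAddCommGroup T] [InnerProductSpace ℝ T]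
  [NormedAddCommGroup H] [InnerProductSpace ℝ H]

lemma sum_inner_mul_inner_eq_ite (b b' : OrthonormalBasis (Fin n) ℝ T)
    (i j : Fin n) :
    ∑ l, inner ℝ (b i) (b' l) * inner ℝ (b j) (b' l) = if i = j then 1 else 0 := by
  have h := b'.sum_inner_mul_inner (b i) (b j)
  rw [← orthonormal_iff_ite.1 b.orthonormal i j, ← h]
  exact Finset.sum_congr rfl fun l _ ↦ by rw [real_inner_comm (b' l) (b j)]

/-- The inner product of multilinear maps does not depend on the orthonormal basis. -/
lemma sum_inner_multilinear_eq (b b' : OrthonormalBasis (Fin n) ℝ T)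
    (α β : MultilinearMap ℝ (fun _ : Fin k ↦ T) H) :
    ∑ J : Fin k → Fin n, inner ℝ (α fun a ↦ b' (J a)) (β fun a ↦ b' (J a))
      = ∑ J : Fin k → Fin n, inner ℝ (α fun a ↦ b (J a)) (β fun a ↦ b (J a)) := by
  have hexp : ∀ (γ : MultilinearMap ℝ (fun _ : Fin k ↦ T) H) (J : Fin k → Fin n),
      γ (fun a ↦ b' (J a)) = ∑ K : Fin k → Fin n,
        (∏ a, inner ℝ (b (K a)) (b' (J a))) • γ fun a ↦ b (K a) := by
    intro γ J
    have : (fun a ↦ b' (J a)) = fun a ↦ ∑ i, inner ℝ (b i) (b' (J a)) • b i := by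
      ext1 a
      exact (b.sum_repr' _).symm
    rw [this, MultilinearMap.map_sum]
    simp only [MultilinearMap.map_smul_univ]
  have h1 : ∀ J : Fin k → Fin n, inner ℝ (α fun a ↦ b' (J a)) (β fun a ↦ b' (J a))
      = ∑ K : Fin k → Fin n, ∑ L : Fin k → Fin n,
        (∏ a, inner ℝ (b (K a)) (b' (J a)) * inner ℝ (b (L a)) (b' (J a)))
          * inner ℝ (α fun a ↦ b (K a)) (β fun a ↦ b (L a)) := by
    intro J
    rw [hexp α, hexp β, sum_inner]
    refine Finset.sum_congr rfl fun K _ ↦ ?_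
    rw [inner_sum]
    refine Finset.sum_congr rfl fun L _ ↦ ?_
    rw [inner_smul_left, inner_smul_right, Finset.prod_mul_distrib]
    simp [mul_assoc]
  simp only [h1]
  rw [Finset.sum_comm]
  refine Finset.sum_congr rfl fun K _ ↦ ?_
  rw [Finset.sum_comm]
  have h2 : ∀ L : Fin k → Fin n, ∑ J : Fin k → Fin n,
      (∏ a, inner ℝ (b (K a)) (b' (J a)) * inner ℝ (b (L a)) (b' (J a)))
        = if K = L then 1 else 0 := by
    intro L
    have h3 := Finset.prod_univ_sum (fun _ : Fin k ↦ (Finset.univ : Finset (Fin n)))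
      (fun a j ↦ inner ℝ (b (K a)) (b' j) * inner ℝ (b (L a)) (b' j))
    rw [Fintype.piFinset_univ] at h3
    rw [← h3]
    simp only [sum_inner_mul_inner_eq_ite]
    split_ifs with h
    · simp [h]
    · obtain ⟨a, ha⟩ := Function.ne_iff.1 h
      exact Finset.prod_eq_zero (Finset.mem_univ a) (by simp [ha])
  simp only [← Finset.sum_mul, h2]
  simp

/-- The trace of a bilinear map does not depend on the orthonormal basis. -/
lemma sum_bilinear_eq (b b' : OrthonormalBasis (Fin n) ℝ T) (B : T →ₗ[ℝ] T →ₗ[ℝ] H) :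
    ∑ i, B (b' i) (b' i) = ∑ i, B (b i) (b i) := by
  have h1 : ∀ l, B (b' l) (b' l)
      = ∑ i, ∑ j, (inner ℝ (b i) (b' l) * inner ℝ (b j) (b' l)) • B (b i) (b j) := by
    intro l
    conv_lhs => rw [← b.sum_repr' (b' l)]
    simp only [map_sum, map_smul, LinearMap.sum_apply, LinearMap.smul_apply, Finset.smul_sum,
      smul_smul]
    rw [Finset.sum_comm]
    refine Finset.sum_congr rfl fun i _ ↦ Finset.sum_congr rfl fun j _ ↦ ?_
    rw [mul_comm]
  simp only [h1]
  rw [Finset.sum_comm]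
  refine Finset.sum_congr rfl fun i _ ↦ ?_
  rw [Finset.sum_comm]
  simp only [← Finset.sum_smul, sum_inner_mul_inner_eq_ite]
  simp

/-- A skew-symmetric endomorphism acts on multilinear maps as a skew-symmetric endomorphism: the
terms are matched by the involution `(J, l) ↦ (J with l in slot c, J c)`. -/
lemma sum_inner_skew (b : OrthonormalBasis (Fin n) ℝ T)
    (α β : MultilinearMap ℝ (fun _ : Fin k ↦ T) H) (A : Fin n → T)
    (hA : ∀ i j, inner ℝ (A i) (b j) + inner ℝ (b i) (A j) = 0) (c : Fin k) :
    ∑ J : Fin k → Fin n,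
      (inner ℝ (α (Function.update (fun a ↦ b (J a)) c (A (J c)))) (β fun a ↦ b (J a))
        + inner ℝ (α fun a ↦ b (J a)) (β (Function.update (fun a ↦ b (J a)) c (A (J c))))) = 0 := by
  have hexp : ∀ (γ : MultilinearMap ℝ (fun _ : Fin k ↦ T) H) (J : Fin k → Fin n),
      γ (Function.update (fun a ↦ b (J a)) c (A (J c)))
        = ∑ l, inner ℝ (b l) (A (J c)) • γ fun a ↦ b (Function.update J c l a) := by
    intro γ J
    have h : ∀ l, (fun a ↦ b (Function.update J c l a))
        = Function.update (fun a ↦ b (J a)) c (b l) := fun l ↦ by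
      ext1 a
      rcases eq_or_ne a c with rfl | h <;> simp [*]
    simp only [h]
    conv_lhs => rw [← b.sum_repr' (A (J c))]
    rw [MultilinearMap.map_update_sum]
    simp only [MultilinearMap.map_update_smul]
  let e : Equiv.Perm ((Fin k → Fin n) × Fin n) :=
    Function.Involutive.toPerm (fun p ↦ (Function.update p.1 c p.2, p.1 c)) (by
      rintro ⟨J, l⟩
      simp)
  have h1 : ∑ J : Fin k → Fin n,
      inner ℝ (α (Function.update (fun a ↦ b (J a)) c (A (J c)))) (β fun a ↦ b (J a))
        = ∑ p : (Fin k → Fin n) × Fin n, inner ℝ (b p.2) (A (p.1 c)) *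
          inner ℝ (α fun a ↦ b (Function.update p.1 c p.2 a)) (β fun a ↦ b (p.1 a)) := by
    rw [Fintype.sum_prod_type]
    refine Finset.sum_congr rfl fun J _ ↦ ?_
    simp only [hexp, sum_inner, inner_smul_left]
    rfl
  have h2 : ∑ J : Fin k → Fin n,
      inner ℝ (α fun a ↦ b (J a)) (β (Function.update (fun a ↦ b (J a)) c (A (J c))))
        = ∑ p : (Fin k → Fin n) × Fin n, inner ℝ (b p.2) (A (p.1 c)) *
          inner ℝ (α fun a ↦ b (p.1 a)) (β fun a ↦ b (Function.update p.1 c p.2 a)) := by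
    rw [Fintype.sum_prod_type]
    refine Finset.sum_congr rfl fun J _ ↦ ?_
    simp only [hexp, inner_sum, inner_smul_right]
  rw [Finset.sum_add_distrib, h1, h2, ← Equiv.sum_comp e, ← Finset.sum_add_distrib]
  refine Finset.sum_eq_zero fun p _ ↦ ?_
  have h3 : e p = (Function.update p.1 c p.2, p.1 c) := rfl
  have h4 := hA (p.1 c) p.2
  rw [real_inner_comm] at h4
  simp only [h3, Function.update_self, Function.update_idem, Function.update_eq_self]
  rw [← add_mul]
  rw [mul_eq_zero]
  left
  linarith

end BasisIndependence

/-! ### The inner product of forms -/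

section FormInner

variable {n : ℕ} {M : Type*} [TopologicalSpace M] [ChartedSpace (EuclideanSpace ℝ (Fin n)) M]
  [IsManifold (𝓡 n) ∞ M]
  {F : Type*} [NormedAddCommGroup F] [NormedSpace ℝ F]
  {V : M → Type*} [TopologicalSpace (TotalSpace F V)]
  [∀ x, NormedAddCommGroup (V x)] [∀ x, InnerProductSpace ℝ (V x)]
  [FiberBundle F V] [VectorBundle ℝ F V] [ContMDiffVectorBundle ∞ F V (𝓡 n)]
  [RiemannianBundle (fun x : M ↦ TangentSpace (𝓡 n) x)]
  [IsContMDiffRiemannianBundle (𝓡 n) ∞ (EuclideanSpace ℝ (Fin n))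
    (fun x : M ↦ TangentSpace (𝓡 n) x)] {k : ℕ}
  {φ ψ : Π x : M, TangentSpace (𝓡 n) x [⋀^Fin k]→L[ℝ] V x} {x : M}

lemma formInner_eq_sum {y : M} (b : OrthonormalBasis (Fin n) ℝ (TangentSpace (𝓡 n) y))
    (α β : TangentSpace (𝓡 n) y [⋀^Fin k]→ₗ[ℝ] V y) :
    formInner y α β = (1 / (k.factorial : ℝ)) *
      ∑ J : Fin k → Fin n, inner ℝ (α fun a ↦ b (J a)) (β fun a ↦ b (J a)) := by
  rw [formInner]
  congr 1
  exact (sum_inner_multilinear_eq (frame y) b α.toMultilinearMap β.toMultilinearMap).symm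

lemma eventually_formInner_eq {E : Fin n → Π x : M, TangentSpace (𝓡 n) x}
    (hE : ∀ᶠ y in 𝓝 x, Orthonormal ℝ (fun i ↦ E i y)) :
    (fun y ↦ formInner y (φ y) (ψ y)) =ᶠ[𝓝 x] fun y ↦ (1 / (k.factorial : ℝ)) *
      ∑ J : Fin k → Fin n, inner ℝ (φ y fun a ↦ E (J a) y) (ψ y fun a ↦ E (J a) y) := by
  filter_upwards [hE] with y hy
  have := formInner_eq_sum (orthonormalBasisOf _ hy) (φ y).toAlternatingMap (ψ y).toAlternatingMap
  simpa using this

lemma mvfderiv_congr {f g : M → ℝ} {x : M} (h : f =ᶠ[𝓝 x] g) :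
    mvfderiv (𝓡 n) f x = mvfderiv (𝓡 n) g x := by
  rw [mvfderiv, mvfderiv, h.mfderiv_eq]
  rfl

lemma mvfderiv_finset_sum {ι : Type*} (s : Finset ι) {f : ι → M → ℝ} {x : M}
    (hf : ∀ i ∈ s, MDifferentiableAt (𝓡 n) 𝓘(ℝ, ℝ) (f i) x) :
    MDifferentiableAt (𝓡 n) 𝓘(ℝ, ℝ) (fun y ↦ ∑ i ∈ s, f i y) x ∧
    mvfderiv (𝓡 n) (fun y ↦ ∑ i ∈ s, f i y) x = ∑ i ∈ s, mvfderiv (𝓡 n) (f i) x := by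
  classical
  induction s using Finset.induction_on with
  | empty =>
    simp only [Finset.sum_empty]
    exact ⟨mdifferentiableAt_const, mvfderiv_const _⟩
  | insert a s ha ih =>
    simp only [Finset.sum_insert ha]
    obtain ⟨h1, h2⟩ := ih fun i hi ↦ hf i (Finset.mem_insert_of_mem hi)
    have h3 := hf a (Finset.mem_insert_self a s)
    exact ⟨h3.add h1, by rw [← h2]; exact mvfderiv_fun_add h3 h1⟩

variable [IsContMDiffRiemannianBundle (𝓡 n) ∞ F V]

lemma isContMDiffRiemannianBundle_one : IsContMDiffRiemannianBundle (𝓡 n) 1 F V :=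
  .of_le (n := ∞) (by norm_cast)

lemma contMDiffAt_formInner (hφ : FormSmoothAt F φ x) (hψ : FormSmoothAt F ψ x) :
    ContMDiffAt (𝓡 n) 𝓘(ℝ, ℝ) ∞ (fun y ↦ formInner y (φ y) (ψ y)) x := by
  obtain ⟨E, -, hE⟩ := exists_orthonormal_frame (n := n) x
  refine ContMDiffAt.congr_of_eventuallyEq ?_ (eventually_formInner_eq (hE.mono fun y hy ↦ hy.2))
  have hEx := hE.self_of_nhds.1
  refine ContMDiffAt.mul contMDiffAt_const (ContMDiffAt.sum fun J _ ↦ ?_)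
  exact ContMDiffAt.inner_bundle (hφ.eval fun a ↦ hEx (J a)) (hψ.eval fun a ↦ hEx (J a))

variable [FiniteDimensional ℝ F] {cov : CovariantDerivative (𝓡 n) F V}

lemma mvfderiv_inner_cov (hcov : cov.IsMetricCompatible) {σ τ : Π x : M, V x}
    (hσ : SecDiffAt n F σ x) (hτ : SecDiffAt n F τ x) (v : TangentSpace (𝓡 n) x) :
    mvfderiv (𝓡 n) (fun y ↦ inner ℝ (σ y) (τ y)) x v
      = inner ℝ (cov σ x v) (τ x) + inner ℝ (σ x) (cov τ x v) := by
  have : IsContMDiffRiemannianBundle (𝓡 n) 1 F V := isContMDiffRiemannianBundle_one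
  have : ContMDiffVectorBundle 1 F V (𝓡 n) := .of_le (n := ∞) (by norm_cast)
  have h := hcov.mvfderiv_inner_eq (ext v) hσ hτ
  simpa using h

/-- The product rule for the inner product of two forms. -/
lemma mvfderiv_formInner (hcov : cov.IsMetricCompatible) (hφ : FormDiffAt F φ x)
    (hψ : FormDiffAt F ψ x) (v : TangentSpace (𝓡 n) x) :
    mvfderiv (𝓡 n) (fun y ↦ formInner y (φ y) (ψ y)) x v
      = formInner x (nabla cov φ x v) (ψ x) + formInner x (φ x) (nabla cov ψ x v) := by
  have : IsContMDiffRiemannianBundle (𝓡 n) 1 F V := isContMDiffRiemannianBundle_one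
  obtain ⟨E, hEx, hE⟩ := exists_orthonormal_frame (n := n) x
  have hEd : ∀ i, VFDiffAt (E i) x := fun i ↦ (hE.self_of_nhds.1 i).secDiffAt
  have hφJ : ∀ J : Fin k → Fin n, SecDiffAt n F (fun y ↦ φ y fun a ↦ E (J a) y) x :=
    fun J ↦ hφ.eval fun a ↦ hEd (J a)
  have hψJ : ∀ J : Fin k → Fin n, SecDiffAt n F (fun y ↦ ψ y fun a ↦ E (J a) y) x :=
    fun J ↦ hψ.eval fun a ↦ hEd (J a)
  have hd := mvfderiv_finset_sum (n := n) Finset.univ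
    (f := fun (J : Fin k → Fin n) y ↦ inner ℝ (φ y fun a ↦ E (J a) y) (ψ y fun a ↦ E (J a) y))
    (x := x) (fun J _ ↦ (hφJ J).inner_bundle (hψJ J))
  have hc : MDifferentiableAt (𝓡 n) 𝓘(ℝ, ℝ) (fun _ : M ↦ (1 / (k.factorial : ℝ))) x :=
    mdifferentiableAt_const
  have hm := mvfderiv_fun_mul hc hd.1
  have hcongr := mvfderiv_congr (n := n) (eventually_formInner_eq (n := n) (φ := φ) (ψ := ψ)
    (hE.mono fun y hy ↦ hy.2))
  -- The matrix of the connection in the orthonormal frame `E` is skew-symmetric, so that its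
  -- contributions to the two covariant derivatives cancel.
  have hskew : ∀ i j, inner ℝ (leviCivita (E i) x v) (frame x j)
      + inner ℝ (frame x i) (leviCivita (E j) x v) = 0 := by
    intro i j
    have h := mvfderiv_inner_leviCivita (hEd i) (hEd j) v
    rw [hEx, hEx] at h
    rw [← h]
    have h1 : (fun y ↦ inner ℝ (E i y) (E j y)) =ᶠ[𝓝 x] fun _ ↦ if i = j then (1 : ℝ) else 0 :=
      hE.mono fun y hy ↦ orthonormal_iff_ite.1 hy.2 i j
    rw [mvfderiv_congr h1, mvfderiv_const]
    rfl
  have hn : ∀ {χ : Π x : M, TangentSpace (𝓡 n) x [⋀^Fin k]→L[ℝ] V x}, FormDiffAt F χ x →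
      ∀ J : Fin k → Fin n, cov (fun y ↦ χ y fun a ↦ E (J a) y) x v
        = nabla cov χ x v (fun a ↦ frame x (J a))
          + ∑ c, χ x (Function.update (fun a ↦ frame x (J a)) c (leviCivita (E (J c)) x v)) := by
    intro χ hχ J
    have h := nabla_eq_nablaFields cov hχ (fun a ↦ hEd (J a)) v
    simp only [hEx] at h
    rw [h, nablaFields]
    simp only [hEx]
    abel
  have hsk := fun c ↦ sum_inner_skew (frame x) (φ x).toMultilinearMap (ψ x).toMultilinearMap
    (fun i ↦ leviCivita (E i) x v) hskew c
  have hval : mvfderiv (𝓡 n) (fun y ↦ (1 / (k.factorial : ℝ)) * ∑ J : Fin k → Fin n,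
        inner ℝ (φ y fun a ↦ E (J a) y) (ψ y fun a ↦ E (J a) y)) x v
      = (1 / (k.factorial : ℝ)) * ∑ J : Fin k → Fin n,
        mvfderiv (𝓡 n) (fun y ↦ inner ℝ (φ y fun a ↦ E (J a) y) (ψ y fun a ↦ E (J a) y)) x v := by
    rw [hm, hd.2, mvfderiv_const]
    simp
  rw [hcongr, hval, formInner, formInner, ← mul_add, ← Finset.sum_add_distrib]
  congr 1
  rw [← sub_eq_zero, ← Finset.sum_sub_distrib]
  refine Eq.trans ?_ (Finset.sum_eq_zero fun c (_ : c ∈ Finset.univ) ↦ hsk c)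
  rw [Finset.sum_comm]
  refine Finset.sum_congr rfl fun J _ ↦ ?_
  rw [mvfderiv_inner_cov hcov (hφJ _) (hψJ _), hn hφ, hn hψ]
  simp only [hEx, inner_add_left, inner_add_right, sum_inner, inner_sum, Finset.sum_add_distrib]
  have hcoe : ∀ (χ : TangentSpace (𝓡 n) x [⋀^Fin k]→L[ℝ] V x) (w : Fin k → TangentSpace (𝓡 n) x),
      χ.toMultilinearMap w = χ w := fun _ _ ↦ rfl
  simp only [hcoe]
  ring

end FormInner

/-! ### Continuity of alternating maps -/

section FiniteDimensional

variable {n k : ℕ} {T H : Type*} [NormedAddCommGroup T] [InnerProductSpace ℝ T]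
  [NormedAddCommGroup H] [InnerProductSpace ℝ H]

/-- On a finite-dimensional space, an alternating map is continuous. -/
def continuousAlternatingOf (b : OrthonormalBasis (Fin n) ℝ T) (f : T [⋀^Fin k]→ₗ[ℝ] H) :
    T [⋀^Fin k]→L[ℝ] H :=
  { f with
    cont := by
      have h : ∀ w : Fin k → T, f w = ∑ K : Fin k → Fin n,
          (∏ a, inner ℝ (b (K a)) (w a)) • f fun a ↦ b (K a) := by
        intro w
        have h1 : w = fun a ↦ ∑ i, inner ℝ (b i) (w a) • b i := by
          ext1 a
          exact (b.sum_repr' _).symm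
        conv_lhs => rw [h1]
        change f.toMultilinearMap _ = _
        rw [MultilinearMap.map_sum]
        simp only [MultilinearMap.map_smul_univ]
        rfl
      change Continuous fun w ↦ f w
      refine (continuous_congr h).2 (continuous_finsetSum _ fun K _ ↦ ?_)
      exact (continuous_finsetProd _ fun a _ ↦
        continuous_const.inner (continuous_apply a)).smul continuous_const }

@[simp] lemma continuousAlternatingOf_apply (b : OrthonormalBasis (Fin n) ℝ T)
    (f : T [⋀^Fin k]→ₗ[ℝ] H) (w : Fin k → T) : continuousAlternatingOf b f w = f w := rfl

end FiniteDimensional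

/-! ### The codifferential as a divergence -/

section Codifferential

variable {n : ℕ} {M : Type*} [TopologicalSpace M] [ChartedSpace (EuclideanSpace ℝ (Fin n)) M]
  [IsManifold (𝓡 n) ∞ M]
  {F : Type*} [NormedAddCommGroup F] [NormedSpace ℝ F]
  {V : M → Type*} [TopologicalSpace (TotalSpace F V)]
  [∀ x, NormedAddCommGroup (V x)] [∀ x, InnerProductSpace ℝ (V x)]
  [FiberBundle F V] [VectorBundle ℝ F V] [ContMDiffVectorBundle ∞ F V (𝓡 n)]
  [RiemannianBundle (fun x : M ↦ TangentSpace (𝓡 n) x)]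
  [IsContMDiffRiemannianBundle (𝓡 n) ∞ (EuclideanSpace ℝ (Fin n))
    (fun x : M ↦ TangentSpace (𝓡 n) x)] {k : ℕ}
  {cov : CovariantDerivative (𝓡 n) F V}

lemma IsSmooth.formSmoothAt {φ : Π x : M, TangentSpace (𝓡 n) x [⋀^Fin k]→L[ℝ] V x}
    (hφ : IsSmooth F φ) (x : M) : FormSmoothAt F φ x := hφ x

lemma FormSmoothAt.formDiffAt {φ : Π x : M, TangentSpace (𝓡 n) x [⋀^Fin k]→L[ℝ] V x} {x : M}
    (hφ : FormSmoothAt F φ x) : FormDiffAt F φ x := ContMDiffAt.mdifferentiableAt hφ (by simp)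

variable (cov) in
lemma secSmoothAt_nablaFields [T2Space M] [CovariantDerivative.ContMDiffCovariantDerivative cov ∞]
    {φ : Π x : M, TangentSpace (𝓡 n) x [⋀^Fin k]→L[ℝ] V x} (hφ : IsSmooth F φ)
    {W : Fin k → Π x : M, TangentSpace (𝓡 n) x} {X : Π x : M, TangentSpace (𝓡 n) x} {x : M}
    (hW : ∀ a, ∀ᶠ y in 𝓝 x, VFSmoothAt (W a) y) (hX : ∀ᶠ y in 𝓝 x, VFSmoothAt X y) :
    SecSmoothAt n F (fun y ↦ nablaFields cov φ W y (X y)) x := by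
  have h1 : ∀ᶠ y in 𝓝 x, SecSmoothAt n F (fun y ↦ φ y (fun a ↦ W a y)) y := by
    filter_upwards [Filter.eventually_all.2 hW] with y hy
    exact (hφ.formSmoothAt y).eval hy
  refine ContMDiffAt.sub_section (secSmoothAt_cov cov h1 hX.self_of_nhds)
    (ContMDiffAt.sum_section fun a _ ↦ ?_)
  have h2 := (hφ.formSmoothAt x).eval
    (W := Function.update W a fun y ↦ leviCivita (W a) y (X y)) (fun b ↦ by
      rcases eq_or_ne b a with rfl | h
      · simpa using vfSmoothAt_leviCivita hX (hW b)
      · simpa [h] using (hW b).self_of_nhds)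
  simpa only [update_field] using h2

lemma nabla_cons_linear {φ : Π x : M, TangentSpace (𝓡 n) x [⋀^Fin (k + 1)]→L[ℝ] V x} {x : M}
    (hφ : FormDiffAt F φ x) (w : Fin k → TangentSpace (𝓡 n) x) :
    ∃ B : TangentSpace (𝓡 n) x →ₗ[ℝ] TangentSpace (𝓡 n) x →ₗ[ℝ] V x,
      ∀ u v, B u v = nabla cov φ x u (Fin.cons v w) := by
  refine ⟨LinearMap.mk₂ ℝ (fun u v ↦ nabla cov φ x u (Fin.cons v w))
    (fun u u' v ↦ nabla_add_left cov u u' _) (fun r u v ↦ nabla_smul_left cov r u _)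
    (fun u v v' ↦ ?_) (fun r u v ↦ ?_), fun u v ↦ rfl⟩
  · exact (nablaAlternating cov hφ u).toMultilinearMap.cons_add w v v'
  · exact (nablaAlternating cov hφ u).toMultilinearMap.cons_smul w r v

/-- The form `-∑_i (∇_{e_i} φ)(e_i, …)`. It turns out to be `(d^∇)* φ`. -/
def codiffForm (cov : CovariantDerivative (𝓡 n) F V)
    {φ : Π x : M, TangentSpace (𝓡 n) x [⋀^Fin (k + 1)]→L[ℝ] V x} (hφ : IsSmooth F φ) (x : M) :
    TangentSpace (𝓡 n) x [⋀^Fin k]→L[ℝ] V x :=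
  continuousAlternatingOf (frame x) (-∑ i, (nablaAlternating cov
    (hφ.formSmoothAt x).formDiffAt (frame x i)).curryLeft (frame x i))

lemma codiffForm_apply {φ : Π x : M, TangentSpace (𝓡 n) x [⋀^Fin (k + 1)]→L[ℝ] V x}
    (hφ : IsSmooth F φ) (x : M) (w : Fin k → TangentSpace (𝓡 n) x) :
    codiffForm cov hφ x w = -∑ i, nabla cov φ x (frame x i) (Fin.cons (frame x i) w) := by
  let ev : (TangentSpace (𝓡 n) x [⋀^Fin k]→ₗ[ℝ] V x) →+ V x :=
    { toFun := fun f ↦ f w, map_zero' := rfl, map_add' := fun _ _ ↦ rfl }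
  change ev (-_) = _
  rw [map_neg, map_sum]
  rfl

lemma codiffForm_apply_basis {φ : Π x : M, TangentSpace (𝓡 n) x [⋀^Fin (k + 1)]→L[ℝ] V x}
    (hφ : IsSmooth F φ) (x : M) (b : OrthonormalBasis (Fin n) ℝ (TangentSpace (𝓡 n) x))
    (w : Fin k → TangentSpace (𝓡 n) x) :
    codiffForm cov hφ x w = -∑ i, nabla cov φ x (b i) (Fin.cons (b i) w) := by
  obtain ⟨B, hB⟩ := nabla_cons_linear (cov := cov) (hφ.formSmoothAt x).formDiffAt w
  rw [codiffForm_apply]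
  simp only [← hB]
  rw [sum_bilinear_eq (frame x) b B]

lemma cons_field (Z : Π x : M, TangentSpace (𝓡 n) x) (W : Fin k → Π x : M, TangentSpace (𝓡 n) x)
    (y : M) : (fun a ↦ (Fin.cons Z W : Fin (k + 1) → Π x : M, TangentSpace (𝓡 n) x) a y)
      = Fin.cons (Z y) fun a ↦ W a y := by
  ext1 a
  refine Fin.cases ?_ (fun a ↦ ?_) a <;> simp

/-- The trace defining `codiffForm` may be computed in a smooth local orthonormal frame. -/
lemma isSmooth_codiffForm [FiniteDimensional ℝ F] [T2Space M]
    [CovariantDerivative.ContMDiffCovariantDerivative cov ∞]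
    {φ : Π x : M, TangentSpace (𝓡 n) x [⋀^Fin (k + 1)]→L[ℝ] V x} (hφ : IsSmooth F φ) :
    IsSmooth F (codiffForm cov hφ) := by
  intro x
  refine formSmoothAt_of_eval fun W hW ↦ ?_
  obtain ⟨E, -, hE⟩ := exists_orthonormal_frame (n := n) x
  have h1 : SecSmoothAt n F (fun y ↦ -∑ i, nablaFields cov φ
      (Fin.cons (E i) W : Fin (k + 1) → Π x : M, TangentSpace (𝓡 n) x) y (E i y)) x := by
    refine ContMDiffAt.neg_section (ContMDiffAt.sum_section fun i _ ↦ ?_)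
    refine secSmoothAt_nablaFields cov hφ (fun a ↦ ?_) (hE.mono fun y hy ↦ hy.1 i)
    refine Fin.cases (hE.mono fun y hy ↦ hy.1 i) (fun a ↦ ?_) a
    exact hW a
  refine h1.congr_of_eventuallyEq ?_
  filter_upwards [hE, Filter.eventually_all.2 hW] with y hy hWy
  rw [codiffForm_apply_basis hφ y (orthonormalBasisOf _ hy.2)]
  simp only [coe_orthonormalBasisOf]
  congr 2
  refine Finset.sum_congr rfl fun i _ ↦ ?_
  rw [← nabla_eq_nablaFields cov (hφ.formSmoothAt y).formDiffAt, cons_field]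
  intro a
  refine Fin.cases (hy.1 i).secDiffAt (fun a ↦ ?_) a
  exact (hWy a).secDiffAt

/-- The contraction of a form with a vector field. -/
def contract (φ : Π x : M, TangentSpace (𝓡 n) x [⋀^Fin (k + 1)]→L[ℝ] V x)
    (Z : Π x : M, TangentSpace (𝓡 n) x) (x : M) : TangentSpace (𝓡 n) x [⋀^Fin k]→L[ℝ] V x :=
  (φ x).curryLeft (Z x)

lemma contract_apply (φ : Π x : M, TangentSpace (𝓡 n) x [⋀^Fin (k + 1)]→L[ℝ] V x)
    (Z : Π x : M, TangentSpace (𝓡 n) x) (x : M) (w : Fin k → TangentSpace (𝓡 n) x) :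
    contract φ Z x w = φ x (Fin.cons (Z x) w) := rfl

lemma formSmoothAt_contract [FiniteDimensional ℝ F]
    {φ : Π x : M, TangentSpace (𝓡 n) x [⋀^Fin (k + 1)]→L[ℝ] V x} {x : M}
    (hφ : FormSmoothAt F φ x) {Z : Π x : M, TangentSpace (𝓡 n) x} (hZ : VFSmoothAt Z x) :
    FormSmoothAt F (contract φ Z) x := by
  refine formSmoothAt_of_eval fun W hW ↦ ?_
  have h := hφ.eval (W := Fin.cons Z W) (fun a ↦ by
    refine Fin.cases hZ (fun a ↦ ?_) a
    exact (hW a).self_of_nhds)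
  simp only [cons_field] at h
  exact h

lemma nabla_contract {φ : Π x : M, TangentSpace (𝓡 n) x [⋀^Fin (k + 1)]→L[ℝ] V x} {x : M}
    (hφ : FormDiffAt F φ x) {Z : Π x : M, TangentSpace (𝓡 n) x} (hZ : VFDiffAt Z x)
    (v : TangentSpace (𝓡 n) x) (w : Fin k → TangentSpace (𝓡 n) x) :
    nabla cov (contract φ Z) x v w
      = nabla cov φ x v (Fin.cons (Z x) w) + φ x (Fin.cons (leviCivita Z x v) w) := by
  have h1 := nabla_eq_nablaFields cov hφ (W := Fin.cons Z fun a ↦ ext (w a)) (fun a ↦ by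
    refine Fin.cases hZ (fun a ↦ ?_) a
    exact mdifferentiableAt_ext _) v
  rw [cons_field] at h1
  simp only [ext_self] at h1
  rw [h1, nablaFields, Fin.sum_univ_succ]
  simp only [cons_field, Fin.cons_zero, Fin.cons_succ, ext_self, Fin.update_cons_zero, nabla,
    contract_apply, Fin.cons_update]
  abel

/-- The vector field `∑_i ⟨η, φ(e_i, …)⟩ e_i`, whose divergence is the difference of the integrands
`⟨d^∇ η, φ⟩` and `⟨η, (d^∇)* φ⟩`. -/
def adjointField (η : Π x : M, TangentSpace (𝓡 n) x [⋀^Fin k]→L[ℝ] V x)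
    (φ : Π x : M, TangentSpace (𝓡 n) x [⋀^Fin (k + 1)]→L[ℝ] V x) (x : M) :
    TangentSpace (𝓡 n) x :=
  ∑ i, formInner x (η x) ((φ x).curryLeft (frame x i)) • frame x i

variable {η : Π x : M, TangentSpace (𝓡 n) x [⋀^Fin k]→L[ℝ] V x}
  {φ : Π x : M, TangentSpace (𝓡 n) x [⋀^Fin (k + 1)]→L[ℝ] V x} {x : M}

lemma formInner_add_right (α β γ : (Fin k → TangentSpace (𝓡 n) x) → V x) :
    formInner x α (fun w ↦ β w + γ w) = formInner x α β + formInner x α γ := by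
  simp [formInner, inner_add_right, Finset.sum_add_distrib, mul_add]

lemma formInner_smul_right (r : ℝ) (α β : (Fin k → TangentSpace (𝓡 n) x) → V x) :
    formInner x α (fun w ↦ r • β w) = r * formInner x α β := by
  simp only [formInner, inner_smul_right, ← Finset.mul_sum]
  ring

lemma formInner_neg_sum_right (α : (Fin k → TangentSpace (𝓡 n) x) → V x)
    (β : Fin n → (Fin k → TangentSpace (𝓡 n) x) → V x) :
    formInner x α (fun w ↦ -∑ i, β i w) = -∑ i, formInner x α (β i) := by
  simp only [formInner, inner_neg_right, inner_sum, Finset.sum_neg_distrib, mul_neg,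
    ← Finset.mul_sum]
  rw [Finset.sum_comm]

lemma formInner_eq_arrayInner (α β : (Fin k → TangentSpace (𝓡 n) x) → V x) :
    formInner x α β = arrayInner (fun J ↦ α fun a ↦ frame x (J a))
      (fun J ↦ β fun a ↦ frame x (J a)) := rfl

lemma inner_adjointField (z : TangentSpace (𝓡 n) x) :
    inner ℝ z (adjointField η φ x) = formInner x (η x) ((φ x).curryLeft z) := by
  let L : TangentSpace (𝓡 n) x →ₗ[ℝ] ℝ :=
    { toFun := fun z ↦ formInner x (η x) ((φ x).curryLeft z)
      map_add' := fun u v ↦ by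
        rw [map_add]
        exact formInner_add_right _ _ _
      map_smul' := fun r u ↦ by
        rw [map_smul]
        exact formInner_smul_right _ _ _ }
  change _ = L z
  conv_rhs => rw [← (frame x).sum_repr' z]
  rw [adjointField, inner_sum, map_sum]
  refine Finset.sum_congr rfl fun i _ ↦ ?_
  rw [map_smul, inner_smul_right, real_inner_comm, smul_eq_mul, mul_comm]
  rfl

lemma isAltArray_form (α : TangentSpace (𝓡 n) x [⋀^Fin k]→ₗ[ℝ] V x)
    (e : Fin n → TangentSpace (𝓡 n) x) :
    IsAltArray (fun J ↦ α fun a ↦ e (J a)) := by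
  intro σ J
  exact (α.map_perm (fun a ↦ e (J a)) σ).trans (by simp)

/-- Contraction is adjoint to the wedge product, so `⟨d^∇ η, α⟩ = ∑_i ⟨∇_{e_i} η, α(e_i, …)⟩`. -/
lemma formInner_covExtDeriv {η : Π x : M, TangentSpace (𝓡 n) x [⋀^Fin k]→L[ℝ] V x}
    (α : TangentSpace (𝓡 n) x [⋀^Fin (k + 1)]→L[ℝ] V x) :
    formInner x (covExtDeriv cov η x) α
      = ∑ i, formInner x (nabla cov η x (frame x i)) (α.curryLeft (frame x i)) := by
  rw [formInner_eq_arrayInner]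
  have h1 : (fun J : Fin (k + 1) → Fin n ↦ covExtDeriv cov η x fun a ↦ frame x (J a))
      = wedgeArray (fun i J ↦ nabla cov η x (frame x i) fun a ↦ frame x (J a)) := by
    ext1 J
    rw [covExtDeriv_eq_sum_nabla]
    rfl
  rw [h1]
  refine (arrayInner_wedge _ (isAltArray_form α.toAlternatingMap (frame x))).trans ?_
  refine Finset.sum_congr rfl fun i _ ↦ ?_
  rw [formInner_eq_arrayInner]
  congr 1
  ext1 J
  change α _ = α _
  congr 1
  ext1 a
  refine Fin.cases ?_ (fun a ↦ ?_) a <;> simp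

variable [IsContMDiffRiemannianBundle (𝓡 n) ∞ F V] [FiniteDimensional ℝ F]

lemma vfSmoothAt_adjointField (hη : FormSmoothAt F η x) (hφ : FormSmoothAt F φ x) :
    VFSmoothAt (adjointField η φ) x := by
  refine vfSmoothAt_of_inner fun Z hZ ↦ ?_
  simp only [inner_adjointField]
  exact contMDiffAt_formInner hη (formSmoothAt_contract hφ hZ.self_of_nhds)

/-- The divergence of a vector field, the trace of its covariant derivative. -/
def divergence (X : Π x : M, TangentSpace (𝓡 n) x) (x : M) : ℝ :=
  ∑ i, inner ℝ (leviCivita X x (frame x i)) (frame x i)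

lemma divergence_adjointField (hcov : cov.IsMetricCompatible) (hη : IsSmooth F η)
    (hφ : IsSmooth F φ) (x : M) :
    divergence (adjointField η φ) x
      = formInner x (covExtDeriv cov η x) (φ x) - formInner x (η x) (codiffForm cov hφ x) := by
  obtain ⟨E, hEx, hE⟩ := exists_orthonormal_frame (n := n) x
  have hEs := hE.self_of_nhds.1
  have hX := vfSmoothAt_adjointField (hη.formSmoothAt x) (hφ.formSmoothAt x)
  have h1 : ∀ i, inner ℝ (leviCivita (adjointField η φ) x (frame x i)) (frame x i)
      = formInner x (nabla cov η x (frame x i)) ((φ x).curryLeft (frame x i))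
        + formInner x (η x) (fun w ↦ nabla cov φ x (frame x i) (Fin.cons (frame x i) w)) := by
    intro i
    have h2 := mvfderiv_inner_leviCivita (hEs i).secDiffAt hX.secDiffAt (frame x i)
    have h3 := mvfderiv_formInner hcov (hη.formSmoothAt x).formDiffAt
      (formSmoothAt_contract (hφ.formSmoothAt x) (hEs i)).formDiffAt (frame x i)
    have h4 : nabla cov (contract φ (E i)) x (frame x i)
        = fun w ↦ nabla cov φ x (frame x i) (Fin.cons (frame x i) w)
          + (φ x).curryLeft (leviCivita (E i) x (frame x i)) w := by
      ext1 w
      rw [nabla_contract (hφ.formSmoothAt x).formDiffAt (hEs i).secDiffAt, hEx]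
      rfl
    simp only [inner_adjointField] at h2
    rw [hEx, real_inner_comm] at h2
    rw [h4, formInner_add_right] at h3
    have h5 : contract φ (E i) x = (φ x).curryLeft (frame x i) := by rw [contract, hEx]
    rw [h5] at h3
    have h6 := h2.symm.trans h3
    linarith
  rw [divergence]
  simp only [h1, Finset.sum_add_distrib]
  rw [formInner_covExtDeriv, sub_eq_add_neg]
  congr 1
  have h7 : (codiffForm cov hφ x : (Fin k → TangentSpace (𝓡 n) x) → V x)
      = fun w ↦ -∑ i, nabla cov φ x (frame x i) (Fin.cons (frame x i) w) :=
    funext fun w ↦ codiffForm_apply hφ x w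
  rw [h7, formInner_neg_sum_right, neg_neg]

end Codifferential

/-! ### The derivative of the volume density -/

section Jacobi

/-- Jacobi's formula for the derivative of a determinant. -/
lemma hasDerivAt_det {n : ℕ} {G : ℝ → Matrix (Fin n) (Fin n) ℝ} {G' : Matrix (Fin n) (Fin n) ℝ}
    {t : ℝ} (h : ∀ j k, HasDerivAt (fun s ↦ G s j k) (G' j k) t) :
    HasDerivAt (fun s ↦ (G s).det) ((G t).adjugate * G').trace t := by
  have h1 : HasDerivAt (fun s ↦ (G s).det) (∑ σ : Equiv.Perm (Fin n), (Equiv.Perm.sign σ : ℝ) *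
      ∑ i, (∏ j ∈ Finset.univ.erase i, G t (σ j) j) • G' (σ i) i) t := by
    simp only [Matrix.det_apply']
    refine HasDerivAt.fun_sum fun σ _ ↦ HasDerivAt.const_mul _ ?_
    exact HasDerivAt.fun_finsetProd fun i _ ↦ h (σ i) i
  convert h1 using 1
  have h2 : ∀ i, ((G t).adjugate * G') i i = ((G t).updateCol i (fun j ↦ G' j i)).det := by
    intro i
    rw [← Matrix.cramer_apply, Matrix.cramer_eq_adjugate_mulVec]
    rfl
  simp only [Matrix.trace, Matrix.diag_apply, h2, Matrix.det_apply', Finset.mul_sum]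
  rw [Finset.sum_comm]
  refine Finset.sum_congr rfl fun σ _ ↦ Finset.sum_congr rfl fun i _ ↦ ?_
  rw [← Finset.mul_prod_erase _ _ (Finset.mem_univ i), Matrix.updateCol_self, smul_eq_mul,
    mul_comm (G' (σ i) i)]
  congr 2
  refine Finset.prod_congr rfl fun j hj ↦ ?_
  rw [Matrix.updateCol_ne (Finset.mem_erase.1 hj).1]

/-- If `G' = Aᵀ G + G A` then `(√det G)' = tr A √det G`. -/
lemma hasDerivAt_sqrt_det {n : ℕ} {G : ℝ → Matrix (Fin n) (Fin n) ℝ} {A : Matrix (Fin n) (Fin n) ℝ}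
    {t : ℝ} (h : ∀ j k, HasDerivAt (fun s ↦ G s j k) ((A.transpose * G t + G t * A) j k) t)
    (hG : 0 < (G t).det) :
    HasDerivAt (fun s ↦ √(G s).det) (A.trace * √(G t).det) t := by
  have h1 := (hasDerivAt_det h).sqrt hG.ne'
  convert h1 using 1
  have h2 : ((G t).adjugate * (A.transpose * G t + G t * A)).trace = 2 * (G t).det * A.trace := by
    rw [mul_add, Matrix.trace_add, ← mul_assoc, ← mul_assoc, Matrix.trace_mul_comm,
      ← mul_assoc, Matrix.mul_adjugate, Matrix.adjugate_mul]
    simp [Matrix.trace_smul]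
    ring
  rw [h2, eq_div_iff (by positivity)]
  linear_combination 2 * A.trace * Real.mul_self_sqrt hG.le

end Jacobi

/-! ### Coordinate vector fields -/

section Chart

variable {n : ℕ} {M : Type*} [TopologicalSpace M] [ChartedSpace (EuclideanSpace ℝ (Fin n)) M]
  [IsManifold (𝓡 n) ∞ M]

/-- The constant `i`-th basis vector field of the model space. -/
def stdField (i : Fin n) (z : EuclideanSpace ℝ (Fin n)) :
    TangentSpace 𝓘(ℝ, EuclideanSpace ℝ (Fin n)) z :=
  (EuclideanSpace.single i (1 : ℝ) : EuclideanSpace ℝ (Fin n))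

lemma contMDiffAt_stdField (i : Fin n) (z : EuclideanSpace ℝ (Fin n)) :
    ContMDiffAt 𝓘(ℝ, EuclideanSpace ℝ (Fin n)) 𝓘(ℝ, EuclideanSpace ℝ (Fin n)).tangent ∞
      (fun z ↦ (⟨z, stdField i z⟩ : TangentBundle 𝓘(ℝ, EuclideanSpace ℝ (Fin n))
        (EuclideanSpace ℝ (Fin n)))) z :=
  contMDiffAt_vectorSpace_iff_contDiffAt.2 contDiffAt_const

lemma mlieBracket_stdField (i j : Fin n) (z : EuclideanSpace ℝ (Fin n)) :
    VectorField.mlieBracket 𝓘(ℝ, EuclideanSpace ℝ (Fin n)) (stdField i) (stdField j) z = 0 := by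
  rw [← VectorField.mlieBracketWithin_univ, VectorField.mlieBracketWithin_eq_lieBracketWithin]
  have h (w v : EuclideanSpace ℝ (Fin n)) :
      fderivWithin ℝ (fun _ : EuclideanSpace ℝ (Fin n) ↦ w) Set.univ z v = 0 := by simp
  exact (congrArg₂ (· - ·) (h _ _) (h _ _)).trans (sub_self (0 : EuclideanSpace ℝ (Fin n)))

/-- The coordinate vector field `∂_i` of the chart at `p`, as a vector field on `M` (meaningful on
the domain of the chart). -/
def coordField (p : M) (i : Fin n) : Π y : M, TangentSpace (𝓡 n) y :=
  VectorField.mpullback (𝓡 n) 𝓘(ℝ, EuclideanSpace ℝ (Fin n)) (extChartAt (𝓡 n) p) (stdField i)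

lemma contMDiffAt_extChartAt_of_mem {p y : M} (hy : y ∈ (extChartAt (𝓡 n) p).source) :
    ContMDiffAt (𝓡 n) 𝓘(ℝ, EuclideanSpace ℝ (Fin n)) ∞ (extChartAt (𝓡 n) p) y :=
  contMDiffAt_extChartAt' (by rwa [extChartAt_source] at hy)

lemma coordField_symm {p : M} {u : EuclideanSpace ℝ (Fin n)}
    (hu : u ∈ (extChartAt (𝓡 n) p).target) (i : Fin n) :
    coordField p i ((extChartAt (𝓡 n) p).symm u) = coordVec p i u := by
  have h1 := isInvertible_mfderiv_extChartAt (I := 𝓡 n) (x := p)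
    ((extChartAt (𝓡 n) p).map_target hu)
  have h2 := mfderiv_extChartAt_comp_mfderivWithin_extChartAt_symm (I := 𝓡 n) hu
  change (mfderiv (𝓡 n) 𝓘(ℝ, EuclideanSpace ℝ (Fin n)) (extChartAt (𝓡 n) p)
    ((extChartAt (𝓡 n) p).symm u)).inverse (stdField i _) = _
  rw [h1.inverse_apply_eq, coordVec]
  simp only [modelWithCornersSelf_coe, Set.range_id, mfderivWithin_univ] at h2
  exact (congrArg (fun L ↦ L (stdField i u)) h2).symm

lemma vfSmoothAt_coordField {p y : M} (hy : y ∈ (extChartAt (𝓡 n) p).source) (i : Fin n) :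
    VFSmoothAt (coordField p i) y :=
  ContMDiffAt.mpullback_vectorField_preimage (n := ∞) (contMDiffAt_stdField i _)
    (contMDiffAt_extChartAt_of_mem hy) (isInvertible_mfderiv_extChartAt hy) (by simp)

lemma mlieBracket_coordField {p y : M} (hy : y ∈ (extChartAt (𝓡 n) p).source) (i j : Fin n) :
    VectorField.mlieBracket (𝓡 n) (coordField p i) (coordField p j) y = 0 := by
  have : IsManifold (𝓡 n) (minSmoothness ℝ 3) M := by
    rw [minSmoothness_of_isRCLikeNormedField]
    exact IsManifold.of_le (n := ∞) (by norm_cast)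
  have h := VectorField.mpullback_mlieBracket (n := ∞)
    ((contMDiffAt_stdField i _).mdifferentiableAt (by simp))
    ((contMDiffAt_stdField j _).mdifferentiableAt (by simp))
    (contMDiffAt_extChartAt_of_mem hy) (by simp; norm_cast)
  refine h.symm.trans ?_
  change (mfderiv (𝓡 n) 𝓘(ℝ, EuclideanSpace ℝ (Fin n)) (extChartAt (𝓡 n) p) y).inverse
    (VectorField.mlieBracket 𝓘(ℝ, EuclideanSpace ℝ (Fin n)) (stdField i) (stdField j) _) = 0
  rw [mlieBracket_stdField, map_zero]

/-- The `i`-th coordinate function of the chart at `p`. -/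
def coordFun (p : M) (i : Fin n) (y : M) : ℝ := extChartAt (𝓡 n) p y i

lemma contMDiffAt_coordFun {p y : M} (hy : y ∈ (extChartAt (𝓡 n) p).source) (i : Fin n) :
    ContMDiffAt (𝓡 n) 𝓘(ℝ, ℝ) ∞ (coordFun p i) y :=
  ((EuclideanSpace.proj i : EuclideanSpace ℝ (Fin n) →L[ℝ] ℝ).contMDiff.contMDiffAt).comp y
    (contMDiffAt_extChartAt_of_mem hy)

lemma mvfderiv_coordFun {p y : M} (hy : y ∈ (extChartAt (𝓡 n) p).source) (i : Fin n)
    (v : TangentSpace (𝓡 n) y) :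
    mvfderiv (𝓡 n) (coordFun p i) y v
      = (EuclideanSpace.proj i : EuclideanSpace ℝ (Fin n) →L[ℝ] ℝ)
        (mfderiv (𝓡 n) 𝓘(ℝ, EuclideanSpace ℝ (Fin n)) (extChartAt (𝓡 n) p) y v) := by
  have h1 : MDifferentiableAt (𝓡 n) 𝓘(ℝ, EuclideanSpace ℝ (Fin n)) (extChartAt (𝓡 n) p) y :=
    (contMDiffAt_extChartAt_of_mem hy).mdifferentiableAt (by simp)
  have h2 := ((EuclideanSpace.proj i : EuclideanSpace ℝ (Fin n) →L[ℝ] ℝ).hasMFDerivAt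
    (x := extChartAt (𝓡 n) p y)).comp y h1.hasMFDerivAt
  exact congrArg (fun L ↦ L v) h2.mfderiv

/-- Expansion of a tangent vector in the coordinate vector fields. -/
lemma sum_mvfderiv_coordFun_smul {p y : M} (hy : y ∈ (extChartAt (𝓡 n) p).source)
    (v : TangentSpace (𝓡 n) y) :
    ∑ i, mvfderiv (𝓡 n) (coordFun p i) y v • coordField p i y = v := by
  have h1 := isInvertible_mfderiv_extChartAt (I := 𝓡 n) (x := p) hy
  set L := mfderiv (𝓡 n) 𝓘(ℝ, EuclideanSpace ℝ (Fin n)) (extChartAt (𝓡 n) p) y with hL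
  have h2 : ∀ w : EuclideanSpace ℝ (Fin n),
      ∑ i, (EuclideanSpace.proj i : EuclideanSpace ℝ (Fin n) →L[ℝ] ℝ) w •
      (EuclideanSpace.single i (1 : ℝ) : EuclideanSpace ℝ (Fin n)) = w := by
    intro w
    simpa using (EuclideanSpace.basisFun (Fin n) ℝ).sum_repr w
  have h3 : L.inverse (L v) = v := by
    rw [h1.inverse_apply_eq]
  have h4 : ∀ (T : EuclideanSpace ℝ (Fin n) →L[ℝ] TangentSpace (𝓡 n) y)
      (w : EuclideanSpace ℝ (Fin n)),
      ∑ i, (EuclideanSpace.proj i : EuclideanSpace ℝ (Fin n) →L[ℝ] ℝ) w •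
        T (EuclideanSpace.single i (1 : ℝ) : EuclideanSpace ℝ (Fin n)) = T w := by
    intro T w
    conv_rhs => rw [← h2 w, map_sum]
    simp only [map_smul]
  refine (Finset.sum_congr rfl fun i _ ↦ ?_).trans ((h4 L.inverse (L v)).trans h3)
  exact congrArg (· • coordField p i y) (mvfderiv_coordFun hy i v)

/-- The derivative of a function on `M` along the coordinate line `t ↦ u + t e_i`. -/
lemma hasDerivAt_coord_line {p : M} {u : EuclideanSpace ℝ (Fin n)}
    (hu : u ∈ (extChartAt (𝓡 n) p).target) (i : Fin n) {f : M → ℝ}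
    (hf : MDifferentiableAt (𝓡 n) 𝓘(ℝ, ℝ) f ((extChartAt (𝓡 n) p).symm u)) :
    HasDerivAt (fun t : ℝ ↦ f ((extChartAt (𝓡 n) p).symm
        (u + t • (EuclideanSpace.single i (1 : ℝ) : EuclideanSpace ℝ (Fin n)))))
      (mvfderiv (𝓡 n) f ((extChartAt (𝓡 n) p).symm u) (coordVec p i u)) 0 := by
  have h1 : MDifferentiableAt (𝓡 n) (𝓡 n) (extChartAt (𝓡 n) p).symm u :=
    ((contMDiffOn_extChartAt_symm (n := ∞) p).contMDiffAt
      ((isOpen_extChartAt_target p).mem_nhds hu)).mdifferentiableAt (by simp)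
  have h2 : HasFDerivAt (fun z ↦ f ((extChartAt (𝓡 n) p).symm z)) _ u :=
    (hf.hasMFDerivAt.comp u h1.hasMFDerivAt).hasFDerivAt
  have h3 : HasDerivAt (fun t : ℝ ↦ u + t • (EuclideanSpace.single i (1 : ℝ) :
      EuclideanSpace ℝ (Fin n))) (EuclideanSpace.single i (1 : ℝ)) 0 := by
    simpa using ((hasDerivAt_id (0 : ℝ)).smul_const
      (EuclideanSpace.single i (1 : ℝ) : EuclideanSpace ℝ (Fin n))).const_add u
  exact h2.comp_hasDerivAt_of_eq (0 : ℝ) h3 (by simp)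

end Chart

/-! ### The divergence in coordinates -/

lemma gram_det_pos {n : ℕ} {T : Type*} [NormedAddCommGroup T] [InnerProductSpace ℝ T]
    (v : Fin n → T) (hv : LinearIndependent ℝ v) :
    0 < (Matrix.of fun j k ↦ inner ℝ (v j) (v k)).det :=
  (Matrix.posDef_gram_of_linearIndependent hv).det_pos

section DivergenceTheorem

variable {n : ℕ} {M : Type*} [TopologicalSpace M] [ChartedSpace (EuclideanSpace ℝ (Fin n)) M]
  [IsManifold (𝓡 n) ∞ M] [RiemannianBundle (fun x : M ↦ TangentSpace (𝓡 n) x)]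
  [IsContMDiffRiemannianBundle (𝓡 n) ∞ (EuclideanSpace ℝ (Fin n))
    (fun x : M ↦ TangentSpace (𝓡 n) x)]
  {p x : M} {X : Π x : M, TangentSpace (𝓡 n) x}

lemma leviCivita_zero (v : TangentSpace (𝓡 n) x) :
    leviCivita (0 : Π x : M, TangentSpace (𝓡 n) x) x v = 0 := by
  have h0 : VFDiffAt (0 : Π x : M, TangentSpace (𝓡 n) x) x :=
    (mdifferentiable_zeroSection ℝ (fun x : M ↦ TangentSpace (𝓡 n) x)) x
  have h := leviCivita_add h0 h0 v
  rwa [add_zero, left_eq_add] at h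

lemma leviCivita_sum {ι : Type*} (s : Finset ι) {Y : ι → Π x : M, TangentSpace (𝓡 n) x}
    (hY : ∀ i, VFSmoothAt (Y i) x) (v : TangentSpace (𝓡 n) x) :
    leviCivita (fun y ↦ ∑ i ∈ s, Y i y) x v = ∑ i ∈ s, leviCivita (Y i) x v := by
  classical
  induction s using Finset.induction_on with
  | empty => exact leviCivita_zero v
  | insert i s hi ih =>
    have h1 : VFSmoothAt (fun y ↦ ∑ i ∈ s, Y i y) x := ContMDiffAt.sum_section fun i _ ↦ hY i
    have h2 := leviCivita_add (hY i).secDiffAt h1.secDiffAt v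
    rw [Finset.sum_insert hi, ← ih, ← h2]
    simp only [Finset.sum_insert hi]
    rfl

lemma mvfderiv_coordFun_coordField (hx : x ∈ (extChartAt (𝓡 n) p).source) (i j : Fin n) :
    mvfderiv (𝓡 n) (coordFun p i) x (coordField p j x) = if i = j then 1 else 0 := by
  rw [mvfderiv_coordFun hx]
  have h1 := isInvertible_mfderiv_extChartAt (I := 𝓡 n) (x := p) hx
  have h2 : mfderiv (𝓡 n) 𝓘(ℝ, EuclideanSpace ℝ (Fin n)) (extChartAt (𝓡 n) p) x
      (coordField p j x) = stdField j _ := h1.self_apply_inverse _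
  rw [h2]
  exact PiLp.single_apply 2 ℝ j (1 : ℝ) i

lemma linearIndependent_coordField (hx : x ∈ (extChartAt (𝓡 n) p).source) :
    LinearIndependent ℝ (fun i : Fin n ↦ coordField p i x) := by
  rw [Fintype.linearIndependent_iff]
  intro a ha i
  have h := congrArg (mvfderiv (𝓡 n) (coordFun p i) x) ha
  rw [map_sum, map_zero] at h
  simpa [mvfderiv_coordFun_coordField hx] using h

/-- The matrix `A` with `∇_{∂_j} ∂_i = ∑ l, A l j • ∂_l`, for a fixed `i`: its entries are the
Christoffel symbols. -/
def christoffel (p : M) (x : M) (i : Fin n) : Matrix (Fin n) (Fin n) ℝ :=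
  .of fun l j ↦ mvfderiv (𝓡 n) (coordFun p l) x (leviCivita (coordField p i) x (coordField p j x))

lemma sum_christoffel_smul (hx : x ∈ (extChartAt (𝓡 n) p).source) (i j : Fin n) :
    ∑ l, christoffel p x i l j • coordField p l x
      = leviCivita (coordField p i) x (coordField p j x) :=
  sum_mvfderiv_coordFun_smul hx _

/-- The matrix `g_jk` of the metric in the chart at `p`. -/
def gramMatrix (p : M) (x : M) : Matrix (Fin n) (Fin n) ℝ :=
  .of fun j k ↦ inner ℝ (coordField p j x) (coordField p k x)

/-- `∂_i g = Aᵀ g + g A` for the matrix `A` of Christoffel symbols, as `∇` is metric and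
`∇_{∂_i} ∂_j = ∇_{∂_j} ∂_i`. -/
lemma mvfderiv_gramMatrix (hx : x ∈ (extChartAt (𝓡 n) p).source) (i j k : Fin n) :
    mvfderiv (𝓡 n) (fun y ↦ gramMatrix p y j k) x (coordField p i x)
      = ((christoffel p x i).transpose * gramMatrix (n := n) p x
        + gramMatrix (n := n) p x * christoffel p x i) j k := by
  have hC := fun j ↦ (vfSmoothAt_coordField (p := p) hx j).secDiffAt
  have hs : ∀ j, leviCivita (coordField p j) x (coordField p i x)
      = leviCivita (coordField p i) x (coordField p j x) := by
    intro j
    have h := leviCivita_sub_swap (hC i) (hC j)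
    rwa [mlieBracket_coordField hx, sub_eq_zero] at h
  have h := mvfderiv_inner_leviCivita (hC j) (hC k) (coordField p i x)
  refine h.trans ?_
  rw [hs, hs, ← sum_christoffel_smul hx, ← sum_christoffel_smul hx, sum_inner, inner_sum]
  simp only [Matrix.add_apply, Matrix.mul_apply, Matrix.transpose_apply, real_inner_smul_left,
    real_inner_smul_right]
  congr 1
  exact Finset.sum_congr rfl fun l _ ↦ mul_comm _ _

lemma gramMatrix_det_pos (hx : x ∈ (extChartAt (𝓡 n) p).source) :
    0 < (gramMatrix (n := n) p x).det :=
  gram_det_pos _ (linearIndependent_coordField hx)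

lemma volDensity_eq {u : EuclideanSpace ℝ (Fin n)} (hu : u ∈ (extChartAt (𝓡 n) p).target) :
    volDensity p u = √(gramMatrix (n := n) p ((extChartAt (𝓡 n) p).symm u)).det := by
  simp only [volDensity, gramMatrix, coordField_symm hu]

lemma volDensity_pos {u : EuclideanSpace ℝ (Fin n)} (hu : u ∈ (extChartAt (𝓡 n) p).target) :
    0 < volDensity p u := by
  rw [volDensity_eq hu]
  exact Real.sqrt_pos.2 (gramMatrix_det_pos ((extChartAt (𝓡 n) p).map_target hu))

lemma contMDiffAt_gramMatrix (hx : x ∈ (extChartAt (𝓡 n) p).source) (j k : Fin n) :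
    ContMDiffAt (𝓡 n) 𝓘(ℝ, ℝ) ∞ (fun y ↦ gramMatrix p y j k) x :=
  ContMDiffAt.inner_bundle (vfSmoothAt_coordField hx j) (vfSmoothAt_coordField hx k)

lemma contDiffAt_comp_symm {u : EuclideanSpace ℝ (Fin n)} (hu : u ∈ (extChartAt (𝓡 n) p).target)
    {f : M → ℝ} (hf : ContMDiffAt (𝓡 n) 𝓘(ℝ, ℝ) ∞ f ((extChartAt (𝓡 n) p).symm u)) :
    ContDiffAt ℝ ∞ (fun z ↦ f ((extChartAt (𝓡 n) p).symm z)) u :=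
  (ContMDiffAt.comp u hf ((contMDiffOn_extChartAt_symm (n := ∞) p).contMDiffAt
      ((isOpen_extChartAt_target p).mem_nhds hu))).contDiffAt

lemma contDiffAt_volDensity {u : EuclideanSpace ℝ (Fin n)}
    (hu : u ∈ (extChartAt (𝓡 n) p).target) : ContDiffAt ℝ ∞ (volDensity p) u := by
  have hx := (extChartAt (𝓡 n) p).map_target hu
  have h1 : ContDiffAt ℝ ∞
      (fun z ↦ (gramMatrix (n := n) p ((extChartAt (𝓡 n) p).symm z)).det) u := by
    simp only [Matrix.det_apply']
    exact ContDiffAt.sum fun σ _ ↦ contDiffAt_const.mul (contDiffAt_prod fun i _ ↦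
      contDiffAt_comp_symm hu (contMDiffAt_gramMatrix hx (σ i) i))
  refine (h1.sqrt (gramMatrix_det_pos hx).ne').congr_of_eventuallyEq ?_
  filter_upwards [(isOpen_extChartAt_target p).mem_nhds hu] with z hz using volDensity_eq hz

lemma eventually_line_mem {u : EuclideanSpace ℝ (Fin n)} (hu : u ∈ (extChartAt (𝓡 n) p).target)
    (e : EuclideanSpace ℝ (Fin n)) :
    ∀ᶠ t : ℝ in 𝓝 0, u + t • e ∈ (extChartAt (𝓡 n) p).target := by
  have h : Filter.Tendsto (fun t : ℝ ↦ u + t • e) (𝓝 0) (𝓝 u) := by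
    have : ContinuousAt (fun t : ℝ ↦ u + t • e) 0 := by fun_prop
    simpa [ContinuousAt] using this
  exact h ((isOpen_extChartAt_target p).mem_nhds hu)

/-- `∂_i √(det g) = (tr ∇∂_i) √(det g)`. -/
lemma hasDerivAt_volDensity_line {u : EuclideanSpace ℝ (Fin n)}
    (hu : u ∈ (extChartAt (𝓡 n) p).target) (i : Fin n) :
    HasDerivAt (fun t : ℝ ↦ volDensity p
        (u + t • (EuclideanSpace.single i (1 : ℝ) : EuclideanSpace ℝ (Fin n))))
      ((christoffel p ((extChartAt (𝓡 n) p).symm u) i).trace * volDensity p u) 0 := by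
  have hx := (extChartAt (𝓡 n) p).map_target hu
  have h := hasDerivAt_sqrt_det (t := 0) (A := christoffel p ((extChartAt (𝓡 n) p).symm u) i)
    (G := fun t ↦ gramMatrix p ((extChartAt (𝓡 n) p).symm (u + t •
      (EuclideanSpace.single i (1 : ℝ) : EuclideanSpace ℝ (Fin n))))) ?_ ?_
  · rw [zero_smul, add_zero, ← volDensity_eq hu] at h
    refine h.congr_of_eventuallyEq ?_
    filter_upwards [eventually_line_mem hu (EuclideanSpace.single i 1)] with t ht
      using volDensity_eq ht
  · intro j k
    have h1 := hasDerivAt_coord_line hu i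
      ((contMDiffAt_gramMatrix hx j k).mdifferentiableAt (by simp))
    rw [← coordField_symm hu, mvfderiv_gramMatrix hx] at h1
    rw [zero_smul, add_zero]
    exact h1
  · rw [zero_smul, add_zero]
    exact gramMatrix_det_pos hx

/-- The components of a vector field in the chart at `p`. -/
def coordComp (p : M) (X : Π x : M, TangentSpace (𝓡 n) x) (i : Fin n) (y : M) : ℝ :=
  mvfderiv (𝓡 n) (coordFun p i) y (X y)

lemma contMDiffAt_coordComp (hx : x ∈ (extChartAt (𝓡 n) p).source) (hX : VFSmoothAt X x)
    (i : Fin n) : ContMDiffAt (𝓡 n) 𝓘(ℝ, ℝ) ∞ (coordComp p X i) x :=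
  contMDiffAt_mvfderiv_apply (contMDiffAt_coordFun hx i) hX

/-- The trace of the covariant derivative, computed in the basis of coordinate vectors instead of an
orthonormal basis. -/
lemma divergence_eq_trace (hx : x ∈ (extChartAt (𝓡 n) p).source) (hX : VFSmoothAt X x) :
    divergence X x
      = ∑ l, mvfderiv (𝓡 n) (coordFun p l) x (leviCivita X x (coordField p l x)) := by
  let T : TangentSpace (𝓡 n) x →ₗ[ℝ] TangentSpace (𝓡 n) x :=
    { toFun := leviCivita X x
      map_add' := leviCivita_add_vec hX.secDiffAt
      map_smul' := leviCivita_smul_vec hX.secDiffAt }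
  have h1 : ∀ v, leviCivita X x v
      = ∑ l, mvfderiv (𝓡 n) (coordFun p l) x v • leviCivita X x (coordField p l x) := by
    intro v
    change T v = ∑ l, _ • T _
    simp only [← map_smul, ← map_sum, sum_mvfderiv_coordFun_smul hx]
  have h2 : ∀ w : TangentSpace (𝓡 n) x, ∑ i, inner ℝ w (frame x i) • frame x i = w := by
    intro w
    simpa only [real_inner_comm] using (frame x).sum_repr' w
  rw [divergence]
  calc ∑ i, inner ℝ (leviCivita X x (frame x i)) (frame x i)
      = ∑ i, ∑ l, mvfderiv (𝓡 n) (coordFun p l) x (frame x i)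
          * inner ℝ (leviCivita X x (coordField p l x)) (frame x i) := by
        refine Finset.sum_congr rfl fun i _ ↦ ?_
        rw [h1 (frame x i), sum_inner]
        simp only [real_inner_smul_left]
    _ = _ := by
        rw [Finset.sum_comm]
        refine Finset.sum_congr rfl fun l _ ↦ ?_
        conv_rhs => rw [← h2 (leviCivita X x (coordField p l x)), map_sum]
        refine Finset.sum_congr rfl fun i _ ↦ ?_
        rw [map_smul, smul_eq_mul, mul_comm]

/-- `div X = ∑_i (∂_i X^i + X^i tr ∇∂_i)`. -/
lemma divergence_eq_coord (hx : x ∈ (extChartAt (𝓡 n) p).source)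
    (hX : VFSmoothAt X x) :
    divergence X x = ∑ i, (mvfderiv (𝓡 n) (coordComp p X i) x (coordField p i x)
      + coordComp p X i x * (christoffel p x i).trace) := by
  have hC := fun i ↦ vfSmoothAt_coordField (p := p) hx i
  have hXi := fun i ↦ contMDiffAt_coordComp hx hX i
  have h1 : X =ᶠ[𝓝 x] fun y ↦ ∑ i, (coordComp p X i • coordField p i) y := by
    filter_upwards [(isOpen_extChartAt_source (I := 𝓡 n) p).mem_nhds hx] with y hy
    exact (sum_mvfderiv_coordFun_smul hy (X y)).symm
  have h2 : ∀ v, leviCivita X x v = ∑ i, (coordComp p X i x • leviCivita (coordField p i) x v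
      + mvfderiv (𝓡 n) (coordComp p X i) x v • coordField p i x) := by
    intro v
    rw [leviCivita_congr h1]
    refine (leviCivita_sum (Y := fun i ↦ coordComp p X i • coordField p i) Finset.univ
      (fun i ↦ (hXi i).smul_section (hC i)) v).trans ?_
    exact Finset.sum_congr rfl fun i _ ↦ leviCivita_smul ((hXi i).mdifferentiableAt (by simp))
      (hC i).secDiffAt v
  rw [divergence_eq_trace hx hX]
  simp only [h2, map_sum, map_add, map_smul, mvfderiv_coordFun_coordField hx]
  rw [Finset.sum_comm]
  refine Finset.sum_congr rfl fun i _ ↦ ?_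
  rw [Finset.sum_add_distrib, add_comm]
  congr 1
  · simp
  · rw [Matrix.trace, Finset.mul_sum]
    rfl

end DivergenceTheorem

/-! ### The divergence theorem in a chart -/

/-- The integral over a vector space of a directional derivative of a compactly supported
function vanishes. -/
lemma integral_fderiv_apply_eq_zero {E : Type*} [NormedAddCommGroup E] [NormedSpace ℝ E]
    [FiniteDimensional ℝ E] [MeasurableSpace E] [BorelSpace E] (μ : Measure E) [μ.IsAddHaarMeasure]
    {h : E → ℝ} (hh : ContDiff ℝ 1 h) (hc : HasCompactSupport h) (v : E) :
    Integrable (fun u ↦ fderiv ℝ h u v) μ ∧ ∫ u, fderiv ℝ h u v ∂μ = 0 := by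
  have h1 : Integrable (fun u ↦ fderiv ℝ h u v) μ :=
    ((hh.continuous_fderiv (by simp)).clm_apply continuous_const).integrable_of_hasCompactSupport
      (hc.fderiv_apply (𝕜 := ℝ) v)
  have h2 : Integrable h μ := hh.continuous.integrable_of_hasCompactSupport hc
  refine ⟨h1, ?_⟩
  have h3 := integral_mul_fderiv_eq_neg_fderiv_mul_of_integrable (μ := μ) (f := h)
    (g := fun _ ↦ (1 : ℝ)) (v := v) (by simpa using h1) (by simp) (by simpa using h2)
    (fun x _ ↦ hh.differentiable (by simp) x) (fun x _ ↦ differentiableAt_const _)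
  simpa using h3.symm

section DivergenceTheorem

variable {n : ℕ} {M : Type*} [TopologicalSpace M] [ChartedSpace (EuclideanSpace ℝ (Fin n)) M]
  [IsManifold (𝓡 n) ∞ M] [RiemannianBundle (fun x : M ↦ TangentSpace (𝓡 n) x)]
  [IsContMDiffRiemannianBundle (𝓡 n) ∞ (EuclideanSpace ℝ (Fin n))
    (fun x : M ↦ TangentSpace (𝓡 n) x)]
  {p : M} {X : Π x : M, TangentSpace (𝓡 n) x}

/-- A function on the domain of the chart at `p`, read in the chart, times the volume density,
extended by zero outside the range of the chart. -/
def chartDensity (p : M) (g : M → ℝ) : EuclideanSpace ℝ (Fin n) → ℝ :=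
  (extChartAt (𝓡 n) p).target.indicator
    fun u ↦ g ((extChartAt (𝓡 n) p).symm u) * volDensity p u

lemma chartIntegral_eq_integral_chartDensity (g : M → ℝ) :
    chartIntegral (n := n) p g = ∫ u, chartDensity (n := n) p g u :=
  (integral_indicator (isOpen_extChartAt_target (I := 𝓡 n) p).measurableSet).symm

variable {K : Set M} {g : M → ℝ} {u : EuclideanSpace ℝ (Fin n)}

lemma chartDensity_eq_zero (hg : ∀ y ∉ K, g y = 0) (hu : u ∉ extChartAt (𝓡 n) p '' K) :
    chartDensity p g u = 0 := by
  rw [chartDensity, Set.indicator_apply_eq_zero]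
  intro hut
  rw [hg _ fun hK ↦ hu ⟨_, hK, (extChartAt (𝓡 n) p).right_inv hut⟩, zero_mul]

lemma chartDensity_eventuallyEq (hu : u ∈ (extChartAt (𝓡 n) p).target) :
    chartDensity p g =ᶠ[𝓝 u] fun u ↦ g ((extChartAt (𝓡 n) p).symm u) * volDensity p u := by
  filter_upwards [(isOpen_extChartAt_target p).mem_nhds hu] with z hz
  rw [chartDensity, Set.indicator_of_mem hz]

lemma contDiffAt_chartDensity (hg : ∀ y ∈ (extChartAt (𝓡 n) p).source,
    ContMDiffAt (𝓡 n) 𝓘(ℝ, ℝ) ∞ g y) (hu : u ∈ (extChartAt (𝓡 n) p).target) :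
    ContDiffAt ℝ ∞ (chartDensity p g) u :=
  ((contDiffAt_comp_symm hu (hg _ ((extChartAt (𝓡 n) p).map_target hu))).mul
    (contDiffAt_volDensity hu)).congr_of_eventuallyEq (chartDensity_eventuallyEq hu)

lemma tsupport_chartDensity_subset (hK : IsCompact K) (hKp : K ⊆ (extChartAt (𝓡 n) p).source)
    (hg0 : ∀ y ∉ K, g y = 0) :
    tsupport (chartDensity (n := n) p g) ⊆ extChartAt (𝓡 n) p '' K :=
  closure_minimal (fun _ hz ↦ by_contra fun h ↦ hz (chartDensity_eq_zero hg0 h))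
    (hK.image_of_continuousOn ((continuousOn_extChartAt p).mono hKp)).isClosed

lemma hasCompactSupport_chartDensity (hK : IsCompact K)
    (hKp : K ⊆ (extChartAt (𝓡 n) p).source) (hg0 : ∀ y ∉ K, g y = 0) :
    HasCompactSupport (chartDensity (n := n) p g) :=
  .intro (hK.image_of_continuousOn ((continuousOn_extChartAt p).mono hKp))
    fun _ hu ↦ chartDensity_eq_zero hg0 hu

lemma contDiff_chartDensity (hg : ∀ y ∈ (extChartAt (𝓡 n) p).source,
    ContMDiffAt (𝓡 n) 𝓘(ℝ, ℝ) ∞ g y) (hK : IsCompact K)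
    (hKp : K ⊆ (extChartAt (𝓡 n) p).source) (hg0 : ∀ y ∉ K, g y = 0) :
    ContDiff ℝ ∞ (chartDensity (n := n) p g) := by
  refine contDiff_iff_contDiffAt.2 fun u ↦ ?_
  by_cases hu : u ∈ tsupport (chartDensity p g)
  · obtain ⟨y, hy, rfl⟩ := tsupport_chartDensity_subset hK hKp hg0 hu
    exact contDiffAt_chartDensity hg ((extChartAt (𝓡 n) p).map_source (hKp hy))
  · exact contDiffAt_const.congr_of_eventuallyEq (notMem_tsupport_iff_eventuallyEq.1 hu)

/-- `√(det g) div X = ∑_i ∂_i (√(det g) X^i)`. -/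
lemma divergence_mul_volDensity (hX : ∀ y, VFSmoothAt X y)
    (hu : u ∈ (extChartAt (𝓡 n) p).target) :
    divergence X ((extChartAt (𝓡 n) p).symm u) * volDensity p u
      = ∑ i, fderiv ℝ (chartDensity p (coordComp p X i)) u
        (EuclideanSpace.single i (1 : ℝ) : EuclideanSpace ℝ (Fin n)) := by
  have hx := (extChartAt (𝓡 n) p).map_target hu
  rw [divergence_eq_coord hx (hX _), Finset.sum_mul]
  refine Finset.sum_congr rfl fun i _ ↦ ?_
  have h1 := hasDerivAt_coord_line hu i
    ((contMDiffAt_coordComp hx (hX _) i).mdifferentiableAt (by simp))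
  have h2 := h1.mul (hasDerivAt_volDensity_line hu i)
  have h3 : HasDerivAt (fun t : ℝ ↦ u + t • (EuclideanSpace.single i (1 : ℝ) :
      EuclideanSpace ℝ (Fin n))) (EuclideanSpace.single i (1 : ℝ)) 0 := by
    simpa using ((hasDerivAt_id (0 : ℝ)).smul_const
      (EuclideanSpace.single i (1 : ℝ) : EuclideanSpace ℝ (Fin n))).const_add u
  have h4 := ((contDiffAt_chartDensity (fun y hy ↦ contMDiffAt_coordComp hy (hX y) i)
    hu).differentiableAt (by simp)).hasFDerivAt
  have h5 := h4.comp_hasDerivAt_of_eq (0 : ℝ) h3 (by simp)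
  have h6 := h5.unique (h2.congr_of_eventuallyEq ?_)
  · rw [h6, ← coordField_symm hu, zero_smul, add_zero]
    ring
  · filter_upwards [eventually_line_mem hu (EuclideanSpace.single i 1)] with t ht
    exact (chartDensity_eventuallyEq ht).eq_of_nhds

/-- The divergence theorem for vector fields with compact support in the domain of a chart. -/
lemma chartIntegral_divergence (hX : ∀ y, VFSmoothAt X y) (hK : IsCompact K)
    (hKp : K ⊆ (extChartAt (𝓡 n) p).source) (hX0 : ∀ y ∉ K, X y = 0) :
    IntegrableOn (fun u ↦ divergence X ((extChartAt (𝓡 n) p).symm u) * volDensity p u)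
        (extChartAt (𝓡 n) p).target ∧
      chartIntegral (n := n) p (divergence X) = 0 := by
  have ho : MeasurableSet (extChartAt (𝓡 n) p).target :=
    (isOpen_extChartAt_target (I := 𝓡 n) p).measurableSet
  have h0 : ∀ i, ∀ y ∉ K, coordComp p X i y = 0 := by
    intro i y hy
    rw [coordComp, hX0 y hy, map_zero]
  have h := fun i ↦ contDiff_chartDensity (fun y hy ↦ contMDiffAt_coordComp hy (hX y) i)
    hK hKp (h0 i)
  have h1 := fun i ↦ integral_fderiv_apply_eq_zero volume ((h i).of_le (by norm_cast))
    (hasCompactSupport_chartDensity hK hKp (h0 i))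
    (EuclideanSpace.single i (1 : ℝ) : EuclideanSpace ℝ (Fin n))
  have h2 : Integrable (fun u ↦ ∑ i, fderiv ℝ (chartDensity p (coordComp p X i)) u
      (EuclideanSpace.single i (1 : ℝ) : EuclideanSpace ℝ (Fin n))) :=
    integrable_finsetSum _ fun i _ ↦ (h1 i).1
  have h3 : ∀ u ∈ (extChartAt (𝓡 n) p).target, _ :=
    fun u hu ↦ divergence_mul_volDensity hX hu
  refine ⟨h2.integrableOn.congr_fun (fun u hu ↦ (h3 u hu).symm) ho, ?_⟩
  have h4 : ∀ u ∉ (extChartAt (𝓡 n) p).target, ∑ i, fderiv ℝ (chartDensity p (coordComp p X i)) u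
      (EuclideanSpace.single i (1 : ℝ) : EuclideanSpace ℝ (Fin n)) = 0 := by
    intro u hu
    refine Finset.sum_eq_zero fun i _ ↦ ?_
    have h5 : u ∉ tsupport (chartDensity p (coordComp p X i)) := by
      intro h6
      obtain ⟨y, hy, rfl⟩ := tsupport_chartDensity_subset hK hKp (h0 i) h6
      exact hu ((extChartAt (𝓡 n) p).map_source (hKp hy))
    rw [fderiv_of_notMem_tsupport (𝕜 := ℝ) h5]
    rfl
  rw [chartIntegral, setIntegral_congr_fun ho h3,
    setIntegral_eq_integral_of_forall_compl_eq_zero h4,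
    integral_finsetSum _ fun i _ ↦ (h1 i).1]
  exact Finset.sum_eq_zero fun i _ ↦ (h1 i).2

/-- Integrands that differ by a divergence have the same integral, also if they fail to be
integrable. -/
lemma chartIntegral_congr_of_divergence (hX : ∀ y, VFSmoothAt X y) (hK : IsCompact K)
    (hKp : K ⊆ (extChartAt (𝓡 n) p).source) (hX0 : ∀ y ∉ K, X y = 0) {f g : M → ℝ}
    (hfg : ∀ y, divergence X y = f y - g y) :
    chartIntegral (n := n) p f = chartIntegral (n := n) p g := by
  obtain ⟨h1, h2⟩ := chartIntegral_divergence hX hK hKp hX0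
  set S := (extChartAt (𝓡 n) p).target
  have h3 : ∀ u, f ((extChartAt (𝓡 n) p).symm u) * volDensity p u
      = g ((extChartAt (𝓡 n) p).symm u) * volDensity p u
        + divergence X ((extChartAt (𝓡 n) p).symm u) * volDensity p u := by
    intro u
    rw [hfg]
    ring
  by_cases hg : IntegrableOn (fun u ↦ g ((extChartAt (𝓡 n) p).symm u) * volDensity p u) S
  · rw [chartIntegral, chartIntegral]
    simp only [h3]
    rw [integral_add hg h1]
    exact (congrArg _ h2).trans (add_zero _)
  · have hf : ¬ IntegrableOn (fun u ↦ f ((extChartAt (𝓡 n) p).symm u) * volDensity p u) S := by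
      refine fun hf ↦ hg ((hf.sub h1).congr (.of_forall fun u ↦ ?_))
      simp only [Pi.sub_apply, h3]
      ring
    rw [chartIntegral, chartIntegral, integral_undef hf, integral_undef hg]

end DivergenceTheorem

/-! ### The formal adjoint of the covariant exterior derivative -/

section FormalAdjoint

variable {n : ℕ} {M : Type*} [TopologicalSpace M] [ChartedSpace (EuclideanSpace ℝ (Fin n)) M]
  [IsManifold (𝓡 n) ∞ M] [RiemannianBundle (fun x : M ↦ TangentSpace (𝓡 n) x)]
  {F : Type*} [NormedAddCommGroup F] [NormedSpace ℝ F]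
  {V : M → Type*} [TopologicalSpace (TotalSpace F V)]
  [∀ x, NormedAddCommGroup (V x)] [∀ x, InnerProductSpace ℝ (V x)]
  [FiberBundle F V] [VectorBundle ℝ F V] {k : ℕ} {x : M}

lemma formInner_comm (α β : (Fin k → TangentSpace (𝓡 n) x) → V x) :
    formInner x α β = formInner x β α := by
  simp only [formInner, real_inner_comm]

lemma formInner_sub_right (α β γ : (Fin k → TangentSpace (𝓡 n) x) → V x) :
    formInner x α (β - γ) = formInner x α β - formInner x α γ := by
  simp [formInner, inner_sub_right, Finset.sum_sub_distrib, mul_sub]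

lemma formInner_smul_left (r : ℝ) (α β : (Fin k → TangentSpace (𝓡 n) x) → V x) :
    formInner x (fun w ↦ r • α w) β = r * formInner x α β := by
  simp only [formInner, real_inner_smul_left, ← Finset.mul_sum]
  ring

lemma formInner_self_nonneg (α : (Fin k → TangentSpace (𝓡 n) x) → V x) :
    0 ≤ formInner x α α :=
  mul_nonneg (by positivity) (Finset.sum_nonneg fun _ _ ↦ real_inner_self_nonneg)

lemma eq_zero_of_formInner_self {α : TangentSpace (𝓡 n) x [⋀^Fin k]→L[ℝ] V x}
    (h : formInner x α α = 0) : α = 0 := by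
  have h1 := (mul_eq_zero.1 h).resolve_left (by positivity)
  rw [Finset.sum_eq_zero_iff_of_nonneg fun _ _ ↦ real_inner_self_nonneg] at h1
  have h2 : α.toAlternatingMap = 0 := by
    refine (frame x).toBasis.ext_alternating fun J _ ↦ ?_
    have h3 := inner_self_eq_zero.1 (h1 J (Finset.mem_univ J))
    simpa using h3
  ext w
  exact DFunLike.congr_fun h2 w

variable [ContMDiffVectorBundle ∞ F V (𝓡 n)]
  [IsContMDiffRiemannianBundle (𝓡 n) ∞ (EuclideanSpace ℝ (Fin n))
    (fun x : M ↦ TangentSpace (𝓡 n) x)] [IsContMDiffRiemannianBundle (𝓡 n) ∞ F V]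
  [FiniteDimensional ℝ F] [T2Space M]
  {cov : CovariantDerivative (𝓡 n) F V} [CovariantDerivative.ContMDiffCovariantDerivative cov ∞]
  {φ : Π x : M, TangentSpace (𝓡 n) x [⋀^Fin (k + 1)]→L[ℝ] V x}

lemma isAdjointImage_codiffForm (hcov : cov.IsMetricCompatible) (hφ : IsSmooth F φ) :
    IsAdjointImage cov φ (codiffForm cov hφ) := by
  refine ⟨isSmooth_codiffForm hφ, fun p η hη ⟨K, hK, hKp, hη0⟩ ↦ ?_⟩
  refine chartIntegral_congr_of_divergence (X := adjointField η φ)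
    (fun y ↦ vfSmoothAt_adjointField (hη.formSmoothAt y) (hφ.formSmoothAt y)) hK
    (by rwa [extChartAt_source]) (fun y hy ↦ ?_) (divergence_adjointField hcov hη hφ)
  simp [adjointField, hη0 y hy, formInner]

/-- The image of a form under the formal adjoint is unique: the difference of two images, times a
bump function, is a test form. -/
lemma IsAdjointImage.unique {ψ ψ' : Π x : M, TangentSpace (𝓡 n) x [⋀^Fin k]→L[ℝ] V x}
    (hψ : IsAdjointImage cov φ ψ) (hψ' : IsAdjointImage cov φ ψ') : ψ = ψ' := by
  ext1 x
  obtain ⟨f⟩ : Nonempty (SmoothBumpFunction (𝓡 n) x) := inferInstance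
  have hK : IsCompact (tsupport f) := f.hasCompactSupport
  have hKp : tsupport f ⊆ (chartAt (EuclideanSpace ℝ (Fin n)) x).source :=
    f.tsupport_subset_chartAt_source
  have hKp' : tsupport f ⊆ (extChartAt (𝓡 n) x).source := by rwa [extChartAt_source]
  have hf0 : ∀ y ∉ tsupport f, f y = 0 := fun y hy ↦ image_eq_zero_of_notMem_tsupport hy
  have hfs : ∀ y, ContMDiffAt (𝓡 n) 𝓘(ℝ, ℝ) ∞ f y := fun y ↦ f.contMDiff y
  let δ : Π x : M, TangentSpace (𝓡 n) x [⋀^Fin k]→L[ℝ] V x := fun y ↦ ψ y - ψ' y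
  have hδ : IsSmooth F δ := fun y ↦ ContMDiffAt.sub_section (hψ.1 y) (hψ'.1 y)
  let η : Π x : M, TangentSpace (𝓡 n) x [⋀^Fin k]→L[ℝ] V x := fun y ↦ f y • δ y
  have hη : IsSmooth F η := fun y ↦ ContMDiffAt.smul_section (hfs y) (hδ y)
  have hη0 : ∀ y ∉ tsupport f, η y = 0 := fun y hy ↦ by
    change f y • δ y = 0
    rw [hf0 y hy, zero_smul]
  have h1 := (hψ.2 x η hη ⟨_, hK, hKp, hη0⟩).symm.trans (hψ'.2 x η hη ⟨_, hK, hKp, hη0⟩)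
  have h2 : ∀ θ : Π x : M, TangentSpace (𝓡 n) x [⋀^Fin k]→L[ℝ] V x, IsSmooth F θ →
      Continuous (chartDensity (n := n) x fun y ↦ formInner y (η y) (θ y)) ∧
        HasCompactSupport (chartDensity (n := n) x fun y ↦ formInner y (η y) (θ y)) := by
    intro θ hθ
    have h3 : ∀ y ∉ tsupport f, formInner y (η y) (θ y) = 0 := fun y hy ↦ by
      simp [hη0 y hy, formInner]
    exact ⟨(contDiff_chartDensity (fun y _ ↦ contMDiffAt_formInner (hη.formSmoothAt y)
      (hθ.formSmoothAt y)) hK hKp' h3).continuous, hasCompactSupport_chartDensity hK hKp' h3⟩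
  have h4 : ∫ u, chartDensity (n := n) x (fun y ↦ formInner y (η y) (δ y)) u = 0 := by
    rw [chartIntegral_eq_integral_chartDensity, chartIntegral_eq_integral_chartDensity,
      ← sub_eq_zero, ← integral_sub ((h2 ψ hψ.1).1.integrable_of_hasCompactSupport (h2 ψ hψ.1).2)
      ((h2 ψ' hψ'.1).1.integrable_of_hasCompactSupport (h2 ψ' hψ'.1).2)] at h1
    rw [← h1]
    refine integral_congr_ae (.of_forall fun u ↦ ?_)
    by_cases hu : u ∈ (extChartAt (𝓡 n) x).target
    · have h5 := formInner_sub_right (η ((extChartAt (𝓡 n) x).symm u))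
        (ψ ((extChartAt (𝓡 n) x).symm u)) (ψ' ((extChartAt (𝓡 n) x).symm u))
      simp only [chartDensity, Set.indicator_of_mem hu, ← sub_mul]
      exact congrArg (· * volDensity x u) h5
    · simp only [chartDensity, Set.indicator_of_notMem hu, sub_zero]
  have h6 : ∀ y, formInner y (η y) (δ y) = f y * formInner y (δ y) (δ y) :=
    fun y ↦ formInner_smul_left _ _ _
  have h7 : 0 ≤ chartDensity (n := n) x fun y ↦ formInner y (η y) (δ y) := by
    refine fun u ↦ Set.indicator_nonneg (fun u hu ↦ ?_) u
    simp only [h6]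
    exact mul_nonneg (mul_nonneg f.nonneg (formInner_self_nonneg _)) (volDensity_pos hu).le
  by_contra hne
  refine ((h2 δ hδ).1.integral_pos_of_hasCompactSupport_nonneg_nonzero (μ := volume) (h2 δ hδ).2 h7
    (x := extChartAt (𝓡 n) x x) ?_).ne' h4
  have hxt := mem_extChartAt_target (I := 𝓡 n) x
  rw [chartDensity, Set.indicator_of_mem hxt, extChartAt_to_inv, h6, f.eq_one, one_mul]
  refine mul_ne_zero (fun h8 ↦ hne ?_) (volDensity_pos hxt).ne'
  exact sub_eq_zero.1 (eq_zero_of_formInner_self h8)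

lemma covCodiff_eq_codiffForm (hcov : cov.IsMetricCompatible) (hφ : IsSmooth F φ) :
    covCodiff cov φ = codiffForm cov hφ := by
  have h : ∃ ψ, IsAdjointImage cov φ ψ := ⟨_, isAdjointImage_codiffForm hcov hφ⟩
  rw [covCodiff, dif_pos h]
  exact h.choose_spec.unique (isAdjointImage_codiffForm hcov hφ)

end FormalAdjoint

/-! ### Letting the constants tend to infinity -/

lemma tendsto_div_one_add_mul {m : ℝ} (hm : m ≠ 0) :
    Filter.Tendsto (fun c : ℝ ↦ c / (1 + m * c)) Filter.atTop (𝓝 (1 / m)) := by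
  have h : Filter.Tendsto (fun c : ℝ ↦ (c⁻¹ + m)⁻¹) Filter.atTop (𝓝 (0 + m)⁻¹) :=
    (tendsto_inv_atTop_zero.add tendsto_const_nhds).inv₀ (by simpa using hm)
  rw [zero_add, ← one_div] at h
  refine h.congr' ?_
  filter_upwards [Filter.eventually_gt_atTop 0] with c hc
  field_simp

/-- If the term `B` with coefficient `c` vanishes then `c` may be chosen freely, and letting it
tend to infinity turns the constant `c / (1 + m c)` into `1 / m`. For `m = 0` the value `1 / m` is
`0`, which is also the value of the constant at `c = 0`. -/
lemma min_katoConst_mul_le {P : Prop} {m c g t N B : ℝ} (hP : P → B = 0) (hc : 0 ≤ c)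
    (h : ∀ c, 0 ≤ c → (1 + min (c / (1 + m * c)) g) * t ≤ N + c * B) :
    (1 + min (katoConst P m c) g) * t ≤ N + c * B := by
  by_cases hP' : P
  · rw [katoConst, if_pos hP', hP hP', mul_zero, add_zero]
    simp only [hP hP', mul_zero, add_zero] at h
    rcases eq_or_ne m 0 with rfl | hm
    · simpa using h 0 le_rfl
    · refine le_of_tendsto ((((tendsto_div_one_add_mul hm).min
        (tendsto_const_nhds (x := g))).const_add 1).mul_const t) ?_
      filter_upwards [Filter.eventually_ge_atTop 0] with c hc using h c hc
  · rw [katoConst, if_neg hP']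
    exact h c hc

/-! ### Degree zero -/

section DegreeZero

variable {n : ℕ} {H : Type*} [NormedAddCommGroup H] [InnerProductSpace ℝ H]

lemma arrayInner_zero (a b : (Fin 0 → Fin n) → H) :
    arrayInner a b = inner ℝ (a default) (b default) := by
  simp [arrayInner]

lemma arrayInner_wedge_zero (α : Fin n → (Fin 0 → Fin n) → H) :
    arrayInner (wedgeArray α) (wedgeArray α) = ∑ i, arrayInner (α i) (α i) := by
  simp only [arrayInner_zero]
  rw [arrayInner, ← (Equiv.funUnique (Fin 1) (Fin n)).symm.sum_comp]
  simp [wedgeArray, Subsingleton.elim _ (default : Fin 0 → Fin n)]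

/-- The refined Kato inequality in degree `0`, where the wedge product of `α` is `α` itself. -/
lemma kato_array_zero {α : Fin n → (Fin 0 → Fin n) → H} {f : (Fin 0 → Fin n) → H}
    (hf1 : arrayInner f f = 1) {ξ : Fin n → ℝ} (hξ : ∀ i, arrayInner (α i) f = ξ i)
    {P : Prop} {c g : ℝ} (hc : 0 ≤ c) (hP : P → arrayInner (wedgeArray α) (wedgeArray α) = 0) :
    (1 + min (katoConst P 0 c) g) * ∑ i, ξ i ^ 2
      ≤ ∑ i, arrayInner (α i) (α i) + c * arrayInner (wedgeArray α) (wedgeArray α) := by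
  refine min_katoConst_mul_le hP hc fun c hc ↦ ?_
  have h1 : ∑ i, ξ i ^ 2 ≤ ∑ i, arrayInner (α i) (α i) := by
    refine Finset.sum_le_sum fun i _ ↦ ?_
    have h2 := real_inner_mul_inner_self_le (α i default) (f default)
    rw [arrayInner_zero] at hf1
    rw [← hξ, arrayInner_zero, arrayInner_zero, sq]
    rwa [hf1, mul_one] at h2
  have h3 : 0 ≤ ∑ i, ξ i ^ 2 := Finset.sum_nonneg fun i _ ↦ sq_nonneg _
  rw [arrayInner_wedge_zero]
  have h4 := min_le_left (c / (1 + 0 * c)) g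
  rw [zero_mul, add_zero, div_one] at h4 ⊢
  calc _ ≤ (1 + c) * ∑ i, ξ i ^ 2 := by gcongr
    _ ≤ (1 + c) * ∑ i, arrayInner (α i) (α i) := by gcongr
    _ = _ := by ring

end DegreeZero

/-! ### The components of the covariant derivative -/

section Kato

variable {n : ℕ} {M : Type*} [TopologicalSpace M] [ChartedSpace (EuclideanSpace ℝ (Fin n)) M]
  [IsManifold (𝓡 n) ∞ M] [RiemannianBundle (fun x : M ↦ TangentSpace (𝓡 n) x)]
  [IsContMDiffRiemannianBundle (𝓡 n) ∞ (EuclideanSpace ℝ (Fin n))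
    (fun x : M ↦ TangentSpace (𝓡 n) x)]
  {F : Type*} [NormedAddCommGroup F] [NormedSpace ℝ F]
  {V : M → Type*} [TopologicalSpace (TotalSpace F V)]
  [∀ x, NormedAddCommGroup (V x)] [∀ x, InnerProductSpace ℝ (V x)]
  [FiberBundle F V] [VectorBundle ℝ F V] [ContMDiffVectorBundle ∞ F V (𝓡 n)]
  [IsContMDiffRiemannianBundle (𝓡 n) ∞ F V]
  {k : ℕ} {x : M} {cov : CovariantDerivative (𝓡 n) F V}
  {φ : Π x : M, TangentSpace (𝓡 n) x [⋀^Fin k]→L[ℝ] V x}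

lemma formInner_self_pos (hx : φ x ≠ 0) : 0 < formInner x (φ x) (φ x) :=
  (formInner_self_nonneg _).lt_of_ne fun h ↦ hx (eq_zero_of_formInner_self h.symm)

lemma degree_le_of_ne_zero (hx : φ x ≠ 0) : k ≤ n := by
  by_contra! hk
  refine hx (eq_zero_of_formInner_self ?_)
  rw [formInner, Finset.sum_eq_zero fun J _ ↦ ?_, mul_zero]
  have hJ : ¬ Function.Injective J := fun hJ ↦ by
    exact hk.not_ge (by simpa using Fintype.card_le_of_injective J hJ)
  have h : φ x (fun a ↦ frame x (J a)) = 0 :=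
    (φ x).toAlternatingMap.map_eq_zero_of_not_injective _ fun h ↦ hJ (.of_comp h)
  rw [h, inner_zero_left]

/-- `d|φ| = ⟨∇φ, φ⟩ / |φ|` where `φ` does not vanish. -/
lemma mvfderiv_sqrt_formInner [FiniteDimensional ℝ F] (hcov : cov.IsMetricCompatible)
    (hφ : FormSmoothAt F φ x) (hx : φ x ≠ 0) (v : TangentSpace (𝓡 n) x) :
    mvfderiv (𝓡 n) (fun y ↦ √(formInner y (φ y) (φ y))) x v
      = formInner x (nabla cov φ x v) (φ x) / √(formInner x (φ x) (φ x)) := by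
  have hq := formInner_self_pos hx
  have h1 := mvfderiv_formInner hcov hφ.formDiffAt hφ.formDiffAt v
  have h2 : MDifferentiableAt (𝓡 n) 𝓘(ℝ, ℝ) (fun y ↦ formInner y (φ y) (φ y)) x :=
    (contMDiffAt_formInner hφ hφ).mdifferentiableAt (by simp)
  have h3 := ((Real.hasDerivAt_sqrt hq.ne').hasFDerivAt.hasMFDerivAt).comp x h2.hasMFDerivAt
  have h4 : mvfderiv (𝓡 n) (fun y ↦ √(formInner y (φ y) (φ y))) x v
      = mvfderiv (𝓡 n) (fun y ↦ formInner y (φ y) (φ y)) x v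
        * (1 / (2 * √(formInner x (φ x) (φ x)))) :=
    congrArg (fun L ↦ L v) h3.mfderiv
  rw [h4, h1, formInner_comm (φ x : (Fin k → TangentSpace (𝓡 n) x) → V x)]
  have := Real.sqrt_pos.2 hq
  field_simp
  ring

/-- The components of `∇φ` in the orthonormal frame at `x`. -/
def nablaArray (cov : CovariantDerivative (𝓡 n) F V)
    (φ : Π x : M, TangentSpace (𝓡 n) x [⋀^Fin k]→L[ℝ] V x) (x : M) (i : Fin n)
    (J : Fin k → Fin n) : V x :=
  nabla cov φ x (frame x i) fun a ↦ frame x (J a)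

/-- The components of `φ / |φ|` in the orthonormal frame at `x`. -/
def unitArray (φ : Π x : M, TangentSpace (𝓡 n) x [⋀^Fin k]→L[ℝ] V x) (x : M) :
    (Fin k → Fin n) → V x :=
  (√(formInner x (φ x) (φ x)))⁻¹ • fun J ↦ φ x fun a ↦ frame x (J a)

lemma isAltArray_nablaArray (hφ : FormDiffAt F φ x) (i : Fin n) :
    IsAltArray (nablaArray cov φ x i) :=
  isAltArray_form (nablaAlternating cov hφ (frame x i)) (frame x)

lemma isAltArray_unitArray : IsAltArray (unitArray φ x) :=
  (isAltArray_form (φ x).toAlternatingMap (frame x)).smul _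

lemma arrayInner_unitArray (hx : φ x ≠ 0) : arrayInner (unitArray φ x) (unitArray φ x) = 1 := by
  have hq := formInner_self_pos hx
  rw [unitArray, arrayInner_smul_left, arrayInner_smul_right, ← formInner_eq_arrayInner]
  have := Real.mul_self_sqrt hq.le
  have := Real.sqrt_pos.2 hq
  field_simp
  linarith

lemma arrayInner_nablaArray_unitArray [FiniteDimensional ℝ F] (hcov : cov.IsMetricCompatible)
    (hφ : FormSmoothAt F φ x) (hx : φ x ≠ 0) (i : Fin n) :
    arrayInner (nablaArray cov φ x i) (unitArray φ x)
      = mvfderiv (𝓡 n) (fun y ↦ √(formInner y (φ y) (φ y))) x (frame x i) := by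
  rw [mvfderiv_sqrt_formInner hcov hφ hx, unitArray, arrayInner_smul_right, div_eq_inv_mul]
  rfl

lemma covExtDeriv_array : (fun J : Fin (k + 1) → Fin n ↦ covExtDeriv cov φ x fun a ↦ frame x (J a))
    = wedgeArray (nablaArray cov φ x) := by
  ext1 J
  rw [covExtDeriv_eq_sum_nabla]
  rfl

lemma formInner_codiffForm {φ : Π x : M, TangentSpace (𝓡 n) x [⋀^Fin (k + 1)]→L[ℝ] V x}
    (hφ : IsSmooth F φ) :
    formInner x (codiffForm cov hφ x) (codiffForm cov hφ x)
      = arrayInner (traceArray (nablaArray cov φ x)) (traceArray (nablaArray cov φ x)) := by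
  have h : (fun J : Fin k → Fin n ↦ codiffForm cov hφ x fun a ↦ frame x (J a))
      = (-1 : ℝ) • traceArray (nablaArray cov φ x) := by
    ext1 J
    rw [codiffForm_apply, Pi.smul_apply, neg_one_smul, traceArray]
    congr 1
    refine Finset.sum_congr rfl fun i _ ↦ ?_
    rw [nablaArray]
    congr 1
    ext1 a
    refine Fin.cases ?_ (fun a ↦ ?_) a <;> simp
  rw [formInner_eq_arrayInner, h, arrayInner_smul_left, arrayInner_smul_right]
  ring

end Kato

end TwistedForm

end

open TwistedForm

theorem theorem1p2 {n k : ℕ}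
    {M : Type*} [TopologicalSpace M] [T2Space M]
    [ChartedSpace (EuclideanSpace ℝ (Fin n)) M] [IsManifold (𝓡 n) ∞ M]
    [RiemannianBundle (fun x : M ↦ TangentSpace (𝓡 n) x)]
    [IsContMDiffRiemannianBundle (𝓡 n) ∞ (EuclideanSpace ℝ (Fin n))
      (fun x : M ↦ TangentSpace (𝓡 n) x)]
    {F : Type*} [NormedAddCommGroup F] [NormedSpace ℝ F] [FiniteDimensional ℝ F]
    {V : M → Type*} [TopologicalSpace (TotalSpace F V)]
    [∀ x, NormedAddCommGroup (V x)] [∀ x, InnerProductSpace ℝ (V x)]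
    [FiberBundle F V] [VectorBundle ℝ F V] [ContMDiffVectorBundle ∞ F V (𝓡 n)]
    [IsContMDiffRiemannianBundle (𝓡 n) ∞ F V]
    (cov : CovariantDerivative (𝓡 n) F V) [CovariantDerivative.ContMDiffCovariantDerivative cov ∞]
    (hcov : cov.IsMetricCompatible)
    (c cs : ℝ) (hc : 0 ≤ c) (hcs : 0 ≤ cs)
    (φ : Π x : M, TangentSpace (𝓡 n) x [⋀^Fin k]→L[ℝ] V x) (hφ : TwistedForm.IsSmooth F φ)
    (x : M) (hx : φ x ≠ 0) :
    TwistedForm.nablaNormSq cov φ x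
        + c * TwistedForm.formInner x
            (TwistedForm.covExtDeriv cov φ x) (TwistedForm.covExtDeriv cov φ x)
        + cs * TwistedForm.formInner x
            (TwistedForm.covCodiff cov φ x) (TwistedForm.covCodiff cov φ x)
      ≥ (1 + min (TwistedForm.katoConst (TwistedForm.covExtDeriv cov φ x = 0) k c)
            (TwistedForm.katoConst (TwistedForm.covCodiff cov φ x = 0) ((n : ℝ) - k) cs))
          * TwistedForm.diffNormSq (n := n) (fun y ↦ √(TwistedForm.formInner y (φ y) (φ y))) x := by
  have hξ := arrayInner_nablaArray_unitArray hcov (hφ.formSmoothAt x) hx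
  have hd : formInner x (covExtDeriv cov φ x) (covExtDeriv cov φ x)
      = arrayInner (wedgeArray (nablaArray cov φ x)) (wedgeArray (nablaArray cov φ x)) := by
    rw [formInner_eq_arrayInner, covExtDeriv_array]
  have hd0 : covExtDeriv cov φ x = 0 →
      arrayInner (wedgeArray (nablaArray cov φ x)) (wedgeArray (nablaArray cov φ x)) = 0 := by
    intro h
    rw [← hd, h]
    simp [formInner]
  rw [hd]
  cases k with
  | zero =>
    -- In degree `0` the codifferential is zero by definition.
    have h0 : formInner x (covCodiff cov φ x) (covCodiff cov φ x) = 0 := by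
      simp [covCodiff, formInner]
    rw [h0, mul_zero, add_zero, Nat.cast_zero]
    exact kato_array_zero (arrayInner_unitArray hx) hξ hc hd0
  | succ k =>
    have hs : formInner x (covCodiff cov φ x) (covCodiff cov φ x)
        = arrayInner (traceArray (nablaArray cov φ x)) (traceArray (nablaArray cov φ x)) := by
      rw [covCodiff_eq_codiffForm hcov hφ]
      exact formInner_codiffForm hφ
    have hs0 : covCodiff cov φ x = 0 →
        arrayInner (traceArray (nablaArray cov φ x)) (traceArray (nablaArray cov φ x)) = 0 := by
      intro h
      rw [← hs, h]
      simp [formInner]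
    -- The two constants are treated one after the other, `min_comm` exchanging their roles.
    rw [hs, min_comm]
    refine min_katoConst_mul_le hs0 hcs fun cs hcs ↦ ?_
    rw [min_comm, add_right_comm (nablaNormSq cov φ x)]
    refine min_katoConst_mul_le hd0 hc fun c hc ↦ ?_
    rw [add_right_comm (nablaNormSq cov φ x)]
    exact kato_array (isAltArray_nablaArray (hφ.formSmoothAt x).formDiffAt) isAltArray_unitArray
      (arrayInner_unitArray hx) hξ (degree_le_of_ne_zero hx) hc hcs
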